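/- **Setting.** Consider the uplink of a network with $L$ cells, $K$ single-antenna users per cell, and $N$ antennas per base station, arranged in $A\ge 1$ subarrays of $N/A$ antennas. The channel from user $k$ of cell $l$ to the antennas of base station $j$ is $h_{jlk}\sim\mathcal{CN}(0,\Lambda_{jlk})$, independent over users, with $\Lambda_{jlk}=\mathrm{diag}(\tilde\lambda^{(1)}_{jlk},\dots,\tilde\lambda^{(A)}_{jlk})\otimes I_{N/A}$, where $\tilde\lambda^{(a)}_{jlk}\ge0$ do not depend on $N$ and, for all $j,k$, $\tilde\lambda^{(a)}_{jjk}>0$ for at least one $a$. It is constant over a block of $T$ channel uses. User $k$ of cell $l$ sends fixed complex pilot symbols $x_{lk}(\tau_1),\dots,x_{lk}(\tau_B)$ at $B\ge 1$ distinct times $\tau_b\in\{1,\dots,T\}$ and data symbols of energy $p_{lk}>0$ at the other times. Base station $j$ receives $$y_j(s)=D_{\phi_j(s)}\sum_{l,k}h_{jlk}x_{lk}(s)+\upsilon_j(s)+\eta_j(s),\qquad D_{\phi_j(s)}=\mathrm{diag}(e^{i\phi_{j1}(s)},\dots,e^{i\phi_{jN}(s)}).$$ Here the phase-drifts are $\phi_{jn}(s)=\phi_{jn}(s-1)+\mathcal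 N(0,\delta)$ with independent increments. They are identical for all antennas of a base station with a common local oscillator (CLO), and they have increments independent over the antennas with separate local oscillators (SLOs). Given the channels, the distortion noise $\upsilon_j(s)$ is independent over antennas and times and distributed as $\mathcal{CN}\big(0,\kappa^2\sum_{l,k}\mathbb E|x_{lk}(s)|^2\,\mathrm{diag}(|h^{(1)}_{jlk}|^2,\dots,|h^{(N)}_{jlk}|^2)\big)$. The receiver noise is $\eta_j(s)\sim\mathcal{CN}(0,\xi I_N)$, independent over times. Channels, phase-drifts and receiver noise are independent, and $\upsilon_j$ depends on them only through the channels. Let $h_{jlk}(t)=D_{\phi_j(t)}h_{jlk}$, let $\psi_j$ be the vector of all received pilot signals $y_j(\tau_1),\dots,y_j(\tau_B)$, and let the maximum ratio combining (MRC) filter $v_{jk}(t)=\mathbb E\{h_{jjk}(t)\psi_j^{\mathsf H}\}(\mathbb E\{\psi_j\psi_j^{\mathsf H}\})^{-1}\psi_j$ be the linear minimum mean-squared error estimate of $h_{jjk}(t)$. For a data time $t\in\{1,\dots,T\}\setminus\{\tau_1,\dots,\tau_B\}$ put $$\mathrm{SINR}_{jk}(t)=\frac{p_{jk}|\mathbb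 E\{v_{jk}^{\mathsf H}(t)h_{jjk}(t)\}|^2}{\sum_{l,m}p_{lm}\mathbb E\{|v_{jk}^{\mathsf H}(t)h_{jlm}(t)|^2\}-p_{jk}|\mathbb E\{v_{jk}^{\mathsf H}(t)h_{jjk}(t)\}|^2+\mathbb E\{|v_{jk}^{\mathsf H}(t)\upsilon_j(t)|^2\}+\xi\,\mathbb E\{\|v_{jk}(t)\|^2\}}.$$ **Claim.** Let $\kappa^2=\kappa_0^2N^{z_1}$, $\xi=\xi_0N^{z_2}$, $\delta=\delta_0(1+\log(N^{z_3}))$ with $z_1,z_2,z_3,\kappa_0,\delta_0\ge0$ and $\xi_0>0$, and let all pilot symbols be non-zero. Let $t$ be a data time, and assume $$\begin{cases}\max(z_1,z_2)\le\tfrac12\ \text{and}\ z_3=0 & \text{for a CLO},\\ \max(z_1,z_2)+z_3\min_{b}\frac{\delta_0|t-\tau_b|}{2}\le\tfrac12 & \text{for SLOs}.\end{cases}$$ Then, for all $j,k$, $\mathrm{SINR}_{jk}(t)$ converges to a non-zero limit in $(0,+\infty]$ as $N\to\infty$ (along multiples of $A$). The limit is finite, i.e. a positive real number, in each of the following cases: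 1. pilot contamination persists: for some $(l,m)\ne(j,k)$ the ratio $|\mathbb E\{v_{jk}^{\mathsf H}(t)h_{jlm}(t)\}|/\mathbb E\{\|v_{jk}(t)\|^2\}$ does not tend to $0$; 2. all pilot symbols are positive reals, $\tilde\lambda^{(a)}_{jjk}\tilde\lambda^{(a)}_{jlm}>0$ for some $(l,m)\neq(j,k)$ and some $a$, and at least one of the following holds: $\kappa_0,z_1>0$; or $z_2>0$; or $\delta_0,z_3>0$; 3. there is a CLO and $\delta_0>0$; 4. $\max(z_1,z_2)+z_3\min_b\frac{\delta_0|t-\tau_b|}{2}=\frac12$, and $\kappa_0>0$ or $z_1\le z_2$. -/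

import Mathlib

open MeasureTheory ProbabilityTheory Filter Topology
open scoped NNReal ENNReal Matrix ComplexConjugate

noncomputable section

namespace MassiveMIMO

/-- The circularly symmetric complex Gaussian law `CN(0, v)`: independent real and imaginary
parts, each of law `N(0, v/2)`. -/
def complexGaussian (v : ℝ≥0) : Measure ℂ :=
  ((gaussianReal 0 (v / 2)).prod (gaussianReal 0 (v / 2))).map
    (fun q : ℝ × ℝ => (⟨q.1, q.2⟩ : ℂ))

/-- Deterministic data of an uplink network with `L` cells, `K` user equipments (UEs) per cell,
`A` subarrays per base station and coherence blocks of `T` channel uses, `B` of which carry pilots.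
Elements of `Fin T` number the channel uses. -/
structure Network (L K A B T : ℕ) where
  /-- `p l k` is the transmit power of UE `k` in cell `l`. -/
  p : Fin L → Fin K → ℝ
  /-- `lam j l k a` is the average channel attenuation from UE `k` in cell `l` to every antenna
  of subarray `a` in cell `j`. -/
  lam : Fin L → Fin L → Fin K → Fin A → ℝ
  /-- The (distinct) pilot times. -/
  τ : Fin B ↪ Fin T
  /-- `x l k b` is the pilot symbol that UE `k` in cell `l` sends at time `τ b`. -/
  x : Fin L → Fin K → Fin B → ℂ

/-- The hardware imperfection parameters `κ²`, `ξ`, `δ`. -/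
structure Impairments where
  kappaSq : ℝ
  xi : ℝ
  delta : ℝ

/-- The impairments `κ² = κ₀² N^z₁`, `ξ = ξ₀ N^z₂`, `δ = δ₀ (1 + log (N^z₃))`. -/
def scaledImpairments (κ₀ ξ₀ δ₀ z₁ z₂ z₃ : ℝ) (N : ℕ) : Impairments where
  kappaSq := κ₀ ^ 2 * (N : ℝ) ^ z₁
  xi := ξ₀ * (N : ℝ) ^ z₂
  delta := δ₀ * (1 + Real.log ((N : ℝ) ^ z₃))

/-- The antennas of a base station: `A` subarrays with `n` antennas each, `N = A * n` in total. -/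
abbrev Antenna (A n : ℕ) : Type := Fin A × Fin n

/-- All antennas are driven by one common local oscillator (LO). -/
def CommonLO {Ant LO : Type*} (osc : Ant → LO) : Prop := ∀ a a', osc a = osc a'

/-- Each antenna is driven by a local oscillator of its own. -/
def SeparateLOs {Ant LO : Type*} (osc : Ant → LO) : Prop := Function.Injective osc

/-- The elementary random variables of the uplink; the first argument is the receiving cell. -/
structure Sources (L K A n T : ℕ) (LO Ω : Type*) where
  /-- `h j l k a`: channel from UE `k` in cell `l` to antenna `a` in cell `j`. -/
  h : Fin L → Fin L → Fin K → Antenna A n → Ω → ℂ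
  /-- `phase0 j o`: phase of oscillator `o` in cell `j` just before the block. -/
  phase0 : Fin L → LO → Ω → ℝ
  /-- `step j o s`: innovation of the phase of oscillator `o` in cell `j` at channel use `s`. -/
  step : Fin L → LO → Fin T → Ω → ℝ
  /-- `dist j a s`: the distortion noise at antenna `a` and channel use `s`, normalized by its
  conditional standard deviation given the channels. -/
  dist : Fin L → Antenna A n → Fin T → Ω → ℂ
  /-- `rx j a s`: the receiver noise at antenna `a` and channel use `s`. -/
  rx : Fin L → Antenna A n → Fin T → Ω → ℂ

/-- Labels of the elementary sources of randomness at one receiver. The initial phases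
form a single source: their joint law is arbitrary. -/
inductive SourceLabel (L K A n T : ℕ) (LO : Type*)
  | chan (l : Fin L) (k : Fin K) (a : Antenna A n)
  | init
  | step (o : LO) (s : Fin T)
  | dist (a : Antenna A n) (s : Fin T)
  | rx (a : Antenna A n) (s : Fin T)

section Model

variable {L K A B T n : ℕ} {LO Ω : Type*}

/-- The σ-algebra generated by a source at the receiver in cell `j`. -/
@[reducible]
def Sources.sigma (V : Sources L K A n T LO Ω) (j : Fin L) :
    SourceLabel L K A n T LO → MeasurableSpace Ω
  | .chan l k a => MeasurableSpace.comap (V.h j l k a) inferInstance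
  | .init => MeasurableSpace.comap (fun ω o => V.phase0 j o ω) inferInstance
  | .step o s => MeasurableSpace.comap (V.step j o s) inferInstance
  | .dist a s => MeasurableSpace.comap (V.dist j a s) inferInstance
  | .rx a s => MeasurableSpace.comap (V.rx j a s) inferInstance

/-- The probabilistic assumptions: at every receiver all sources are independent; the channels are
`CN(0, λ)`, the phase innovations `N(0, δ)`, the normalized distortion noise `CN(0, 1)` and the
receiver noise `CN(0, ξ)`. -/
structure IsModel [MeasurableSpace Ω] (net : Network L K A B T) (imp : Impairments)
    (V : Sources L K A n T LO Ω) (μ : Measure Ω) : Prop where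
  measurable_h : ∀ j l k a, Measurable (V.h j l k a)
  measurable_phase0 : ∀ j o, Measurable (V.phase0 j o)
  measurable_step : ∀ j o s, Measurable (V.step j o s)
  measurable_dist : ∀ j a s, Measurable (V.dist j a s)
  measurable_rx : ∀ j a s, Measurable (V.rx j a s)
  law_h : ∀ j l k a, μ.map (V.h j l k a) = complexGaussian (net.lam j l k a.1).toNNReal
  law_step : ∀ j o s, μ.map (V.step j o s) = gaussianReal 0 imp.delta.toNNReal
  law_dist : ∀ j a s, μ.map (V.dist j a s) = complexGaussian 1
  law_rx : ∀ j a s, μ.map (V.rx j a s) = complexGaussian imp.xi.toNNReal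
  indep : ∀ j, iIndep (V.sigma j) μ

variable (net : Network L K A B T) (imp : Impairments) (osc : Antenna A n → LO)
  (V : Sources L K A n T LO Ω)

/-- The phase-drift at antenna `a` in cell `j`: a random walk with Gaussian steps, driven by the
oscillator of the antenna. -/
def phase (j : Fin L) (a : Antenna A n) (s : Fin T) (ω : Ω) : ℝ :=
  V.phase0 j (osc a) ω + ∑ i ∈ Finset.Iic s, V.step j (osc a) i ω

/-- The effective channel: entry `a` of `D_{φ_j(s)} h_{jlk}`. -/
def effChannel (j l : Fin L) (k : Fin K) (s : Fin T) (a : Antenna A n) (ω : Ω) : ℂ :=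
  Complex.exp (Complex.I * (phase osc V j a s ω : ℂ)) * V.h j l k a ω

/-- Distortion noise when UE `k` in cell `l` has symbol energy `e l k`: conditionally on the
channels it is `CN(0, κ² ∑ₗ ∑ₖ e l k |h_{jlk}|²)`, independent over antennas and channel uses. -/
def distortion (e : Fin L → Fin K → ℝ) (j : Fin L) (s : Fin T) (a : Antenna A n) (ω : Ω) : ℂ :=
  (Real.sqrt (imp.kappaSq * ∑ l, ∑ k, e l k * ‖V.h j l k a ω‖ ^ 2) : ℂ) * V.dist j a s ω

/-- The distortion noise during pilot transmission, at time `τ b`. -/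
def pilotDistortion (j : Fin L) (b : Fin B) (a : Antenna A n) (ω : Ω) : ℂ :=
  distortion imp V (fun l k => ‖net.x l k b‖ ^ 2) j (net.τ b) a ω

/-- The distortion noise during data transmission at full power, at a data time `t`. -/
def dataDistortion (j : Fin L) (t : Fin T) (a : Antenna A n) (ω : Ω) : ℂ :=
  distortion imp V net.p j t a ω

/-- The combined received pilot signal `ψ_j`. -/
def pilotSignal (j : Fin L) (q : Fin B × Antenna A n) (ω : Ω) : ℂ :=
  (∑ l, ∑ k, effChannel osc V j l k (net.τ q.1) q.2 ω * net.x l k q.1)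
    + pilotDistortion net imp V j q.1 q.2 ω + V.rx j q.2 (net.τ q.1) ω

variable [MeasurableSpace Ω] (μ : Measure Ω)

/-- The covariance matrix `E{ψ_j ψ_jᴴ}`. -/
def pilotCov (j : Fin L) : Matrix (Fin B × Antenna A n) (Fin B × Antenna A n) ℂ :=
  fun q q' => ∫ ω, pilotSignal net imp osc V j q ω * conj (pilotSignal net imp osc V j q' ω) ∂μ

/-- The cross-covariance matrix `E{h_{jlk}(t) ψ_jᴴ}`. -/
def crossCov (j l : Fin L) (k : Fin K) (t : Fin T) :
    Matrix (Antenna A n) (Fin B × Antenna A n) ℂ :=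
  fun a q => ∫ ω, effChannel osc V j l k t a ω * conj (pilotSignal net imp osc V j q ω) ∂μ

/-- The LMMSE estimate `E{h ψᴴ} (E{ψ ψᴴ})⁻¹ ψ` of the effective channel `h = h_{jlk}(t)` (all
variables have mean zero). -/
def lmmse (j l : Fin L) (k : Fin K) (t : Fin T) (ω : Ω) : Antenna A n → ℂ :=
  (crossCov net imp osc V μ j l k t * (pilotCov net imp osc V μ j)⁻¹) *ᵥ
    (fun q => pilotSignal net imp osc V j q ω)

/-- The maximum ratio combining (MRC) receive filter. -/
def mrc (j : Fin L) (k : Fin K) (t : Fin T) (ω : Ω) : Antenna A n → ℂ :=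
  lmmse net imp osc V μ j j k t ω

/-- `v_{jk}ᴴ(t) h_{jlm}(t)` for the MRC filter. -/
def filteredChannel (j : Fin L) (k : Fin K) (l : Fin L) (m : Fin K) (t : Fin T) (ω : Ω) : ℂ :=
  star (mrc net imp osc V μ j k t ω) ⬝ᵥ (fun a => effChannel osc V j l m t a ω)

/-- `v_{jk}ᴴ(t) υ_j(t)` for the MRC filter at a data time `t`. -/
def filteredDistortion (j : Fin L) (k : Fin K) (t : Fin T) (ω : Ω) : ℂ :=
  star (mrc net imp osc V μ j k t ω) ⬝ᵥ (fun a => dataDistortion net imp V j t a ω)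

/-- `E{‖v_{jk}(t)‖²}` for the MRC filter. -/
def filterPower (j : Fin L) (k : Fin K) (t : Fin T) : ℝ :=
  ∫ ω, ∑ a, ‖mrc net imp osc V μ j k t ω a‖ ^ 2 ∂μ

/-- `SINR_{jk}(t)` with the MRC filter, at a data time `t`. -/
def sinr (j : Fin L) (k : Fin K) (t : Fin T) : ℝ :=
  net.p j k * ‖∫ ω, filteredChannel net imp osc V μ j k j k t ω ∂μ‖ ^ 2 /
    ((∑ l, ∑ m, net.p l m * ∫ ω, ‖filteredChannel net imp osc V μ j k l m t ω‖ ^ 2 ∂μ)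
      - net.p j k * ‖∫ ω, filteredChannel net imp osc V μ j k j k t ω ∂μ‖ ^ 2
      + (∫ ω, ‖filteredDistortion net imp osc V μ j k t ω‖ ^ 2 ∂μ)
      + imp.xi * filterPower net imp osc V μ j k t)

/-- The pilot contamination of UE `k` in cell `j` by UE `m` in cell `l`: the correlation
`|E{v_{jk}ᴴ(t) h_{jlm}(t)}|` of the MRC filter with the interfering channel, relative to
`E{‖v_{jk}(t)‖²}`. -/
def contamination (j : Fin L) (k : Fin K) (l : Fin L) (m : Fin K) (t : Fin T) : ℝ :=
  ‖∫ ω, filteredChannel net imp osc V μ j k l m t ω ∂μ‖ / filterPower net imp osc V μ j k t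

end Model

end MassiveMIMO

end

/-!
# Scaling law of the SINR with maximum ratio combining

Given the phase-drifts, the pilot signals of different antennas of a base station are uncorrelated,
so the covariance of `ψ` is block diagonal with one `B × B` block per antenna, and the blocks of the
antennas of a subarray are equal. The MRC filter therefore acts antenna by antenna, through a
weight vector that depends only on the subarray. Its moments with the channels, the distortion
noise and the receiver noise are then sums over antennas and over pairs of different antennas. They
are computed exactly, with the second and fourth moments of complex Gaussian variables and the
Fourier transform of the Gaussian increments of the phase-drifts. The result, `IsModel.sinr_eq`, is
`SINR = p / interference`, where the interference is an explicit function of finitely many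
second-order statistics (a `Scene`: correlations of the phase-drifts between pilot times, between a
pilot time and the data time, and for pairs of antennas, and the variances of the noises) and of the
weights `1 / n` of the contributions of single antennas.

The number of antennas then enters through the scene and the weights only. The interference is
covariant under rescaling the pilot covariances by `N ^ θ`, `θ = max z₁ z₂`, and the correlations
with the data time by `N ^ (-δ₀ z₃ d / 2)`, `d` the distance to the nearest pilot
(`Scene.interference_scale`). After this rescaling all statistics converge (`tendsTo_limitScene`);
the weights become powers of `N`, and the scaling law says exactly that the largest of them,
`N ^ (2 θ + δ₀ z₃ d - 1)` up to a constant, stays bounded. The limit scene still has invertible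
pilot covariances in the subarrays that hear the user, the only ones where the filter is not zero,
and a nonzero gain (`admissible_limitScene`). So the interference converges to a
limit `Δ ≥ 0`, and the SINR converges to `p / Δ`, which is positive, and finite if `Δ > 0`.

The limit `Δ` is positive as soon as one of three contributions is
(`Scene.Admissible.interference_pos`):
- coherent interference of another user, i.e. persistent pilot contamination. If the noises or the
  phase-drifts grow, the limit of the pilot covariance is diagonal, and with positive pilots the
  contamination is a sum of nonnegative terms, not all zero (`mean_ne_zero_of_diagonal`);
- the fluctuation of the effective channel due to a common oscillator, positive because the kernel
  of correlations strictly dominates the product of the means (`sq_norm_lt_quad_phaseCorr`);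
- the noise, whose weight has a positive limit when the scaling law holds with equality.
-/

namespace MassiveMIMO

/-! ### Random variables with moments of all orders -/

/-- `Tame μ m f`: the complex random variable `f` is measurable for the σ-algebra `m` and has
moments of all orders under `μ`. Such variables are closed under the ring operations, so that all
expectations of polynomials in them may be expanded freely. -/
def Tame {Ω : Type*} {mΩ : MeasurableSpace Ω} (μ : Measure Ω) (m : MeasurableSpace Ω)
    (f : Ω → ℂ) : Prop :=
  Measurable[m] f ∧ ∀ p : ℝ≥0∞, p ≠ ∞ → MemLp f p μ

section Tame

variable {Ω : Type*} {m m' mΩ : MeasurableSpace Ω} {μ : Measure Ω} {f g : Ω → ℂ}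

lemma Tame.mono (hf : Tame μ m f) (h : m ≤ m') : Tame μ m' f :=
  ⟨hf.1.mono h le_rfl, hf.2⟩

lemma Tame.integrable (hf : Tame μ m f) : Integrable f μ :=
  memLp_one_iff_integrable.1 (hf.2 1 ENNReal.one_ne_top)

lemma Tame.add (hf : Tame μ m f) (hg : Tame μ m g) : Tame μ m (fun ω => f ω + g ω) :=
  ⟨hf.1.add hg.1, fun p hp => (hf.2 p hp).add (hg.2 p hp)⟩

lemma Tame.mul (hf : Tame μ m f) (hg : Tame μ m g) : Tame μ m (fun ω => f ω * g ω) := by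
  refine ⟨hf.1.mul hg.1, fun p hp => ?_⟩
  have h2 : (2 : ℝ≥0∞) * p ≠ ∞ := ENNReal.mul_ne_top (by simp) hp
  have : ENNReal.HolderTriple (2 * p) (2 * p) p := by
    refine ⟨?_⟩
    rw [ENNReal.mul_inv (by simp) (by simp), ← two_mul, ← mul_assoc,
      ENNReal.mul_inv_cancel (by simp) (by simp), one_mul]
  exact (hg.2 _ h2).mul' (hf.2 _ h2)

lemma Tame.conj (hf : Tame μ m f) : Tame μ m (fun ω => conj (f ω)) :=
  ⟨Complex.continuous_conj.measurable.comp hf.1, fun p hp => (hf.2 p hp).star⟩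

lemma Tame.const [IsProbabilityMeasure μ] (c : ℂ) : Tame μ m (fun _ => c) :=
  ⟨measurable_const, fun _ _ => memLp_const c⟩

lemma Tame.sum [IsProbabilityMeasure μ] {ι : Type*} {s : Finset ι} {F : ι → Ω → ℂ}
    (hF : ∀ i ∈ s, Tame μ m (F i)) : Tame μ m (fun ω => ∑ i ∈ s, F i ω) :=
  ⟨Finset.measurable_fun_sum _ fun i hi => (hF i hi).1,
    fun p hp => memLp_finsetSum _ fun i hi => (hF i hi).2 p hp⟩

lemma Tame.of_bounded [IsProbabilityMeasure μ] (hm : m ≤ mΩ) (hf : Measurable[m] f) (C : ℝ)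
    (hC : ∀ ω, ‖f ω‖ ≤ C) : Tame μ m f :=
  ⟨hf, fun _ _ => MemLp.of_bound (hf.mono hm le_rfl).aestronglyMeasurable C
    (Filter.Eventually.of_forall hC)⟩

lemma Tame.of_norm_le (hm : m ≤ mΩ) (hf : Measurable[m] f) (hg : Tame μ m' g)
    (h : ∀ ω, ‖f ω‖ ≤ ‖g ω‖) : Tame μ m f :=
  ⟨hf, fun p hp => (hg.2 p hp).mono (hf.mono hm le_rfl).aestronglyMeasurable
    (Filter.Eventually.of_forall h)⟩

/-- The second moment of a complex random variable dominates the squared modulus of its mean. -/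
lemma Tame.sq_norm_integral_le [IsProbabilityMeasure μ] (hf : Tame μ m f) :
    ‖∫ ω, f ω ∂μ‖ ^ 2 ≤ ∫ ω, ‖f ω‖ ^ 2 ∂μ := by
  have h1 : MemLp (fun ω => ‖f ω‖) 2 μ := (hf.2 2 (by simp)).norm
  have h2 := variance_nonneg (fun ω => ‖f ω‖) μ
  rw [variance_eq_sub h1] at h2
  have h3 := norm_integral_le_integral_norm (μ := μ) f
  have h4 : ‖∫ ω, f ω ∂μ‖ ^ 2 ≤ (∫ ω, ‖f ω‖ ∂μ) ^ 2 := by gcongr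
  simp only [Pi.pow_apply] at h2
  linarith

lemma integral_mul_of_indep (hm : m ≤ mΩ) (hm' : m' ≤ mΩ)
    (h : Indep m m' μ) (hf : Measurable[m] f) (hg : Measurable[m'] g) :
    ∫ ω, f ω * g ω ∂μ = (∫ ω, f ω ∂μ) * ∫ ω, g ω ∂μ := by
  have : IndepFun f g μ :=
    indep_of_indep_of_le_left (indep_of_indep_of_le_right h hg.comap_le) hf.comap_le
  exact this.integral_fun_mul_eq_mul_integral (hf.mono hm le_rfl).aestronglyMeasurable
    (hg.mono hm' le_rfl).aestronglyMeasurable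

end Tame

/-! ### Moments of the complex Gaussian law -/

section Gaussian

lemma integral_sq_gaussianReal (v : ℝ≥0) : ∫ x, x ^ 2 ∂(gaussianReal 0 v) = (v : ℝ) := by
  have h := variance_id_gaussianReal (μ := 0) (v := v)
  rw [variance_eq_sub (memLp_id_gaussianReal' 2 (by simp))] at h
  simpa using h

lemma integrable_pow_gaussianReal (v : ℝ≥0) (n : ℕ) :
    Integrable (fun x : ℝ => x ^ n) (gaussianReal 0 v) := by
  rcases Nat.eq_zero_or_pos n with rfl | hn
  · simp
  have h := (memLp_id_gaussianReal' (μ := 0) (v := v) (n : ℝ≥0∞) (by simp)).integrable_norm_pow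
    hn.ne'
  refine h.mono' (measurable_id.pow_const n).aestronglyMeasurable ?_
  exact Filter.Eventually.of_forall fun x => by simp

/-- If `X` and `Y` are independent of law `N(0, v)`, then `X + Y` and `√2 X` have the same law;
comparing fourth moments gives `E X⁴ = 3 v²`. -/
lemma integral_pow_four_gaussianReal (v : ℝ≥0) :
    ∫ x, x ^ 4 ∂(gaussianReal 0 v) = 3 * (v : ℝ) ^ 2 := by
  have hlaw : (gaussianReal 0 v).map (fun x => Real.sqrt 2 * x) =
      ((gaussianReal 0 v).prod (gaussianReal 0 v)).map (fun q : ℝ × ℝ => q.1 + q.2) := by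
    have h := gaussianReal_conv_gaussianReal (m₁ := 0) (m₂ := 0) (v₁ := v) (v₂ := v)
    unfold Measure.conv at h
    rw [h, gaussianReal_map_const_mul]
    congr 1
    · simp
    · ext; simp; ring
  have h := congrArg (fun ν : Measure ℝ => ∫ x, x ^ 4 ∂ν) hlaw
  rw [integral_map (by fun_prop) (by fun_prop), integral_map (by fun_prop) (by fun_prop)] at h
  have i := integrable_pow_gaussianReal v
  have e1 : ∫ x, (Real.sqrt 2 * x) ^ 4 ∂(gaussianReal 0 v)
      = 4 * ∫ x, x ^ 4 ∂(gaussianReal 0 v) := by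
    rw [← integral_const_mul]
    refine integral_congr_ae (Filter.Eventually.of_forall fun x => ?_)
    have : Real.sqrt 2 ^ 4 = 4 := by
      rw [show 4 = 2 * 2 by norm_num, pow_mul, Real.sq_sqrt (by norm_num)]; norm_num
    simp only [mul_pow, this]
  have j : ∀ a b : ℕ, Integrable (fun q : ℝ × ℝ => q.1 ^ a * q.2 ^ b)
      ((gaussianReal 0 v).prod (gaussianReal 0 v)) := fun a b => (i a).mul_prod (i b)
  have e2 : ∫ q : ℝ × ℝ, (q.1 + q.2) ^ 4 ∂((gaussianReal 0 v).prod (gaussianReal 0 v))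
      = 2 * (∫ x, x ^ 4 ∂(gaussianReal 0 v)) + 6 * (v : ℝ) ^ 2 := by
    have : ∀ q : ℝ × ℝ, (q.1 + q.2) ^ 4 = q.1 ^ 4 * q.2 ^ 0 + 4 * (q.1 ^ 3 * q.2 ^ 1)
        + 6 * (q.1 ^ 2 * q.2 ^ 2) + 4 * (q.1 ^ 1 * q.2 ^ 3) + q.1 ^ 0 * q.2 ^ 4 := fun q => by ring
    simp only [this]
    rw [integral_add, integral_add, integral_add, integral_add]
    rotate_left
    · exact j 4 0
    · exact (j 3 1).const_mul 4
    · exact (j 4 0).add ((j 3 1).const_mul 4)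
    · exact (j 2 2).const_mul 6
    · exact ((j 4 0).add ((j 3 1).const_mul 4)).add ((j 2 2).const_mul 6)
    · exact (j 1 3).const_mul 4
    · exact (((j 4 0).add ((j 3 1).const_mul 4)).add ((j 2 2).const_mul 6)).add
        ((j 1 3).const_mul 4)
    · exact j 0 4
    simp only [integral_const_mul]
    rw [integral_prod_mul (fun x => x ^ 4) (fun x => x ^ 0),
      integral_prod_mul (fun x => x ^ 3) (fun x => x ^ 1),
      integral_prod_mul (fun x => x ^ 2) (fun x => x ^ 2),
      integral_prod_mul (fun x => x ^ 1) (fun x => x ^ 3),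
      integral_prod_mul (fun x => x ^ 0) (fun x => x ^ 4), integral_sq_gaussianReal]
    simp
    ring
  rw [e1, e2] at h
  linarith

variable (v : ℝ≥0)

lemma integral_complexGaussian {E : Type*} [NormedAddCommGroup E] [NormedSpace ℝ E] (f : ℂ → E) :
    ∫ z, f z ∂(complexGaussian v) =
      ∫ q : ℝ × ℝ, f ⟨q.1, q.2⟩ ∂((gaussianReal 0 (v / 2)).prod (gaussianReal 0 (v / 2))) :=
  integral_map_equiv Complex.measurableEquivRealProd.symm f

lemma neg_complexGaussian : (complexGaussian v).map (fun z => -z) = complexGaussian v := by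
  have hm : Measurable (fun q : ℝ × ℝ => (⟨q.1, q.2⟩ : ℂ)) :=
    Complex.measurableEquivRealProd.symm.measurable
  have h := Measure.map_prod_map (gaussianReal 0 (v / 2)) (gaussianReal 0 (v / 2))
    (f := fun x : ℝ => -x) (g := fun x : ℝ => -x) (by fun_prop) (by fun_prop)
  rw [gaussianReal_map_neg, neg_zero] at h
  unfold complexGaussian
  rw [Measure.map_map (by fun_prop) hm]
  nth_rewrite 2 [h]
  rw [Measure.map_map hm (by fun_prop)]
  rfl

lemma memLp_id_complexGaussian (p : ℝ≥0∞) (hp : p ≠ ∞) :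
    MemLp (fun z => z) p (complexGaussian v) := by
  have hre : MemLp (fun q : ℝ × ℝ => q.1) p
      ((gaussianReal 0 (v / 2)).prod (gaussianReal 0 (v / 2))) :=
    (memLp_id_gaussianReal' (μ := 0) (v := v / 2) p hp).comp_fst _
  have him : MemLp (fun q : ℝ × ℝ => q.2) p
      ((gaussianReal 0 (v / 2)).prod (gaussianReal 0 (v / 2))) :=
    (memLp_id_gaussianReal' (μ := 0) (v := v / 2) p hp).comp_snd _
  have hm : Measurable (fun q : ℝ × ℝ => (⟨q.1, q.2⟩ : ℂ)) :=
    Complex.measurableEquivRealProd.symm.measurable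
  unfold complexGaussian
  rw [memLp_map_measure_iff (by fun_prop) hm.aemeasurable]
  have h1 : MemLp (fun q : ℝ × ℝ => (q.1 : ℂ)) p
      ((gaussianReal 0 (v / 2)).prod (gaussianReal 0 (v / 2))) := hre.ofReal
  have h2 : MemLp (fun q : ℝ × ℝ => (q.2 : ℂ)) p
      ((gaussianReal 0 (v / 2)).prod (gaussianReal 0 (v / 2))) := him.ofReal
  have e : ((fun z : ℂ => z) ∘ fun q : ℝ × ℝ => (⟨q.1, q.2⟩ : ℂ)) =
      (fun q : ℝ × ℝ => (q.1 : ℂ)) + fun q : ℝ × ℝ => Complex.I * (q.2 : ℂ) := by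
    funext q
    apply Complex.ext <;> simp
  rw [e]
  exact h1.add (h2.const_mul Complex.I)

lemma integral_id_complexGaussian : ∫ z, z ∂(complexGaussian v) = 0 := by
  have h1 : ∫ z, z ∂(complexGaussian v) = -∫ z, z ∂(complexGaussian v) := by
    rw [← integral_neg]
    conv_lhs => rw [← neg_complexGaussian v]
    rw [integral_map (by fun_prop) (by fun_prop)]
  exact self_eq_neg.1 h1

lemma integral_normSq_complexGaussian : ∫ z : ℂ, ‖z‖ ^ 2 ∂(complexGaussian v) = v := by
  rw [integral_complexGaussian]
  simp only [Complex.sq_norm, Complex.normSq_mk, ← pow_two]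
  have i := integrable_pow_gaussianReal (v / 2)
  rw [integral_add ((i 2).comp_fst _) ((i 2).comp_snd _),
    integral_fun_fst (fun x : ℝ => x ^ 2), integral_fun_snd (fun x : ℝ => x ^ 2)]
  simp [integral_sq_gaussianReal]

lemma integral_norm_pow_four_complexGaussian :
    ∫ z : ℂ, ‖z‖ ^ 4 ∂(complexGaussian v) = 2 * (v : ℝ) ^ 2 := by
  rw [integral_complexGaussian]
  have i := integrable_pow_gaussianReal (v / 2)
  have : ∀ q : ℝ × ℝ, ‖(⟨q.1, q.2⟩ : ℂ)‖ ^ 4 = q.1 ^ 4 + 2 * (q.1 ^ 2 * q.2 ^ 2) + q.2 ^ 4 :=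
    fun q => by
      rw [show 4 = 2 * 2 by norm_num, pow_mul, Complex.sq_norm, Complex.normSq_mk]; ring
  simp only [this]
  rw [integral_add, integral_add]
  rotate_left
  · exact (i 4).comp_fst _
  · exact ((i 2).mul_prod (i 2)).const_mul 2
  · exact ((i 4).comp_fst _).add (((i 2).mul_prod (i 2)).const_mul 2)
  · exact (i 4).comp_snd _
  rw [integral_const_mul, integral_prod_mul (fun x : ℝ => x ^ 2) (fun x => x ^ 2),
    integral_fun_fst (fun x : ℝ => x ^ 4), integral_fun_snd (fun x : ℝ => x ^ 4)]
  simp [integral_sq_gaussianReal, integral_pow_four_gaussianReal]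
  ring

end Gaussian

/-! ### Independent sources of randomness -/

lemma tame_of_map_eq {Ω : Type*} {m mΩ : MeasurableSpace Ω} {μ : Measure Ω} {f : Ω → ℂ} {v : ℝ≥0}
    (hfm : Measurable f) (hf : Measurable[m] f) (hlaw : μ.map f = complexGaussian v) :
    Tame μ m f := by
  refine ⟨hf, fun p hp => ?_⟩
  have h := memLp_id_complexGaussian v p hp
  rw [← hlaw] at h
  exact (memLp_map_measure_iff measurable_id.aestronglyMeasurable hfm.aemeasurable).1 h

section Independence

variable {L K A B T n : ℕ} {LO Ω : Type*}

/-- The σ-algebra generated by a set of sources at the receiver in cell `j`. -/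
noncomputable abbrev Sources.sigmaOn (V : Sources L K A n T LO Ω) (j : Fin L)
    (S : Set (SourceLabel L K A n T LO)) : MeasurableSpace Ω :=
  ⨆ i ∈ S, V.sigma j i

lemma Sources.sigma_le_sigmaOn (V : Sources L K A n T LO Ω) (j : Fin L)
    {S : Set (SourceLabel L K A n T LO)} {i : SourceLabel L K A n T LO} (hi : i ∈ S) :
    V.sigma j i ≤ V.sigmaOn j S :=
  le_iSup₂_of_le i hi le_rfl

lemma Sources.sigmaOn_mono (V : Sources L K A n T LO Ω) (j : Fin L)
    {S S' : Set (SourceLabel L K A n T LO)} (h : S ⊆ S') : V.sigmaOn j S ≤ V.sigmaOn j S' :=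
  biSup_mono h

/-- The factor `e^{iφ}` by which the oscillators rotate the signal at antenna `a`. -/
noncomputable def phasor (osc : Antenna A n → LO) (V : Sources L K A n T LO Ω) (j : Fin L)
    (s : Fin T) (a : Antenna A n) (ω : Ω) : ℂ :=
  Complex.exp (Complex.I * (phase osc V j a s ω : ℂ))

lemma norm_phasor (osc : Antenna A n → LO) (V : Sources L K A n T LO Ω) (j : Fin L) (s : Fin T)
    (a : Antenna A n) (ω : Ω) : ‖phasor osc V j s a ω‖ = 1 := by
  rw [phasor, mul_comm, Complex.norm_exp_ofReal_mul_I]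

/-- The sources that make up the phase-drifts. -/
def phaseLabels : Set (SourceLabel L K A n T LO) :=
  {i | match i with
    | .init => True
    | .step _ _ => True
    | _ => False}

/-- The sources that make up the channels. -/
def chanLabels : Set (SourceLabel L K A n T LO) :=
  {i | match i with
    | .chan _ _ _ => True
    | _ => False}

variable [mΩ : MeasurableSpace Ω] {net : Network L K A B T} {imp : Impairments}
  {V : Sources L K A n T LO Ω} {μ : Measure Ω}

lemma IsModel.sigma_le (hm : IsModel net imp V μ) (j : Fin L) (i : SourceLabel L K A n T LO) :
    V.sigma j i ≤ mΩ := by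
  cases i with
  | chan l k a => exact (hm.measurable_h j l k a).comap_le
  | init => exact (measurable_pi_lambda _ fun o => hm.measurable_phase0 j o).comap_le
  | step o s => exact (hm.measurable_step j o s).comap_le
  | dist a s => exact (hm.measurable_dist j a s).comap_le
  | rx a s => exact (hm.measurable_rx j a s).comap_le

lemma IsModel.sigmaOn_le (hm : IsModel net imp V μ) (j : Fin L)
    (S : Set (SourceLabel L K A n T LO)) : V.sigmaOn j S ≤ mΩ :=
  iSup₂_le fun i _ => hm.sigma_le j i

/-- Expectations factor over disjoint sets of sources. -/
lemma IsModel.integral_mul (hm : IsModel net imp V μ) {j : Fin L}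
    {S S' : Set (SourceLabel L K A n T LO)} (hS : Disjoint S S') {f g : Ω → ℂ}
    (hf : Measurable[V.sigmaOn j S] f) (hg : Measurable[V.sigmaOn j S'] g) :
    ∫ ω, f ω * g ω ∂μ = (∫ ω, f ω ∂μ) * ∫ ω, g ω ∂μ :=
  integral_mul_of_indep (hm.sigmaOn_le j S) (hm.sigmaOn_le j S')
    (indep_iSup_of_disjoint (hm.sigma_le j) (hm.indep j) hS) hf hg

lemma integral_comp_of_map_eq {E : Type*} [NormedAddCommGroup E] [NormedSpace ℝ E]
    {f : Ω → ℂ} {v : ℝ≥0} (hfm : Measurable f) (hlaw : μ.map f = complexGaussian v)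
    {g : ℂ → E} (hg : Continuous g) (hE : SecondCountableTopologyEither ℂ E) :
    ∫ ω, g (f ω) ∂μ = ∫ z, g z ∂(complexGaussian v) := by
  rw [← hlaw, integral_map hfm.aemeasurable hg.aestronglyMeasurable]

lemma IsModel.tame_h (hm : IsModel net imp V μ) (j l : Fin L) (k : Fin K) (a : Antenna A n)
    {S : Set (SourceLabel L K A n T LO)} (hS : SourceLabel.chan l k a ∈ S) :
    Tame μ (V.sigmaOn j S) (V.h j l k a) :=
  tame_of_map_eq (hm.measurable_h j l k a)
    (measurable_iff_comap_le.2 (V.sigma_le_sigmaOn j hS)) (hm.law_h j l k a)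

lemma IsModel.tame_dist (hm : IsModel net imp V μ) (j : Fin L) (a : Antenna A n) (s : Fin T)
    {S : Set (SourceLabel L K A n T LO)} (hS : SourceLabel.dist a s ∈ S) :
    Tame μ (V.sigmaOn j S) (V.dist j a s) :=
  tame_of_map_eq (hm.measurable_dist j a s)
    (measurable_iff_comap_le.2 (V.sigma_le_sigmaOn j hS)) (hm.law_dist j a s)

lemma IsModel.tame_rx (hm : IsModel net imp V μ) (j : Fin L) (a : Antenna A n) (s : Fin T)
    {S : Set (SourceLabel L K A n T LO)} (hS : SourceLabel.rx a s ∈ S) :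
    Tame μ (V.sigmaOn j S) (V.rx j a s) :=
  tame_of_map_eq (hm.measurable_rx j a s)
    (measurable_iff_comap_le.2 (V.sigma_le_sigmaOn j hS)) (hm.law_rx j a s)

lemma IsModel.tame_phasor [IsProbabilityMeasure μ] (hm : IsModel net imp V μ)
    (osc : Antenna A n → LO) (j : Fin L)
    (s : Fin T) (a : Antenna A n) {S : Set (SourceLabel L K A n T LO)} (hS : phaseLabels ⊆ S) :
    Tame μ (V.sigmaOn j S) (phasor osc V j s a) := by
  refine Tame.of_bounded (hm.sigmaOn_le j S) ?_ 1 fun ω => (norm_phasor osc V j s a ω).le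
  have h0 : Measurable[V.sigmaOn j S] (fun ω => V.phase0 j (osc a) ω) := by
    have : Measurable[V.sigmaOn j S] (fun ω o => V.phase0 j o ω) :=
      measurable_iff_comap_le.2 (V.sigma_le_sigmaOn j (i := .init) (hS trivial))
    exact (measurable_pi_apply (osc a)).comp this
  have h1 : ∀ i, Measurable[V.sigmaOn j S] (V.step j (osc a) i) := fun i =>
    measurable_iff_comap_le.2 (V.sigma_le_sigmaOn j (i := .step (osc a) i) (hS trivial))
  have h2 : Measurable[V.sigmaOn j S] (phase osc V j a s) :=
    h0.add (Finset.measurable_fun_sum _ fun i _ => h1 i)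
  have h3 : Continuous fun r : ℝ => Complex.exp (Complex.I * (r : ℂ)) := by fun_prop
  exact h3.measurable.comp h2

variable (μ) in
/-- Mean and absolute second and fourth moments of a random variable of law `CN(0, v)`. -/
structure IsStandard (f : Ω → ℂ) (v : ℝ) : Prop where
  mean : ∫ ω, f ω ∂μ = 0
  mean_conj : ∫ ω, conj (f ω) ∂μ = 0
  second : ∫ ω, conj (f ω) * f ω ∂μ = v
  fourth : ∫ ω, conj (f ω) * f ω * (conj (f ω) * f ω) ∂μ = 2 * (v : ℂ) ^ 2

lemma isStandard_of_map_eq {f : Ω → ℂ} {v : ℝ} (hv : 0 ≤ v) (hfm : Measurable f)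
    (hlaw : μ.map f = complexGaussian v.toNNReal) : IsStandard μ f v := by
  have h0 : ∫ ω, f ω ∂μ = 0 := by
    rw [integral_comp_of_map_eq hfm hlaw (g := fun z => z) (by fun_prop) inferInstance,
      integral_id_complexGaussian]
  have e : ∀ z : ℂ, conj z * z = ((‖z‖ ^ 2 : ℝ) : ℂ) := fun z => by
    rw [Complex.conj_mul']; push_cast; rfl
  refine ⟨h0, ?_, ?_, ?_⟩
  · rw [integral_conj, h0, map_zero]
  · simp only [e]
    rw [integral_complex_ofReal, integral_comp_of_map_eq hfm hlaw (g := fun z => ‖z‖ ^ 2)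
      (by fun_prop) inferInstance, integral_normSq_complexGaussian, Real.coe_toNNReal _ hv]
  · have e' : ∀ z : ℂ, conj z * z * (conj z * z) = ((‖z‖ ^ 4 : ℝ) : ℂ) := fun z => by
      rw [e]; push_cast; ring
    simp only [e']
    rw [integral_complex_ofReal, integral_comp_of_map_eq hfm hlaw (g := fun z => ‖z‖ ^ 4)
      (by fun_prop) inferInstance, integral_norm_pow_four_complexGaussian, Real.coe_toNNReal _ hv]
    push_cast; rfl

lemma IsModel.isStandard_h (hm : IsModel net imp V μ) (hlam : ∀ j l k a, 0 ≤ net.lam j l k a)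
    (j l : Fin L) (k : Fin K) (a : Antenna A n) :
    IsStandard μ (V.h j l k a) (net.lam j l k a.1) :=
  isStandard_of_map_eq (hlam _ _ _ _) (hm.measurable_h j l k a) (hm.law_h j l k a)

lemma IsModel.isStandard_dist (hm : IsModel net imp V μ) (j : Fin L) (a : Antenna A n)
    (s : Fin T) : IsStandard μ (V.dist j a s) 1 :=
  isStandard_of_map_eq zero_le_one (hm.measurable_dist j a s)
    (by rw [hm.law_dist j a s, Real.toNNReal_one])

lemma IsModel.isStandard_rx (hm : IsModel net imp V μ) (hxi : 0 ≤ imp.xi) (j : Fin L)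
    (a : Antenna A n) (s : Fin T) : IsStandard μ (V.rx j a s) imp.xi :=
  isStandard_of_map_eq hxi (hm.measurable_rx j a s) (hm.law_rx j a s)

end Independence

/-! ### Moments of the phase-drifts -/

section Phases

variable {L K A B T n : ℕ} {LO Ω : Type*} {V : Sources L K A n T LO Ω}

/-- The correlation `exp (-δ |s - s'| / 2)` of the phasors of one oscillator at two channel
uses. -/
noncomputable def phaseCorr (δ : ℝ) (s s' : Fin T) : ℝ := Real.exp (-(δ * |(s : ℝ) - (s' : ℝ)| / 2))

lemma phaseCorr_comm (δ : ℝ) (s s' : Fin T) : phaseCorr δ s s' = phaseCorr δ s' s := by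
  rw [phaseCorr, phaseCorr, abs_sub_comm]

/-- The coefficient of the phase innovation at time `i` in the phase difference between `s` and
`s'`. -/
noncomputable def stepCoeff (s s' i : Fin T) : ℝ :=
  (if i ≤ s' then 1 else 0) - (if i ≤ s then 1 else 0)

lemma sum_stepCoeff_sq (s s' : Fin T) :
    ∑ i, stepCoeff s s' i ^ 2 = |(s : ℝ) - (s' : ℝ)| := by
  wlog h : s ≤ s' generalizing s s'
  · rw [abs_sub_comm, ← this s' s (le_of_not_ge h)]
    exact Finset.sum_congr rfl fun i _ => by unfold stepCoeff; ring
  have e : ∀ i, stepCoeff s s' i ^ 2 = if i ∈ Finset.Ioc s s' then 1 else 0 := fun i => by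
    unfold stepCoeff
    simp only [Finset.mem_Ioc]
    by_cases h1 : i ≤ s
    · simp [h1, h1.trans h, not_lt.2 h1]
    · by_cases h2 : i ≤ s' <;> simp [h1, h2, not_le.1 h1]
  simp only [e]
  rw [Finset.sum_ite_mem, Finset.univ_inter, Finset.sum_const, Fin.card_Ioc, nsmul_eq_mul, mul_one,
    abs_sub_comm, abs_of_nonneg (sub_nonneg.2 (by exact_mod_cast h)), Nat.cast_sub (by exact h)]

/-- The phase difference of oscillator `o` between the channel uses `s` and `s'`. -/
noncomputable def phaseDiff (V : Sources L K A n T LO Ω) (j : Fin L) (o : LO) (s s' : Fin T)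
    (ω : Ω) : ℝ :=
  ∑ i, stepCoeff s s' i * V.step j o i ω

lemma conj_phasor_mul_phasor (osc : Antenna A n → LO) (j : Fin L) (s s' : Fin T)
    {a a' : Antenna A n} (h : osc a = osc a') (ω : Ω) :
    conj (phasor osc V j s a ω) * phasor osc V j s' a' ω =
      Complex.exp (Complex.I * (phaseDiff V j (osc a) s s' ω : ℂ)) := by
  have e : phaseDiff V j (osc a) s s' ω = phase osc V j a' s' ω - phase osc V j a s ω := by
    have e1 : ∀ r : Fin T, ∑ i ∈ Finset.Iic r, V.step j (osc a) i ω =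
        ∑ i, (if i ≤ r then 1 else 0) * V.step j (osc a) i ω := fun r => by
      simp only [ite_mul, one_mul, zero_mul]
      rw [← Finset.sum_filter]
      refine Finset.sum_congr ?_ fun _ _ => rfl
      ext i; simp
    unfold phase
    rw [← h, e1, e1, add_sub_add_left_eq_sub, ← Finset.sum_sub_distrib]
    exact Finset.sum_congr rfl fun i _ => by rw [stepCoeff, sub_mul]
  unfold phasor
  rw [← Complex.exp_conj, ← Complex.exp_add, e]
  congr 1
  simp
  ring

variable [MeasurableSpace Ω] {net : Network L K A B T} {imp : Impairments} {μ : Measure Ω}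

lemma IsModel.integral_exp_phaseDiff (hm : IsModel net imp V μ) [IsProbabilityMeasure μ]
    (hδ : 0 ≤ imp.delta) (j : Fin L) (o : LO) (s s' : Fin T) :
    ∫ ω, Complex.exp (Complex.I * (phaseDiff V j o s s' ω : ℂ)) ∂μ
      = phaseCorr imp.delta s s' := by
  have hind : iIndepFun (fun i => V.step j o i) μ :=
    (hm.indep j).precomp (g := fun i : Fin T => SourceLabel.step o i)
      (fun a b h => by simpa using h)
  have e1 : ∀ ω, Complex.exp (Complex.I * (phaseDiff V j o s s' ω : ℂ)) =
      ∏ i, (fun r : ℝ => Complex.exp (stepCoeff s s' i * r * Complex.I)) (V.step j o i ω) :=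
    fun ω => by
      rw [← Complex.exp_sum, phaseDiff]
      congr 1
      push_cast
      rw [Finset.mul_sum]
      exact Finset.sum_congr rfl fun i _ => by ring
  simp only [e1]
  have hc : ∀ i : Fin T, Continuous
      (fun r : ℝ => Complex.exp (stepCoeff s s' i * r * Complex.I)) := fun i => by fun_prop
  rw [hind.integral_fun_prod_comp (fun i => (hm.measurable_step j o i).aemeasurable)
    (fun i => (hc i).aestronglyMeasurable)]
  have e2 : ∀ i, ∫ ω, Complex.exp (stepCoeff s s' i * (V.step j o i ω) * Complex.I) ∂μ =
      Complex.exp ((-(imp.delta * stepCoeff s s' i ^ 2 / 2) : ℝ) : ℂ) := fun i => by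
    rw [← integral_map (f := fun r : ℝ => Complex.exp (stepCoeff s s' i * r * Complex.I))
      (hm.measurable_step j o i).aemeasurable (hc i).aestronglyMeasurable, hm.law_step,
      ← charFun_apply_real, charFun_gaussianReal, Real.coe_toNNReal _ hδ]
    congr 1
    push_cast
    ring
  simp only [e2]
  rw [← Complex.exp_sum, ← Complex.ofReal_sum, ← Complex.ofReal_exp, phaseCorr]
  congr 2
  rw [← sum_stepCoeff_sq, Finset.sum_neg_distrib, Finset.mul_sum, Finset.sum_div]

lemma IsModel.integral_conj_phasor_mul (hm : IsModel net imp V μ) [IsProbabilityMeasure μ]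
    (hδ : 0 ≤ imp.delta) (osc : Antenna A n → LO) (j : Fin L) (s s' : Fin T)
    {a a' : Antenna A n} (h : osc a = osc a') :
    ∫ ω, conj (phasor osc V j s a ω) * phasor osc V j s' a' ω ∂μ = phaseCorr imp.delta s s' := by
  simp only [conj_phasor_mul_phasor osc j s s' h]
  exact hm.integral_exp_phaseDiff hδ j (osc a) s s'

/-- With a common oscillator, the rotation at time `t` cancels between two antennas. -/
lemma IsModel.integral_phasor_common (hm : IsModel net imp V μ) [IsProbabilityMeasure μ]
    (hδ : 0 ≤ imp.delta) (osc : Antenna A n → LO) (j : Fin L) (s s' t : Fin T)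
    {a a' : Antenna A n} (h : osc a = osc a') :
    ∫ ω, conj (phasor osc V j s a ω) * phasor osc V j s' a' ω *
      (phasor osc V j t a ω * conj (phasor osc V j t a' ω)) ∂μ = phaseCorr imp.delta s s' := by
  have e : ∀ ω, phasor osc V j t a ω * conj (phasor osc V j t a' ω) = 1 := fun ω => by
    have : phasor osc V j t a ω = phasor osc V j t a' ω := by
      unfold phasor phase; rw [h]
    rw [this, Complex.mul_conj, Complex.normSq_eq_norm_sq, norm_phasor]; simp
  simp only [e, mul_one]
  exact hm.integral_conj_phasor_mul hδ osc j s s' h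

/-- With separate oscillators, the phase-drifts at two antennas are independent. -/
lemma IsModel.integral_phasor_separate (hm : IsModel net imp V μ) [IsProbabilityMeasure μ]
    (hδ : 0 ≤ imp.delta) (osc : Antenna A n → LO) (j : Fin L) (s s' t : Fin T)
    {a a' : Antenna A n} (h : osc a ≠ osc a') :
    ∫ ω, conj (phasor osc V j s a ω) * phasor osc V j s' a' ω *
      (phasor osc V j t a ω * conj (phasor osc V j t a' ω)) ∂μ =
      phaseCorr imp.delta t s * phaseCorr imp.delta t s' := by
  have e : ∀ ω, conj (phasor osc V j s a ω) * phasor osc V j s' a' ω *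
      (phasor osc V j t a ω * conj (phasor osc V j t a' ω)) =
      Complex.exp (Complex.I * (phaseDiff V j (osc a) s t ω : ℂ)) *
      Complex.exp (Complex.I * (phaseDiff V j (osc a') t s' ω : ℂ)) := fun ω => by
    rw [← conj_phasor_mul_phasor osc j s t rfl, ← conj_phasor_mul_phasor osc j t s' rfl]
    ring
  have hmeas : ∀ (o : LO) (s s' : Fin T),
      Measurable[V.sigmaOn j (Set.range (SourceLabel.step o))]
        (fun ω => Complex.exp (Complex.I * (phaseDiff V j o s s' ω : ℂ))) := fun o s s' => by
    have h1 : ∀ i, Measurable[V.sigmaOn j (Set.range (SourceLabel.step o))] (V.step j o i) :=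
      fun i => measurable_iff_comap_le.2 (V.sigma_le_sigmaOn j (i := .step o i) ⟨i, rfl⟩)
    have h2 : Measurable[V.sigmaOn j (Set.range (SourceLabel.step o))] (phaseDiff V j o s s') :=
      Finset.measurable_fun_sum _ fun i _ => (h1 i).const_mul _
    have h3 : Continuous fun r : ℝ => Complex.exp (Complex.I * (r : ℂ)) := by fun_prop
    exact h3.measurable.comp h2
  simp only [e]
  rw [hm.integral_mul (j := j) (S := Set.range (SourceLabel.step (osc a)))
    (S' := Set.range (SourceLabel.step (osc a'))) ?_ (hmeas _ _ _) (hmeas _ _ _),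
    hm.integral_exp_phaseDiff hδ, hm.integral_exp_phaseDiff hδ, phaseCorr_comm _ s t]
  rw [Set.disjoint_left]
  rintro _ ⟨i, rfl⟩ ⟨i', hi'⟩
  simp only [SourceLabel.step.injEq] at hi'
  exact h hi'.1.symm

end Phases

/-! ### Covariance of the pilot signal at a single antenna -/

section Gram

variable {ι β : Type*} [Fintype ι] [DecidableEq β]

/-- The covariance matrix of the pilot signals at one antenna, which hears UE `u` with attenuation
`lam u`: `x u` are the pilots of UE `u`, `E` the correlations of the phase-drifts, `κ` and `ξ` the
levels of distortion noise and receiver noise. -/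
noncomputable def gram (lam : ι → ℝ) (x : ι → β → ℂ) (E : β → β → ℝ) (κ ξ : ℝ) : Matrix β β ℂ :=
  fun b b' => (∑ u, lam u * (x u b * conj (x u b'))) * E b b' +
    if b = b' then ((κ * (∑ u, lam u * ‖x u b‖ ^ 2) + ξ : ℝ) : ℂ) else 0

/-- The covariance of the effective channel with the pilot signals at one antenna, conjugated; `e`
are the correlations of the phases at the pilot times with the phase at the data time. -/
noncomputable def crossVec (lam : ℝ) (x : β → ℂ) (e : β → ℝ) : β → ℂ :=
  fun b => lam * conj (x b) * e b

/-- The expectation of `conj ψ_b ψ_b' |h|²` at one antenna, where `h` is the channel from UE `u`. -/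
noncomputable def gramFour (lam : ι → ℝ) (x : ι → β → ℂ) (E : β → β → ℝ) (κ ξ : ℝ) (u : ι) :
    β → β → ℂ :=
  fun b b' => lam u * gram lam x E κ ξ b' b +
    lam u ^ 2 * (conj (x u b) * x u b' * E b b' + if b = b' then (κ * ‖x u b‖ ^ 2 : ℝ) else 0)

end Gram

section Moments

variable {L K A B T n : ℕ} {LO Ω : Type*} [mΩ : MeasurableSpace Ω] {net : Network L K A B T}
  {imp : Impairments} {V : Sources L K A n T LO Ω} {μ : Measure Ω}

/-! ### Moments of the channels -/

/-- The channel from the UE `u = (l, k)`. -/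
abbrev Sources.chan (V : Sources L K A n T LO Ω) (j : Fin L) (u : Fin L × Fin K)
    (a : Antenna A n) : Ω → ℂ := V.h j u.1 u.2 a

/-- The average attenuation of the UE `u = (l, k)`. -/
abbrev Network.lamAt (net : Network L K A B T) (j : Fin L) (α : Fin A) (u : Fin L × Fin K) : ℝ :=
  net.lam j u.1 u.2 α

/-- The pilot symbols of the UE `u = (l, k)`. -/
abbrev Network.pilot (net : Network L K A B T) (u : Fin L × Fin K) (b : Fin B) : ℂ :=
  net.x u.1 u.2 b

/-- The sources that make up the channels to the antenna `a`. -/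
def antLabels (a : Antenna A n) : Set (SourceLabel L K A n T LO) :=
  {i | ∃ l k, i = .chan l k a}

lemma disjoint_antLabels {a a' : Antenna A n} (h : a ≠ a') :
    Disjoint (antLabels a : Set (SourceLabel L K A n T LO)) (antLabels a') := by
  rw [Set.disjoint_left]
  rintro _ ⟨l, k, rfl⟩ ⟨l', k', h'⟩
  simp only [SourceLabel.chan.injEq] at h'
  exact h h'.2.2

lemma antLabels_subset (a : Antenna A n) :
    (antLabels a : Set (SourceLabel L K A n T LO)) ⊆ chanLabels := by
  rintro _ ⟨l, k, rfl⟩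
  exact trivial

lemma disjoint_phaseLabels_chanLabels :
    Disjoint (phaseLabels : Set (SourceLabel L K A n T LO)) chanLabels := by
  rw [Set.disjoint_left]
  intro i h h'
  cases i <;> simp_all [phaseLabels, chanLabels]

/-- Expectations factor when one factor depends on a single source that the other omits. -/
lemma IsModel.integral_mul_compl (hm : IsModel net imp V μ) {j : Fin L}
    {i : SourceLabel L K A n T LO} {f g : Ω → ℂ}
    (hf : Tame μ (V.sigmaOn j {i}) f) (hg : Tame μ (V.sigmaOn j {i}ᶜ) g) :
    ∫ ω, f ω * g ω ∂μ = (∫ ω, f ω ∂μ) * ∫ ω, g ω ∂μ :=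
  hm.integral_mul disjoint_compl_right hf.1 hg.1

lemma chan_mem_compl {u u' : Fin L × Fin K} {a a' : Antenna A n} (h : (u, a) ≠ (u', a')) :
    SourceLabel.chan u'.1 u'.2 a' ∈
      ({SourceLabel.chan u.1 u.2 a}ᶜ : Set (SourceLabel L K A n T LO)) := by
  simp only [Set.mem_compl_iff, Set.mem_singleton_iff, SourceLabel.chan.injEq, not_and]
  intro h1 h2 h3
  exact h (Prod.ext (Prod.ext h1.symm h2.symm) h3.symm)

lemma IsModel.integral_chan_two (hm : IsModel net imp V μ) (hlam : ∀ j l k a, 0 ≤ net.lam j l k a)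
    (j : Fin L) (u u' : Fin L × Fin K) (a a' : Antenna A n) :
    ∫ ω, conj (V.chan j u a ω) * V.chan j u' a' ω ∂μ =
      if u = u' ∧ a = a' then (net.lamAt j a.1 u : ℂ) else 0 := by
  split_ifs with h
  · obtain ⟨rfl, rfl⟩ := h
    exact (hm.isStandard_h hlam j _ _ a).second
  · have h' : (u, a) ≠ (u', a') := fun e => h (by simpa using e)
    rw [hm.integral_mul_compl (hm.tame_h j u.1 u.2 a (Set.mem_singleton _)).conj
      (hm.tame_h j u'.1 u'.2 a' (chan_mem_compl h')),
      (hm.isStandard_h hlam j _ _ a).mean_conj, zero_mul]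

lemma IsModel.integral_chan_four (hm : IsModel net imp V μ)
    (hlam : ∀ j l k a, 0 ≤ net.lam j l k a)
    (j : Fin L) (u u' w : Fin L × Fin K) (a : Antenna A n) :
    ∫ ω, conj (V.chan j u a ω) * V.chan j u' a ω *
        (conj (V.chan j w a ω) * V.chan j w a ω) ∂μ =
      if u = u' then (net.lamAt j a.1 u * net.lamAt j a.1 w +
        if u = w then (net.lamAt j a.1 u : ℂ) ^ 2 else 0) else 0 := by
  have hne : ∀ {u u' : Fin L × Fin K}, u ≠ u' → (u, a) ≠ (u', a) := fun h e => h (by simpa using e)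
  split_ifs with h h2
  · subst h; subst h2
    rw [(hm.isStandard_h hlam j _ _ a).fourth]
    ring
  · subst h
    rw [hm.integral_mul_compl ((hm.tame_h j u.1 u.2 a (Set.mem_singleton _)).conj.mul
        (hm.tame_h j u.1 u.2 a (Set.mem_singleton _)))
      ((hm.tame_h j w.1 w.2 a (chan_mem_compl (hne h2))).conj.mul
        (hm.tame_h j w.1 w.2 a (chan_mem_compl (hne h2)))),
      (hm.isStandard_h hlam j _ _ a).second, (hm.isStandard_h hlam j _ _ a).second, add_zero]
  · by_cases h2 : u = w
    · subst h2
      have e : ∀ ω, conj (V.chan j u a ω) * V.chan j u' a ω *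
          (conj (V.chan j u a ω) * V.chan j u a ω) = V.chan j u' a ω *
          (conj (V.chan j u a ω) * (conj (V.chan j u a ω) * V.chan j u a ω)) := fun ω => by ring
      have t := hm.tame_h j u.1 u.2 a (chan_mem_compl (hne (Ne.symm h)))
      simp only [e]
      rw [hm.integral_mul_compl (hm.tame_h j u'.1 u'.2 a (Set.mem_singleton _))
        (t.conj.mul (t.conj.mul t)),
        (hm.isStandard_h hlam j _ _ a).mean, zero_mul]
    · have e : ∀ ω, conj (V.chan j u a ω) * V.chan j u' a ω *
          (conj (V.chan j w a ω) * V.chan j w a ω) = conj (V.chan j u a ω) * (V.chan j u' a ω *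
          (conj (V.chan j w a ω) * V.chan j w a ω)) := fun ω => by ring
      have t := hm.tame_h j w.1 w.2 a (chan_mem_compl (hne h2))
      simp only [e]
      rw [hm.integral_mul_compl (hm.tame_h j u.1 u.2 a (Set.mem_singleton _)).conj
        ((hm.tame_h j u'.1 u'.2 a (chan_mem_compl (hne h))).mul (t.conj.mul t)),
        (hm.isStandard_h hlam j _ _ a).mean_conj, zero_mul]

/-- The superposition of the channels to antenna `q.2` that is received with the pilots of time
`q.1`, before rotation by the phase-drift. -/
noncomputable def superposition (net : Network L K A B T) (V : Sources L K A n T LO Ω) (j : Fin L)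
    (q : Fin B × Antenna A n) (ω : Ω) : ℂ :=
  ∑ u, net.pilot u q.1 * V.chan j u q.2 ω

lemma IsModel.integral_superposition_chan (hm : IsModel net imp V μ)
    (hlam : ∀ j l k a, 0 ≤ net.lam j l k a)
    (j : Fin L) (q : Fin B × Antenna A n) (u : Fin L × Fin K) (a : Antenna A n) :
    ∫ ω, conj (superposition net V j q ω) * V.chan j u a ω ∂μ =
      if q.2 = a then net.lamAt j a.1 u * conj (net.pilot u q.1) else 0 := by
  have e : ∀ ω, conj (superposition net V j q ω) * V.chan j u a ω =
      ∑ u', conj (net.pilot u' q.1) * (conj (V.chan j u' q.2 ω) * V.chan j u a ω) := fun ω => by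
    rw [superposition, map_sum, Finset.sum_mul]
    exact Finset.sum_congr rfl fun u' _ => by rw [map_mul, mul_assoc]
  simp only [e]
  rw [integral_finsetSum]
  · simp only [integral_const_mul, hm.integral_chan_two hlam, mul_ite, mul_zero]
    by_cases h : q.2 = a
    · simp [h, mul_comm]
    · simp [h]
  · intro u' _
    exact ((((hm.tame_h j u'.1 u'.2 q.2 (S := chanLabels) trivial).conj.mul
      (hm.tame_h j u.1 u.2 a (S := chanLabels) trivial)).integrable).const_mul _)

variable [IsProbabilityMeasure μ]

lemma IsModel.tame_superposition (hm : IsModel net imp V μ) (j : Fin L)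
    (q : Fin B × Antenna A n) :
    Tame μ (V.sigmaOn j (antLabels q.2)) (superposition net V j q) :=
  Tame.sum fun u _ => (Tame.const _).mul (hm.tame_h j u.1 u.2 q.2 ⟨u.1, u.2, rfl⟩)

lemma IsModel.integral_superposition_two (hm : IsModel net imp V μ)
    (hlam : ∀ j l k a, 0 ≤ net.lam j l k a) (j : Fin L) (q q' : Fin B × Antenna A n) :
    ∫ ω, conj (superposition net V j q ω) * superposition net V j q' ω ∂μ =
      if q.2 = q'.2 then
        ∑ u, net.lamAt j q.2.1 u * (net.pilot u q'.1 * conj (net.pilot u q.1)) else 0 := by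
  have e : ∀ ω, conj (superposition net V j q ω) * superposition net V j q' ω =
      ∑ u, net.pilot u q'.1 * (conj (superposition net V j q ω) * V.chan j u q'.2 ω) := fun ω => by
    conv_lhs => rw [superposition.eq_def net V j q', Finset.mul_sum]
    exact Finset.sum_congr rfl fun u' _ => by ring
  simp only [e]
  rw [integral_finsetSum]
  · simp only [integral_const_mul, hm.integral_superposition_chan hlam]
    split_ifs with h
    · rw [h]
      exact Finset.sum_congr rfl fun u' _ => by ring
    · simp
  · intro u _
    exact ((((hm.tame_superposition j q).mono (V.sigmaOn_mono j (antLabels_subset _))).conj.mul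
      (hm.tame_h j u.1 u.2 q'.2 (S := chanLabels) trivial)).integrable).const_mul _

lemma IsModel.integral_superposition_four (hm : IsModel net imp V μ)
    (hlam : ∀ j l k a, 0 ≤ net.lam j l k a) (j : Fin L) (b b' : Fin B) (a : Antenna A n)
    (w : Fin L × Fin K) :
    ∫ ω, conj (superposition net V j (b, a) ω) * superposition net V j (b', a) ω *
        (conj (V.chan j w a ω) * V.chan j w a ω) ∂μ =
      net.lamAt j a.1 w * (∑ u, net.lamAt j a.1 u * (net.pilot u b' * conj (net.pilot u b)))
        + (net.lamAt j a.1 w : ℂ) ^ 2 * (conj (net.pilot w b) * net.pilot w b') := by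
  have e : ∀ ω, conj (superposition net V j (b, a) ω) * superposition net V j (b', a) ω *
      (conj (V.chan j w a ω) * V.chan j w a ω) =
      ∑ u, ∑ u', (conj (net.pilot u b) * net.pilot u' b') * (conj (V.chan j u a ω) *
        V.chan j u' a ω * (conj (V.chan j w a ω) * V.chan j w a ω)) := fun ω => by
    rw [superposition, superposition, map_sum, Finset.sum_mul_sum, Finset.sum_mul]
    refine Finset.sum_congr rfl fun u _ => ?_
    rw [Finset.sum_mul]
    exact Finset.sum_congr rfl fun u' _ => by rw [map_mul]; ring
  simp only [e]
  have t : ∀ u, Tame μ (V.sigmaOn j chanLabels) (V.chan j u a) := fun u =>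
    hm.tame_h j u.1 u.2 a (S := chanLabels) trivial
  have i : ∀ u u', Tame μ (V.sigmaOn j chanLabels) (fun ω => (conj (net.pilot u b) *
      net.pilot u' b') * (conj (V.chan j u a ω) *
        V.chan j u' a ω * (conj (V.chan j w a ω) * V.chan j w a ω))) := fun u u' =>
    (Tame.const _).mul (((t u).conj.mul (t u')).mul ((t w).conj.mul (t w)))
  rw [integral_finsetSum _ fun u _ => (Tame.sum fun u' _ => i u u').integrable]
  simp only [integral_finsetSum _ fun u' _ => (i _ u').integrable, integral_const_mul,
    hm.integral_chan_four hlam, mul_ite, mul_zero, Finset.sum_ite_eq, Finset.mem_univ, if_true,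
    mul_add, Finset.sum_add_distrib, Finset.mul_sum]
  rw [Finset.sum_ite_eq']
  simp only [Finset.mem_univ, if_true]
  congr 1
  · exact Finset.sum_congr rfl fun u _ => by ring
  · ring

end Moments

section PilotSignal

variable {L K A B T n : ℕ} {LO Ω : Type*} {net : Network L K A B T}
  {imp : Impairments} {V : Sources L K A n T LO Ω}

/-! ### Moments of the noise in the pilot signal -/

/-- The conditional standard deviation of the distortion noise given the channels. -/
noncomputable def distScale (imp : Impairments) (V : Sources L K A n T LO Ω)
    (e : Fin L → Fin K → ℝ) (j : Fin L) (a : Antenna A n) (ω : Ω) : ℂ :=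
  (Real.sqrt (imp.kappaSq * ∑ l, ∑ k, e l k * ‖V.h j l k a ω‖ ^ 2) : ℂ)

/-- The conditional variance of the distortion noise given the channels. -/
noncomputable def distVar (imp : Impairments) (V : Sources L K A n T LO Ω)
    (e : Fin L → Fin K → ℝ) (j : Fin L) (a : Antenna A n) (ω : Ω) : ℂ :=
  imp.kappaSq * ∑ u : Fin L × Fin K, e u.1 u.2 * (conj (V.chan j u a ω) * V.chan j u a ω)

lemma distVar_eq (e : Fin L → Fin K → ℝ) (j : Fin L) (a : Antenna A n) (ω : Ω) :
    distVar imp V e j a ω =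
      ((imp.kappaSq * ∑ l, ∑ k, e l k * ‖V.h j l k a ω‖ ^ 2 : ℝ) : ℂ) := by
  unfold distVar
  push_cast
  rw [Fintype.sum_prod_type]
  simp only [Complex.conj_mul']

lemma conj_distScale (e : Fin L → Fin K → ℝ) (j : Fin L) (a : Antenna A n) (ω : Ω) :
    conj (distScale imp V e j a ω) = distScale imp V e j a ω := Complex.conj_ofReal _

lemma distScale_mul_self (hκ : 0 ≤ imp.kappaSq) {e : Fin L → Fin K → ℝ} (he : ∀ l k, 0 ≤ e l k)
    (j : Fin L) (a : Antenna A n) (ω : Ω) :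
    distScale imp V e j a ω * distScale imp V e j a ω = distVar imp V e j a ω := by
  rw [distVar_eq, distScale, ← Complex.ofReal_mul, Real.mul_self_sqrt]
  exact mul_nonneg hκ (Finset.sum_nonneg fun l _ => Finset.sum_nonneg fun k _ =>
    mul_nonneg (he l k) (by positivity))

/-- The noise in the pilot signal: distortion noise and receiver noise. -/
noncomputable def pilotNoise (net : Network L K A B T) (imp : Impairments)
    (V : Sources L K A n T LO Ω) (j : Fin L) (q : Fin B × Antenna A n) (ω : Ω) : ℂ :=
  pilotDistortion net imp V j q.1 q.2 ω + V.rx j q.2 (net.τ q.1) ω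

lemma pilotSignal_eq (osc : Antenna A n → LO) (j : Fin L) (q : Fin B × Antenna A n) (ω : Ω) :
    pilotSignal net imp osc V j q ω =
      phasor osc V j (net.τ q.1) q.2 ω * superposition net V j q ω
        + pilotNoise net imp V j q ω := by
  unfold pilotSignal pilotNoise superposition
  rw [← add_assoc, Fintype.sum_prod_type, Finset.mul_sum]
  congr 2
  refine Finset.sum_congr rfl fun l _ => ?_
  rw [Finset.mul_sum]
  refine Finset.sum_congr rfl fun k _ => ?_
  rw [effChannel, phasor]
  ring

variable [MeasurableSpace Ω] {μ : Measure Ω}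

lemma dist_mem_compl {a a' : Antenna A n} {s s' : Fin T} (h : (a, s) ≠ (a', s')) :
    SourceLabel.dist a' s' ∈ ({SourceLabel.dist a s}ᶜ : Set (SourceLabel L K A n T LO)) := by
  simp only [Set.mem_compl_iff, Set.mem_singleton_iff, SourceLabel.dist.injEq, not_and]
  intro h1 h2
  exact h (Prod.ext h1.symm h2.symm)

lemma rx_mem_compl {a a' : Antenna A n} {s s' : Fin T} (h : (a, s) ≠ (a', s')) :
    SourceLabel.rx a' s' ∈ ({SourceLabel.rx a s}ᶜ : Set (SourceLabel L K A n T LO)) := by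
  simp only [Set.mem_compl_iff, Set.mem_singleton_iff, SourceLabel.rx.injEq, not_and]
  intro h1 h2
  exact h (Prod.ext h1.symm h2.symm)

lemma subset_compl_dist (a : Antenna A n) (s : Fin T) :
    (phaseLabels ∪ chanLabels : Set (SourceLabel L K A n T LO)) ⊆ {SourceLabel.dist a s}ᶜ := by
  rintro i (h | h) h' <;> rw [Set.mem_singleton_iff] at h' <;> subst h' <;> exact h

lemma subset_compl_rx (a : Antenna A n) (s : Fin T) :
    (phaseLabels ∪ chanLabels : Set (SourceLabel L K A n T LO)) ⊆ {SourceLabel.rx a s}ᶜ := by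
  rintro i (h | h) h' <;> rw [Set.mem_singleton_iff] at h' <;> subst h' <;> exact h

/-- Normalized distortion noise has mean zero and unit variance, given everything else. -/
lemma IsModel.integral_dist_mul (hm : IsModel net imp V μ) (j : Fin L) (a : Antenna A n)
    (s : Fin T) {W : Ω → ℂ} (hW : Tame μ (V.sigmaOn j {SourceLabel.dist a s}ᶜ) W) :
    ∫ ω, V.dist j a s ω * W ω ∂μ = 0 ∧ ∫ ω, conj (V.dist j a s ω) * W ω ∂μ = 0 ∧
      ∫ ω, conj (V.dist j a s ω) * V.dist j a s ω * W ω ∂μ = ∫ ω, W ω ∂μ := by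
  have t := hm.tame_dist j a s (Set.mem_singleton _)
  have h := hm.isStandard_dist j a s
  refine ⟨?_, ?_, ?_⟩
  · rw [hm.integral_mul_compl t hW, h.mean, zero_mul]
  · rw [hm.integral_mul_compl t.conj hW, h.mean_conj, zero_mul]
  · rw [hm.integral_mul_compl (t.conj.mul t) hW, h.second, Complex.ofReal_one, one_mul]

/-- Receiver noise has mean zero and variance `ξ`, given everything else. -/
lemma IsModel.integral_rx_mul (hm : IsModel net imp V μ) (hξ : 0 ≤ imp.xi) (j : Fin L)
    (a : Antenna A n)
    (s : Fin T) {W : Ω → ℂ} (hW : Tame μ (V.sigmaOn j {SourceLabel.rx a s}ᶜ) W) :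
    ∫ ω, V.rx j a s ω * W ω ∂μ = 0 ∧ ∫ ω, conj (V.rx j a s ω) * W ω ∂μ = 0 ∧
      ∫ ω, conj (V.rx j a s ω) * V.rx j a s ω * W ω ∂μ = imp.xi * ∫ ω, W ω ∂μ := by
  have t := hm.tame_rx j a s (Set.mem_singleton _)
  have h := hm.isStandard_rx hξ j a s
  refine ⟨?_, ?_, ?_⟩
  · rw [hm.integral_mul_compl t hW, h.mean, zero_mul]
  · rw [hm.integral_mul_compl t.conj hW, h.mean_conj, zero_mul]
  · rw [hm.integral_mul_compl (t.conj.mul t) hW, h.second]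

variable [IsProbabilityMeasure μ]

lemma IsModel.tame_distVar (hm : IsModel net imp V μ) (e : Fin L → Fin K → ℝ) (j : Fin L)
    (a : Antenna A n) {S : Set (SourceLabel L K A n T LO)} (hS : chanLabels ⊆ S) :
    Tame μ (V.sigmaOn j S) (distVar imp V e j a) := by
  have t : ∀ u : Fin L × Fin K, Tame μ (V.sigmaOn j S) (V.chan j u a) := fun u =>
    hm.tame_h j u.1 u.2 a (hS trivial)
  exact (Tame.const _).mul (Tame.sum fun u _ => (Tame.const _).mul ((t u).conj.mul (t u)))

lemma IsModel.tame_distScale (hm : IsModel net imp V μ) (e : Fin L → Fin K → ℝ) (j : Fin L)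
    (a : Antenna A n) {S : Set (SourceLabel L K A n T LO)} (hS : chanLabels ⊆ S) :
    Tame μ (V.sigmaOn j S) (distScale imp V e j a) := by
  have t := hm.tame_distVar e j a hS
  have e1 : ∀ ω, distScale imp V e j a ω = (Real.sqrt (distVar imp V e j a ω).re : ℂ) := fun ω => by
    rw [distVar_eq, Complex.ofReal_re, distScale]
  have hmeas : Measurable[V.sigmaOn j S] (distScale imp V e j a) := by
    have hc : Continuous fun z : ℂ => ((Real.sqrt z.re : ℝ) : ℂ) := by fun_prop
    rw [show distScale imp V e j a = (fun z : ℂ => ((Real.sqrt z.re : ℝ) : ℂ)) ∘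
      distVar imp V e j a from funext e1]
    exact hc.measurable.comp t.1
  -- `√r ≤ 1 + r²`
  refine Tame.of_norm_le (hm.sigmaOn_le j S) hmeas
    ((Tame.const 1).add (t.mul t)) fun ω => ?_
  rw [e1, distVar_eq, Complex.ofReal_re]
  generalize (imp.kappaSq * ∑ l, ∑ k, e l k * ‖V.h j l k a ω‖ ^ 2 : ℝ) = r
  rw [← Complex.ofReal_one, ← Complex.ofReal_mul, ← Complex.ofReal_add, Complex.norm_real,
    Complex.norm_real, Real.norm_of_nonneg (Real.sqrt_nonneg _), Real.norm_of_nonneg (by nlinarith)]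
  rw [Real.sqrt_le_left (by nlinarith)]
  nlinarith [sq_nonneg (r - 1), sq_nonneg (r * r), sq_nonneg r]

lemma IsModel.tame_pilotNoise (hm : IsModel net imp V μ) (j : Fin L) (q : Fin B × Antenna A n)
    {S : Set (SourceLabel L K A n T LO)} (hS : chanLabels ⊆ S)
    (hd : SourceLabel.dist q.2 (net.τ q.1) ∈ S) (hr : SourceLabel.rx q.2 (net.τ q.1) ∈ S) :
    Tame μ (V.sigmaOn j S) (pilotNoise net imp V j q) :=
  ((hm.tame_distScale _ j q.2 hS).mul (hm.tame_dist j _ _ hd)).add (hm.tame_rx j _ _ hr)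

lemma IsModel.integral_pilotNoise_mul (hm : IsModel net imp V μ) (hξ : 0 ≤ imp.xi) (j : Fin L)
    (q : Fin B × Antenna A n) {W : Ω → ℂ}
    (hW : Tame μ (V.sigmaOn j (phaseLabels ∪ chanLabels)) W) :
    ∫ ω, pilotNoise net imp V j q ω * W ω ∂μ = 0 ∧
      ∫ ω, conj (pilotNoise net imp V j q ω) * W ω ∂μ = 0 := by
  obtain ⟨b, a⟩ := q
  have hWd := hW.mono (V.sigmaOn_mono j (subset_compl_dist a (net.τ b)))
  have hWr := hW.mono (V.sigmaOn_mono j (subset_compl_rx a (net.τ b)))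
  have ts := hm.tame_distScale (fun l k => ‖net.x l k b‖ ^ 2) j a
    (Set.subset_union_right.trans (subset_compl_dist a (net.τ b)))
  have d := hm.integral_dist_mul j a (net.τ b) (ts.mul hWd)
  have r := hm.integral_rx_mul hξ j a (net.τ b) hWr
  have ids := ((hm.tame_dist j a (net.τ b) (Set.mem_univ _)).mul
    ((ts.mul hWd).mono (V.sigmaOn_mono j (Set.subset_univ _)))).integrable
  have irs := ((hm.tame_rx j a (net.τ b) (Set.mem_univ _)).mul
    (hWr.mono (V.sigmaOn_mono j (Set.subset_univ _)))).integrable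
  have idc := ((hm.tame_dist j a (net.τ b) (Set.mem_univ _)).conj.mul
    ((ts.mul hWd).mono (V.sigmaOn_mono j (Set.subset_univ _)))).integrable
  have irc := ((hm.tame_rx j a (net.τ b) (Set.mem_univ _)).conj.mul
    (hWr.mono (V.sigmaOn_mono j (Set.subset_univ _)))).integrable
  constructor
  · rw [← add_zero (0 : ℂ)]
    nth_rewrite 1 [← d.1]
    rw [← r.1, ← integral_add ids irs]
    refine integral_congr_ae (Eventually.of_forall fun ω => ?_)
    change (distScale imp V _ j a ω * V.dist j a _ ω + _) * _ = _
    ring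
  · rw [← add_zero (0 : ℂ)]
    nth_rewrite 1 [← d.2.1]
    rw [← r.2.1, ← integral_add idc irc]
    refine integral_congr_ae (Eventually.of_forall fun ω => ?_)
    change conj (distScale imp V _ j a ω * V.dist j a _ ω + _) * _ = _
    rw [map_add, map_mul, conj_distScale]
    ring

/-- The noise is uncorrelated over antennas and pilot times, given the phase-drifts and the
channels. -/
lemma IsModel.integral_pilotNoise_two (hm : IsModel net imp V μ) (hκ : 0 ≤ imp.kappaSq)
    (hξ : 0 ≤ imp.xi) (j : Fin L)
    (q q' : Fin B × Antenna A n) {W : Ω → ℂ}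
    (hW : Tame μ (V.sigmaOn j (phaseLabels ∪ chanLabels)) W) :
    ∫ ω, conj (pilotNoise net imp V j q ω) * pilotNoise net imp V j q' ω * W ω ∂μ =
      if q = q' then
        (∫ ω, distVar imp V (fun l k => ‖net.x l k q.1‖ ^ 2) j q.2 ω * W ω ∂μ)
          + imp.xi * ∫ ω, W ω ∂μ else 0 := by
  obtain ⟨b, a⟩ := q
  obtain ⟨b', a'⟩ := q'
  have hWd := fun a b => hW.mono (V.sigmaOn_mono j (subset_compl_dist a (net.τ b)))
  have hWr := fun a b => hW.mono (V.sigmaOn_mono j (subset_compl_rx a (net.τ b)))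
  have hWu := hW.mono (V.sigmaOn_mono j (Set.subset_univ _))
  set s : Fin B → Antenna A n → Ω → ℂ :=
    fun b => distScale imp V (fun l k => ‖net.x l k b‖ ^ 2) j with hs
  have ts : ∀ c a b a', Tame μ (V.sigmaOn j {SourceLabel.dist a (net.τ b)}ᶜ) (s c a') :=
    fun c a b a' => hm.tame_distScale _ j a'
      (Set.subset_union_right.trans (subset_compl_dist a (net.τ b)))
  have tsu : ∀ c a', Tame μ (V.sigmaOn j Set.univ) (s c a') :=
    fun c a' => hm.tame_distScale _ j a' (Set.subset_univ _)
  have td := fun a b => hm.tame_dist j a (net.τ b) (Set.mem_univ _)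
  have tr := fun a b => hm.tame_rx j a (net.τ b) (Set.mem_univ _)
  have e : ∀ ω, conj (pilotNoise net imp V j (b, a) ω) * pilotNoise net imp V j (b', a') ω * W ω =
      ((conj (V.dist j a (net.τ b) ω) * V.dist j a' (net.τ b') ω * (s b a ω * s b' a' ω * W ω)
      + conj (V.dist j a (net.τ b) ω) * (s b a ω * V.rx j a' (net.τ b') ω * W ω))
      + V.dist j a' (net.τ b') ω * (conj (V.rx j a (net.τ b) ω) * s b' a' ω * W ω))
      + conj (V.rx j a (net.τ b) ω) * V.rx j a' (net.τ b') ω * W ω := fun ω => by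
    change conj (distScale imp V _ j a ω * V.dist j a _ ω + _) *
      (distScale imp V _ j a' ω * V.dist j a' _ ω + _) * _ = _
    rw [map_add, map_mul, conj_distScale]
    simp only [hs]
    ring
  have i1 := (((td a b).conj.mul (td a' b')).mul (((tsu b a).mul (tsu b' a')).mul hWu))
  have i2 := ((td a b).conj.mul (((tsu b a).mul (tr a' b')).mul hWu))
  have i3 := ((td a' b').mul (((tr a b).conj.mul (tsu b' a')).mul hWu))
  have i4 := (((tr a b).conj.mul (tr a' b')).mul hWu)
  simp only [e]
  rw [integral_add ((i1.add i2).add i3).integrable i4.integrable,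
    integral_add (i1.add i2).integrable i3.integrable, integral_add i1.integrable i2.integrable]
  have z2 := (hm.integral_dist_mul j a (net.τ b) (((ts b a b a).mul
    (hm.tame_rx j a' (net.τ b') (by simp))).mul (hWd a b))).2.1
  have z3 := (hm.integral_dist_mul j a' (net.τ b') (((hm.tame_rx j a (net.τ b) (by simp)).conj.mul
    (ts b' a' b' a')).mul (hWd a' b'))).1
  rw [z2, z3, add_zero, add_zero]
  split_ifs with h
  · simp only [Prod.mk.injEq] at h
    obtain ⟨rfl, rfl⟩ := h
    rw [(hm.integral_dist_mul j a (net.τ b) (((ts b a b a).mul (ts b a b a)).mul (hWd a b))).2.2,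
      (hm.integral_rx_mul hξ j a (net.τ b) (hWr a b)).2.2]
    simp only [hs, distScale_mul_self hκ (e := fun l k => ‖net.x l k b‖ ^ 2)
      (fun l k => by positivity)]
  · have hne : (a, net.τ b) ≠ (a', net.τ b') := fun e => h (by simpa [and_comm] using e)
    have z1 := (hm.integral_dist_mul j a (net.τ b) ((hm.tame_dist j a' (net.τ b')
      (dist_mem_compl hne)).mul (((ts b a b a).mul (ts b' a b a')).mul (hWd a b)))).2.1
    have z4 := (hm.integral_rx_mul hξ j a (net.τ b) ((hm.tame_rx j a' (net.τ b')
      (rx_mem_compl hne)).mul (hWr a b))).2.1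
    rw [← add_zero (0 : ℂ)]
    nth_rewrite 1 [← z1]
    rw [← z4]
    congr 1 <;> exact integral_congr_ae (Eventually.of_forall fun ω => by simp only [hs]; ring)

end PilotSignal

section PilotMoments

variable {L K A B T n : ℕ} {LO Ω : Type*} [mΩ : MeasurableSpace Ω] {net : Network L K A B T}
  {imp : Impairments} {V : Sources L K A n T LO Ω} {μ : Measure Ω}

/-! ### Second and fourth moments of the pilot signal -/

/-- Expectations of products of a function of the phases and a function of the channels factor. -/
lemma IsModel.integral_phase_mul_chan (hm : IsModel net imp V μ) {j : Fin L} {F P : Ω → ℂ}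
    (hF : Tame μ (V.sigmaOn j phaseLabels) F) (hP : Tame μ (V.sigmaOn j chanLabels) P) :
    ∫ ω, F ω * P ω ∂μ = (∫ ω, F ω ∂μ) * ∫ ω, P ω ∂μ :=
  hm.integral_mul disjoint_phaseLabels_chanLabels hF.1 hP.1

lemma IsModel.integral_distVar_mul (hm : IsModel net imp V μ) (e : Fin L → Fin K → ℝ) (j : Fin L)
    (a : Antenna A n) {W : Ω → ℂ} (hW : Tame μ (V.sigmaOn j Set.univ) W) :
    ∫ ω, distVar imp V e j a ω * W ω ∂μ = imp.kappaSq * ∑ u : Fin L × Fin K, e u.1 u.2 *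
      ∫ ω, conj (V.chan j u a ω) * V.chan j u a ω * W ω ∂μ := by
  have t : ∀ u : Fin L × Fin K, Tame μ (V.sigmaOn j Set.univ) (V.chan j u a) := fun u =>
    hm.tame_h j u.1 u.2 a (Set.mem_univ _)
  have e1 : ∀ ω, distVar imp V e j a ω * W ω = imp.kappaSq * ∑ u : Fin L × Fin K, e u.1 u.2 *
      (conj (V.chan j u a ω) * V.chan j u a ω * W ω) := fun ω => by
    rw [distVar, mul_assoc, Finset.sum_mul]
    congr 1
    exact Finset.sum_congr rfl fun u _ => by ring
  simp only [e1]
  rw [integral_const_mul, integral_finsetSum _ fun u _ =>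
    ((((t u).conj.mul (t u)).mul hW).integrable.const_mul _)]
  simp only [integral_const_mul]

variable [IsProbabilityMeasure μ]

lemma IsModel.tame_superposition' (hm : IsModel net imp V μ) (j : Fin L)
    (q : Fin B × Antenna A n) {S : Set (SourceLabel L K A n T LO)} (hS : chanLabels ⊆ S) :
    Tame μ (V.sigmaOn j S) (superposition net V j q) :=
  (hm.tame_superposition j q).mono (V.sigmaOn_mono j ((antLabels_subset _).trans hS))

lemma IsModel.tame_pilotSignal (hm : IsModel net imp V μ) (osc : Antenna A n → LO) (j : Fin L)
    (q : Fin B × Antenna A n) {S : Set (SourceLabel L K A n T LO)} (hP : phaseLabels ⊆ S)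
    (hS : chanLabels ⊆ S) (hd : SourceLabel.dist q.2 (net.τ q.1) ∈ S)
    (hr : SourceLabel.rx q.2 (net.τ q.1) ∈ S) :
    Tame μ (V.sigmaOn j S) (pilotSignal net imp osc V j q) := by
  rw [show pilotSignal net imp osc V j q = fun ω => phasor osc V j (net.τ q.1) q.2 ω *
    superposition net V j q ω + pilotNoise net imp V j q ω from funext (pilotSignal_eq osc j q)]
  exact ((hm.tame_phasor osc j _ _ hP).mul (hm.tame_superposition' j q hS)).add
    (hm.tame_pilotNoise j q hS hd hr)

lemma IsModel.tame_effChannel (hm : IsModel net imp V μ) (osc : Antenna A n → LO) (j : Fin L)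
    (u : Fin L × Fin K) (t : Fin T) (a : Antenna A n)
    {S : Set (SourceLabel L K A n T LO)} (hP : phaseLabels ⊆ S) (hS : chanLabels ⊆ S) :
    Tame μ (V.sigmaOn j S) (effChannel osc V j u.1 u.2 t a) :=
  (hm.tame_phasor osc j _ _ hP).mul (hm.tame_h j u.1 u.2 a (hS trivial))

lemma IsModel.integral_pilotSignal_mul (hm : IsModel net imp V μ) (hξ : 0 ≤ imp.xi)
    (osc : Antenna A n → LO) (j : Fin L) (q : Fin B × Antenna A n) {W : Ω → ℂ}
    (hW : Tame μ (V.sigmaOn j (phaseLabels ∪ chanLabels)) W) :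
    ∫ ω, conj (pilotSignal net imp osc V j q ω) * W ω ∂μ =
      ∫ ω, conj (phasor osc V j (net.τ q.1) q.2 ω) * conj (superposition net V j q ω) * W ω ∂μ := by
  have tA := (hm.tame_phasor osc j (net.τ q.1) q.2 (Set.subset_univ _)).conj.mul
    (hm.tame_superposition' j q (Set.subset_univ _)).conj
  have tN := (hm.tame_pilotNoise j q (Set.subset_univ _) (Set.mem_univ _) (Set.mem_univ _)).conj
  have hWu := hW.mono (V.sigmaOn_mono j (Set.subset_univ _))
  have e : ∀ ω, conj (pilotSignal net imp osc V j q ω) * W ω =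
      conj (phasor osc V j (net.τ q.1) q.2 ω) * conj (superposition net V j q ω) * W ω
      + conj (pilotNoise net imp V j q ω) * W ω := fun ω => by
    rw [pilotSignal_eq, map_add, map_mul, add_mul]
  simp only [e]
  rw [integral_add (tA.mul hWu).integrable (tN.mul hWu).integrable,
    (hm.integral_pilotNoise_mul hξ j q hW).2, add_zero]

lemma IsModel.integral_pilotSignal_two_mul (hm : IsModel net imp V μ) (hκ : 0 ≤ imp.kappaSq)
    (hξ : 0 ≤ imp.xi) (osc : Antenna A n → LO) (j : Fin L) (q q' : Fin B × Antenna A n) {W : Ω → ℂ}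
    (hW : Tame μ (V.sigmaOn j (phaseLabels ∪ chanLabels)) W) :
    ∫ ω, conj (pilotSignal net imp osc V j q ω) * pilotSignal net imp osc V j q' ω * W ω ∂μ =
      (∫ ω, conj (phasor osc V j (net.τ q.1) q.2 ω) * phasor osc V j (net.τ q'.1) q'.2 ω *
        (conj (superposition net V j q ω) * superposition net V j q' ω) * W ω ∂μ) +
      if q = q' then
        (∫ ω, distVar imp V (fun l k => ‖net.x l k q.1‖ ^ 2) j q.2 ω * W ω ∂μ)
          + imp.xi * ∫ ω, W ω ∂μ else 0 := by
  have hPU : (phaseLabels : Set (SourceLabel L K A n T LO)) ⊆ phaseLabels ∪ chanLabels :=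
    Set.subset_union_left
  have hCU : (chanLabels : Set (SourceLabel L K A n T LO)) ⊆ phaseLabels ∪ chanLabels :=
    Set.subset_union_right
  have tU := fun q : Fin B × Antenna A n => hm.tame_phasor osc j (net.τ q.1) q.2 hPU
  have tY := fun q : Fin B × Antenna A n => hm.tame_superposition' j q hCU
  have up : V.sigmaOn j (phaseLabels ∪ chanLabels) ≤ V.sigmaOn j Set.univ :=
    V.sigmaOn_mono j (Set.subset_univ _)
  have tN := fun q : Fin B × Antenna A n =>
    hm.tame_pilotNoise j q (Set.subset_univ _) (Set.mem_univ _) (Set.mem_univ _)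
  have e : ∀ ω, conj (pilotSignal net imp osc V j q ω) * pilotSignal net imp osc V j q' ω * W ω =
      ((conj (phasor osc V j (net.τ q.1) q.2 ω) * phasor osc V j (net.τ q'.1) q'.2 ω *
        (conj (superposition net V j q ω) * superposition net V j q' ω) * W ω
      + pilotNoise net imp V j q' ω * (conj (phasor osc V j (net.τ q.1) q.2 ω) *
        conj (superposition net V j q ω) * W ω))
      + conj (pilotNoise net imp V j q ω) * (phasor osc V j (net.τ q'.1) q'.2 ω *
        superposition net V j q' ω * W ω))
      + conj (pilotNoise net imp V j q ω) * pilotNoise net imp V j q' ω * W ω := fun ω => by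
    rw [pilotSignal_eq, pilotSignal_eq, map_add, map_mul]
    ring
  have t1 := (((tU q).conj.mul (tU q')).mul ((tY q).conj.mul (tY q'))).mul hW
  have t2 := ((tU q).conj.mul (tY q).conj).mul hW
  have t3 := ((tU q').mul (tY q')).mul hW
  have i2 := (tN q').mul (t2.mono up)
  have i3 := (tN q).conj.mul (t3.mono up)
  have i4 := ((tN q).conj.mul (tN q')).mul (hW.mono up)
  simp only [e]
  rw [integral_add (((t1.mono up).add i2).add i3).integrable i4.integrable,
    integral_add ((t1.mono up).add i2).integrable i3.integrable,
    integral_add t1.integrable i2.integrable,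
    (hm.integral_pilotNoise_mul hξ j q' t2).1, (hm.integral_pilotNoise_mul hξ j q t3).2,
    hm.integral_pilotNoise_two hκ hξ j q q' hW, add_zero, add_zero]

/-- The phase correlations at the pilot times. -/
noncomputable def pilotCorr (net : Network L K A B T) (δ : ℝ) (b b' : Fin B) : ℝ :=
  phaseCorr δ (net.τ b) (net.τ b')

/-- The covariance matrix of the pilot signals at an antenna of subarray `α` in cell `j`. -/
noncomputable def Network.gramAt (net : Network L K A B T) (imp : Impairments) (j : Fin L)
    (α : Fin A) : Matrix (Fin B) (Fin B) ℂ :=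
  gram (net.lamAt j α) net.pilot (pilotCorr net imp.delta) imp.kappaSq imp.xi

lemma IsModel.integral_pilotSignal_two (hm : IsModel net imp V μ) (hκ : 0 ≤ imp.kappaSq)
    (hξ : 0 ≤ imp.xi) (hδ : 0 ≤ imp.delta) (hlam : ∀ j l k a, 0 ≤ net.lam j l k a)
    (osc : Antenna A n → LO) (j : Fin L) (q q' : Fin B × Antenna A n) :
    ∫ ω, conj (pilotSignal net imp osc V j q ω) * pilotSignal net imp osc V j q' ω ∂μ =
      if q.2 = q'.2 then net.gramAt imp j q.2.1 q'.1 q.1 else 0 := by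
  have h := hm.integral_pilotSignal_two_mul hκ hξ osc j q q'
    (W := fun _ => 1) (Tame.const 1)
  have hd := hm.integral_distVar_mul (fun l k => ‖net.x l k q.1‖ ^ 2) j q.2
    (W := fun _ => 1) (Tame.const 1)
  simp only [mul_one, integral_const, probReal_univ, one_smul] at h hd
  rw [h, hd, hm.integral_phase_mul_chan
    ((hm.tame_phasor osc j _ _ le_rfl).conj.mul (hm.tame_phasor osc j _ _ le_rfl))
    ((hm.tame_superposition' j q le_rfl).conj.mul (hm.tame_superposition' j q' le_rfl)),
    hm.integral_superposition_two hlam]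
  obtain ⟨b, a⟩ := q
  obtain ⟨b', a'⟩ := q'
  by_cases ha : a = a'
  · subst ha
    rw [hm.integral_conj_phasor_mul hδ osc j _ _ rfl]
    simp only [if_true, hm.integral_chan_two hlam, and_self, Prod.mk.injEq, and_true,
      Network.gramAt, gram, pilotCorr]
    rw [mul_comm, phaseCorr_comm]
    congr 1
    by_cases hb : b = b'
    · subst hb
      rw [if_pos rfl, if_pos rfl]
      push_cast
      congr 2
      exact Finset.sum_congr rfl fun u _ => by ring
    · rw [if_neg hb, if_neg (Ne.symm hb)]
  · simp [ha]

lemma IsModel.integral_pilotSignal_effChannel (hm : IsModel net imp V μ)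
    (hξ : 0 ≤ imp.xi) (hδ : 0 ≤ imp.delta) (hlam : ∀ j l k a, 0 ≤ net.lam j l k a)
    (osc : Antenna A n → LO) (j : Fin L) (q : Fin B × Antenna A n) (u : Fin L × Fin K)
    (t : Fin T) (a : Antenna A n) :
    ∫ ω, conj (pilotSignal net imp osc V j q ω) * effChannel osc V j u.1 u.2 t a ω ∂μ =
      if q.2 = a then crossVec (net.lamAt j a.1 u) (net.pilot u)
        (fun b => phaseCorr imp.delta t (net.τ b)) q.1 else 0 := by
  rw [hm.integral_pilotSignal_mul hξ osc j q
    (hm.tame_effChannel osc j u t a Set.subset_union_left Set.subset_union_right)]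
  have e : ∀ ω, conj (phasor osc V j (net.τ q.1) q.2 ω) * conj (superposition net V j q ω) *
      effChannel osc V j u.1 u.2 t a ω =
      (conj (phasor osc V j (net.τ q.1) q.2 ω) * phasor osc V j t a ω) *
      (conj (superposition net V j q ω) * V.chan j u a ω) := fun ω => by
    rw [effChannel, phasor, phasor]; ring
  simp only [e]
  rw [hm.integral_phase_mul_chan
    ((hm.tame_phasor osc j _ _ le_rfl).conj.mul (hm.tame_phasor osc j _ _ le_rfl))
    ((hm.tame_superposition' j q le_rfl).conj.mul (hm.tame_h j u.1 u.2 a trivial)),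
    hm.integral_superposition_chan hlam]
  split_ifs with h
  · rw [hm.integral_conj_phasor_mul hδ osc j _ _ (congrArg osc h), crossVec, phaseCorr_comm]
    ring
  · simp

lemma IsModel.integral_pilotSignal_four_same (hm : IsModel net imp V μ) (hκ : 0 ≤ imp.kappaSq)
    (hξ : 0 ≤ imp.xi) (hδ : 0 ≤ imp.delta) (hlam : ∀ j l k a, 0 ≤ net.lam j l k a)
    (osc : Antenna A n → LO) (j : Fin L) (b b' : Fin B) (a : Antenna A n) (w : Fin L × Fin K) :
    ∫ ω, conj (pilotSignal net imp osc V j (b, a) ω) * pilotSignal net imp osc V j (b', a) ω *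
        (conj (V.chan j w a ω) * V.chan j w a ω) ∂μ =
      gramFour (net.lamAt j a.1) net.pilot (pilotCorr net imp.delta) imp.kappaSq imp.xi w b b' := by
  have tw : ∀ {S : Set (SourceLabel L K A n T LO)}, chanLabels ⊆ S → Tame μ (V.sigmaOn j S)
      (fun ω => conj (V.chan j w a ω) * V.chan j w a ω) := fun hS =>
    (hm.tame_h j w.1 w.2 a (hS trivial)).conj.mul (hm.tame_h j w.1 w.2 a (hS trivial))
  rw [hm.integral_pilotSignal_two_mul hκ hξ osc j _ _ (tw Set.subset_union_right),
    hm.integral_distVar_mul _ j a (tw (Set.subset_univ _))]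
  simp only [mul_assoc (conj (phasor osc V j _ _ _) * phasor osc V j _ _ _)]
  rw [hm.integral_phase_mul_chan
    ((hm.tame_phasor osc j _ _ le_rfl).conj.mul (hm.tame_phasor osc j _ _ le_rfl))
    (((hm.tame_superposition' j (b, a) le_rfl).conj.mul
      (hm.tame_superposition' j (b', a) le_rfl)).mul (tw le_rfl)),
    hm.integral_superposition_four hlam, hm.integral_conj_phasor_mul hδ osc j _ _ rfl]
  simp only [hm.integral_chan_four hlam, hm.integral_chan_two hlam, if_true, and_self,
    Prod.mk.injEq, and_true, gramFour, gram, pilotCorr]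
  rw [phaseCorr_comm _ (net.τ b')]
  by_cases hb : b = b'
  · subst hb
    simp only [if_true]
    simp only [mul_add, Finset.sum_add_distrib, mul_ite, mul_zero, Finset.sum_ite_eq',
      Finset.mem_univ]
    push_cast
    simp only [Finset.mul_sum]
    have : ∀ u : Fin L × Fin K, (imp.kappaSq : ℂ) * ((‖net.x u.1 u.2 b‖ : ℂ) ^ 2 *
        ((net.lamAt j a.1 u : ℂ) * net.lamAt j a.1 w)) =
        net.lamAt j a.1 w * (imp.kappaSq * (net.lamAt j a.1 u * ‖net.pilot u b‖ ^ 2)) :=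
      fun u => by ring
    simp only [this, ← Finset.mul_sum]
    ring
  · simp only [if_neg hb, if_neg (Ne.symm hb), Complex.ofReal_zero]
    ring

/-- Between different antennas, only the channel of the UE itself correlates. The correlation `C`
of the phase-drifts depends on the oscillators. -/
lemma IsModel.integral_pilotSignal_four_ne (hm : IsModel net imp V μ) (hκ : 0 ≤ imp.kappaSq)
    (hξ : 0 ≤ imp.xi) (hlam : ∀ j l k a, 0 ≤ net.lam j l k a)
    (osc : Antenna A n → LO) (j : Fin L) (b b' : Fin B) {a a' : Antenna A n} (h : a ≠ a')
    (t : Fin T) {C : ℝ}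
    (hC : ∫ ω, conj (phasor osc V j (net.τ b) a ω) * phasor osc V j (net.τ b') a' ω *
      (phasor osc V j t a ω * conj (phasor osc V j t a' ω)) ∂μ = C) (u : Fin L × Fin K) :
    ∫ ω, conj (pilotSignal net imp osc V j (b, a) ω) * pilotSignal net imp osc V j (b', a') ω *
        (effChannel osc V j u.1 u.2 t a ω * conj (effChannel osc V j u.1 u.2 t a' ω)) ∂μ =
      C * (conj (net.lamAt j a.1 u * net.pilot u b) * (net.lamAt j a'.1 u * net.pilot u b')) := by
  have tH := fun a => hm.tame_effChannel osc j u t a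
    (Set.subset_union_left : phaseLabels ⊆ phaseLabels ∪ chanLabels) Set.subset_union_right
  rw [hm.integral_pilotSignal_two_mul hκ hξ osc j _ _ ((tH a).mul (tH a').conj),
    if_neg (by simp [h]), add_zero]
  have e : ∀ ω, conj (phasor osc V j (net.τ b) a ω) * phasor osc V j (net.τ b') a' ω *
      (conj (superposition net V j (b, a) ω) * superposition net V j (b', a') ω) *
      (effChannel osc V j u.1 u.2 t a ω * conj (effChannel osc V j u.1 u.2 t a' ω)) =
      (conj (phasor osc V j (net.τ b) a ω) * phasor osc V j (net.τ b') a' ω *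
      (phasor osc V j t a ω * conj (phasor osc V j t a' ω))) *
      ((conj (superposition net V j (b, a) ω) * V.chan j u a ω) *
        conj (conj (superposition net V j (b', a') ω) * V.chan j u a' ω)) := fun ω => by
    have e2 : ∀ a, effChannel osc V j u.1 u.2 t a ω = phasor osc V j t a ω * V.chan j u a ω :=
      fun a => rfl
    rw [e2, e2, map_mul, map_mul, Complex.conj_conj]
    ring
  have tY : ∀ a b, Tame μ (V.sigmaOn j (antLabels a))
      (fun ω => conj (superposition net V j (b, a) ω) * V.chan j u a ω) := fun a b =>
    (hm.tame_superposition j (b, a)).conj.mul (hm.tame_h j u.1 u.2 a ⟨u.1, u.2, rfl⟩)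
  have tU := fun s a => hm.tame_phasor osc j s a le_rfl
  have up := fun a : Antenna A n => V.sigmaOn_mono j (antLabels_subset a)
  simp only [e]
  rw [hm.integral_phase_mul_chan (((tU _ _).conj.mul (tU _ _)).mul ((tU _ _).mul (tU _ _).conj))
    (((tY a b).mono (up a)).mul ((tY a' b').mono (up a')).conj), hC,
    hm.integral_mul (disjoint_antLabels h) (tY a b).1 (tY a' b').conj.1, integral_conj,
    hm.integral_superposition_chan hlam, hm.integral_superposition_chan hlam]
  simp

end PilotMoments

/-! ### Quadratic forms of real kernels -/

section Quad

variable {ι β : Type*} [Fintype β]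

/-- The value at the complex vector `v` of the quadratic form of a real kernel `Q`. -/
noncomputable def quad (Q : β → β → ℝ) (v : β → ℂ) : ℝ :=
  ∑ b, ∑ b', Q b b' * (conj (v b) * v b').re

lemma quad_mul_self (e : β → ℝ) (v : β → ℂ) :
    quad (fun b b' => e b * e b') v = ‖∑ b, conj (v b) * e b‖ ^ 2 := by
  have h : ((‖∑ b, conj (v b) * e b‖ ^ 2 : ℝ) : ℂ) =
      ∑ b, ∑ b', ((e b * e b' : ℝ) : ℂ) * (conj (v b) * v b') := by
    push_cast
    rw [← Complex.mul_conj', map_sum, Finset.sum_mul_sum]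
    refine Finset.sum_congr rfl fun b _ => Finset.sum_congr rfl fun b' _ => ?_
    rw [map_mul, Complex.conj_conj, Complex.conj_ofReal]
    ring
  have h' := congrArg Complex.re h
  rw [Complex.ofReal_re] at h'
  rw [h', quad, Complex.re_sum]
  refine Finset.sum_congr rfl fun b _ => ?_
  rw [Complex.re_sum]
  exact Finset.sum_congr rfl fun b' _ => (Complex.re_ofReal_mul _ _).symm

lemma quad_sum {S : Type*} (s : Finset S) (Q : S → β → β → ℝ) (v : β → ℂ) :
    quad (fun b b' => ∑ i ∈ s, Q i b b') v = ∑ i ∈ s, quad (Q i) v := by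
  simp only [quad, Finset.sum_mul]
  have : ∀ b, ∑ b', ∑ i ∈ s, Q i b b' * (conj (v b) * v b').re =
      ∑ i ∈ s, ∑ b', Q i b b' * (conj (v b) * v b').re := fun b => Finset.sum_comm
  simp only [this]
  exact Finset.sum_comm

lemma quad_smul (Q : β → β → ℝ) (c : ℝ) (v : β → ℂ) :
    quad Q (fun b => c * v b) = c ^ 2 * quad Q v := by
  simp only [quad, Finset.mul_sum]
  refine Finset.sum_congr rfl fun b _ => Finset.sum_congr rfl fun b' _ => ?_
  have : conj ((c : ℂ) * v b) * (c * v b') = ((c ^ 2 : ℝ) : ℂ) * (conj (v b) * v b') := by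
    rw [map_mul, Complex.conj_ofReal]; push_cast; ring
  rw [this, Complex.re_ofReal_mul]
  ring

lemma smul_quad (Q : β → β → ℝ) (c : ℝ) (v : β → ℂ) :
    quad (fun b b' => c * Q b b') v = c * quad Q v := by
  simp only [quad, Finset.mul_sum, mul_assoc]

lemma sum_vecMul_eq (w : β → ℂ) (M : Matrix β β ℂ) :
    ∑ b, ∑ b', conj (w b) * w b' * M b' b = ∑ b, conj (w b) * (w ᵥ* M) b := by
  refine Finset.sum_congr rfl fun b _ => ?_
  simp only [Matrix.vecMul, dotProduct, Finset.mul_sum, mul_assoc]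

/-- The mean of the filtered channel of UE `u` at one antenna, when the filter has weights `w`. -/
noncomputable def chanMean (lam : ι → ℝ) (x : ι → β → ℂ) (e : β → ℝ) (w : β → ℂ) (u : ι) : ℂ :=
  ∑ b, conj (w b) * crossVec (lam u) (x u) e b

lemma chanMean_eq (lam : ι → ℝ) (x : ι → β → ℂ) (e : β → ℝ) (w : β → ℂ) (u : ι) :
    chanMean lam x e w u = ∑ b, conj (lam u * (w b * x u b)) * e b := by
  refine Finset.sum_congr rfl fun b _ => ?_
  rw [crossVec, map_mul, map_mul, Complex.conj_ofReal]
  ring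

variable [Fintype ι] [DecidableEq β]

variable {lam : ι → ℝ} {x : ι → β → ℂ} {E : β → β → ℝ} {κ ξ : ℝ}

lemma re_gram (hE : ∀ b b', E b b' = E b' b) (w : β → ℂ) :
    (∑ b, ∑ b', conj (w b) * w b' * gram lam x E κ ξ b' b).re =
      (∑ u, lam u * quad E (fun b => w b * x u b)) +
        ∑ b, (κ * (∑ u, lam u * ‖x u b‖ ^ 2) + ξ) * ‖w b‖ ^ 2 := by
  have e : ∀ b b', conj (w b) * w b' * gram lam x E κ ξ b' b =
      (∑ u, ((lam u * E b b' : ℝ) : ℂ) * (conj (w b * x u b) * (w b' * x u b'))) +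
      if b = b' then (((κ * (∑ u, lam u * ‖x u b‖ ^ 2) + ξ) * ‖w b‖ ^ 2 : ℝ) : ℂ) else 0 := by
    intro b b'
    rw [gram, hE b' b, mul_add]
    congr 1
    · rw [mul_comm (∑ u, _) (E b b' : ℂ), ← mul_assoc, Finset.mul_sum]
      refine Finset.sum_congr rfl fun u _ => ?_
      rw [map_mul]; push_cast; ring
    · by_cases h : b = b'
      · subst h
        rw [if_pos rfl, if_pos rfl, Complex.conj_mul']
        push_cast; ring
      · rw [if_neg h, if_neg (Ne.symm h), mul_zero]
  simp only [e, Finset.sum_add_distrib, Finset.sum_ite_eq, Finset.mem_univ, if_true,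
    Complex.add_re, Complex.re_sum, Complex.ofReal_re, Complex.re_ofReal_mul]
  congr 1
  simp only [quad, Finset.mul_sum]
  rw [Finset.sum_comm]
  have := fun b => Finset.sum_comm (s := (Finset.univ : Finset β)) (t := (Finset.univ : Finset ι))
    (f := fun b' u => lam u * E b b' * (conj (w b * x u b) * (w b' * x u b')).re)
  rw [Finset.sum_comm]
  simp only [this]
  rw [Finset.sum_comm]
  exact Finset.sum_congr rfl fun u _ => Finset.sum_congr rfl fun b _ =>
    Finset.sum_congr rfl fun b' _ => by ring

lemma re_gram_pos (hE : ∀ b b', E b b' = E b' b) (hQ : ∀ v, 0 ≤ quad E v) (hlam : ∀ u, 0 ≤ lam u)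
    (hpos : ∀ b, 0 < κ * (∑ u, lam u * ‖x u b‖ ^ 2) + ξ) {w : β → ℂ} (hw : w ≠ 0) :
    0 < (∑ b, ∑ b', conj (w b) * w b' * gram lam x E κ ξ b' b).re := by
  rw [re_gram hE]
  refine add_pos_of_nonneg_of_pos
    (Finset.sum_nonneg fun u _ => mul_nonneg (hlam u) (hQ _)) ?_
  obtain ⟨b, hb⟩ := Function.ne_iff.1 hw
  exact Finset.sum_pos' (fun b _ => mul_nonneg (hpos b).le (by positivity))
    ⟨b, Finset.mem_univ _, mul_pos (hpos b) (by have := norm_pos_iff.2 hb; positivity)⟩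

lemma isUnit_det_gram (hE : ∀ b b', E b b' = E b' b) (hQ : ∀ v, 0 ≤ quad E v)
    (hlam : ∀ u, 0 ≤ lam u) (hpos : ∀ b, 0 < κ * (∑ u, lam u * ‖x u b‖ ^ 2) + ξ) :
    IsUnit (gram lam x E κ ξ).det := by
  rw [isUnit_iff_ne_zero]
  intro h
  obtain ⟨w, hw, hz⟩ := Matrix.exists_vecMul_eq_zero_iff.2 h
  have := re_gram_pos hE hQ hlam hpos hw
  rw [sum_vecMul_eq, hz] at this
  simp at this

/-- The weights of the linear estimator of the channel of UE `k` from the pilot signals at one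
antenna. -/
noncomputable def weight (lam : ι → ℝ) (x : ι → β → ℂ) (E : β → β → ℝ) (κ ξ : ℝ) (e : β → ℝ)
    (k : ι) : β → ℂ :=
  crossVec (lam k) (x k) e ᵥ* (gram lam x E κ ξ)⁻¹

lemma weight_vecMul_gram (h : IsUnit (gram lam x E κ ξ).det) (e : β → ℝ) (k : ι) :
    weight lam x E κ ξ e k ᵥ* gram lam x E κ ξ = crossVec (lam k) (x k) e := by
  rw [weight, Matrix.vecMul_vecMul, Matrix.nonsing_inv_mul _ h, Matrix.vecMul_one]

/-- The second moment of the filtered channel of UE `u` at one antenna, when the filter has weights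
`w` and power `g`. -/
noncomputable def chanPower (lam : ι → ℝ) (x : ι → β → ℂ) (E : β → β → ℝ) (κ g : ℝ) (w : β → ℂ)
    (u : ι) : ℝ :=
  lam u * g + lam u ^ 2 * (quad E (fun b => w b * x u b) + κ * ∑ b, ‖w b * x u b‖ ^ 2)

lemma re_gramFour (w : β → ℂ) (u : ι) :
    (∑ b, ∑ b', conj (w b) * w b' * gramFour lam x E κ ξ u b b').re =
      chanPower lam x E κ (∑ b, ∑ b', conj (w b) * w b' * gram lam x E κ ξ b' b).re w u := by
  have e : ∀ b b', conj (w b) * w b' * gramFour lam x E κ ξ u b b' =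
      (lam u : ℂ) * (conj (w b) * w b' * gram lam x E κ ξ b' b) +
      (((lam u ^ 2 : ℝ) : ℂ) * ((E b b' : ℂ) * (conj (w b * x u b) * (w b' * x u b'))) +
        ((lam u ^ 2 : ℝ) : ℂ) * if b = b' then ((κ * ‖w b * x u b‖ ^ 2 : ℝ) : ℂ) else 0) := by
    intro b b'
    rw [gramFour]
    by_cases h : b = b'
    · subst h
      rw [if_pos rfl, if_pos rfl, norm_mul, mul_pow]
      push_cast
      rw [← Complex.conj_mul' (w b), map_mul]
      ring
    · rw [if_neg h, if_neg h, map_mul]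
      push_cast; ring
  simp only [e, Finset.sum_add_distrib, ← Finset.mul_sum, Finset.sum_ite_eq, Finset.mem_univ,
    if_true, Complex.add_re, Complex.re_ofReal_mul, Complex.re_sum, Complex.ofReal_re, chanPower,
    quad]
  ring

end Quad

/-! ### The kernel of the phase-drifts -/

section PhaseKernel

variable {T : ℕ}

/-- The phase innovations that separate the channel uses `s` and `t`. -/
def stepsBetween (s t : Fin T) : Finset (Fin T) := Finset.univ.filter fun i => ¬(i ≤ s ↔ i ≤ t)

lemma stepCoeff_mul (s s' t i : Fin T) : stepCoeff s t i * stepCoeff s' t i =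
    if i ∈ stepsBetween s t ∩ stepsBetween s' t then 1 else 0 := by
  simp only [stepCoeff, stepsBetween, Finset.mem_inter, Finset.mem_filter, Finset.mem_univ,
    true_and]
  by_cases h1 : i ≤ s <;> by_cases h2 : i ≤ s' <;> by_cases h3 : i ≤ t <;> simp [h1, h2, h3]

lemma abs_sub_eq_card (s s' t : Fin T) : |(s : ℝ) - (s' : ℝ)| = |(t : ℝ) - (s : ℝ)| +
    |(t : ℝ) - (s' : ℝ)| - 2 * (stepsBetween s t ∩ stepsBetween s' t).card := by
  have h : ((stepsBetween s t ∩ stepsBetween s' t).card : ℝ) =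
      ∑ i, stepCoeff s t i * stepCoeff s' t i := by
    simp only [stepCoeff_mul]
    rw [Finset.sum_ite_mem, Finset.univ_inter, Finset.sum_const, nsmul_eq_mul, mul_one]
  rw [h, abs_sub_comm (t : ℝ), abs_sub_comm (t : ℝ), ← sum_stepCoeff_sq, ← sum_stepCoeff_sq,
    ← sum_stepCoeff_sq, Finset.mul_sum, ← Finset.sum_add_distrib, ← Finset.sum_sub_distrib]
  refine Finset.sum_congr rfl fun i _ => ?_
  unfold stepCoeff
  ring

lemma card_stepsBetween (s t : Fin T) : ((stepsBetween s t).card : ℝ) = |(t : ℝ) - (s : ℝ)| := by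
  have := abs_sub_eq_card s s t
  rw [sub_self, abs_zero, Finset.inter_self] at this
  linarith

lemma stepsBetween_injective (t : Fin T) : Function.Injective fun s => stepsBetween s t := by
  intro s s' h
  have h1 := abs_sub_eq_card s s' t
  simp only at h
  rw [← card_stepsBetween s t, ← card_stepsBetween s' t, h, Finset.inter_self] at h1
  have h2 : (s : ℝ) - (s' : ℝ) = 0 := abs_eq_zero.1 (by rw [h1]; ring)
  exact Fin.ext (by exact_mod_cast sub_eq_zero.1 h2)

/-- The phase correlations as a Gram kernel. With `y = e^δ - 1`, the factor
`e^{δ c} = (1 + y)^c` for the `c` common innovations expands into a sum over sets of common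
innovations. -/
lemma phaseCorr_eq_sum (δ : ℝ) (s s' t : Fin T) :
    phaseCorr δ s s' = ∑ S : Finset (Fin T), (Real.exp δ - 1) ^ S.card *
      ((if S ⊆ stepsBetween s t then phaseCorr δ t s else 0) *
       (if S ⊆ stepsBetween s' t then phaseCorr δ t s' else 0)) := by
  have h1 : ∀ S : Finset (Fin T), (Real.exp δ - 1) ^ S.card *
      ((if S ⊆ stepsBetween s t then phaseCorr δ t s else 0) *
       (if S ⊆ stepsBetween s' t then phaseCorr δ t s' else 0)) =
      phaseCorr δ t s * phaseCorr δ t s' *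
        if S ∈ (stepsBetween s t ∩ stepsBetween s' t).powerset then
          (Real.exp δ - 1) ^ S.card else 0 := fun S => by
    simp only [Finset.mem_powerset, Finset.subset_inter_iff]
    by_cases a : S ⊆ stepsBetween s t <;> by_cases b : S ⊆ stepsBetween s' t <;> simp [a, b]
    ring
  simp only [h1]
  rw [← Finset.mul_sum, Finset.sum_ite_mem, Finset.univ_inter]
  have h2 := Finset.sum_pow_mul_eq_add_pow (Real.exp δ - 1) 1 (stepsBetween s t ∩ stepsBetween s' t)
  simp only [one_pow, mul_one, sub_add_cancel] at h2
  rw [h2, ← Real.exp_nat_mul, phaseCorr, phaseCorr, phaseCorr, ← Real.exp_add, ← Real.exp_add,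
    abs_sub_eq_card s s' t]
  congr 1
  ring

variable {B : ℕ} (τ : Fin B → Fin T) (t : Fin T) {δ : ℝ}

lemma quad_phaseCorr (v : Fin B → ℂ) :
    quad (fun b b' => phaseCorr δ (τ b) (τ b')) v =
      ∑ S : Finset (Fin T), (Real.exp δ - 1) ^ S.card *
        ‖∑ b, conj (v b) * ((if S ⊆ stepsBetween (τ b) t then phaseCorr δ t (τ b) else 0 : ℝ) : ℂ)‖
          ^ 2 := by
  rw [funext₂ fun b b' => phaseCorr_eq_sum δ (τ b) (τ b') t]
  simp only [quad_sum, smul_quad, quad_mul_self]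

lemma sq_norm_le_quad_phaseCorr (hδ : 0 ≤ δ) (v : Fin B → ℂ) :
    ‖∑ b, conj (v b) * (phaseCorr δ t (τ b) : ℂ)‖ ^ 2 ≤
      quad (fun b b' => phaseCorr δ (τ b) (τ b')) v := by
  rw [quad_phaseCorr τ t]
  have hy : 0 ≤ Real.exp δ - 1 := by linarith [Real.add_one_le_exp δ]
  have := Finset.single_le_sum (f := fun S : Finset (Fin T) => (Real.exp δ - 1) ^ S.card *
    ‖∑ b, conj (v b) * ((if S ⊆ stepsBetween (τ b) t then phaseCorr δ t (τ b) else 0 : ℝ) : ℂ)‖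
      ^ 2) (fun S _ => by positivity) (Finset.mem_univ ∅)
  simpa using this

/-- If the phase drifts, the filtered channel fluctuates. Among the pilot times that carry weight,
one that is farthest from `t` involves innovations that no other has in common. -/
lemma sq_norm_lt_quad_phaseCorr (hδ : 0 < δ) (hτ : Function.Injective τ) (ht : ∀ b, τ b ≠ t)
    {v : Fin B → ℂ} (hv : v ≠ 0) :
    ‖∑ b, conj (v b) * (phaseCorr δ t (τ b) : ℂ)‖ ^ 2 <
      quad (fun b b' => phaseCorr δ (τ b) (τ b')) v := by
  rw [quad_phaseCorr τ t]
  have hy : 0 < Real.exp δ - 1 := by linarith [Real.add_one_lt_exp hδ.ne']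
  obtain ⟨b₁, hb₁⟩ := Function.ne_iff.1 hv
  obtain ⟨b₀, hb₀, hmax⟩ := Finset.exists_max_image (Finset.univ.filter fun b => v b ≠ 0)
    (fun b => (stepsBetween (τ b) t).card) ⟨b₁, by simpa using hb₁⟩
  simp only [Finset.mem_filter, Finset.mem_univ, true_and] at hb₀ hmax
  set S₀ := stepsBetween (τ b₀) t with hS₀
  have hne : S₀ ≠ ∅ := by
    intro h
    refine ht b₀ (stepsBetween_injective t ?_)
    simp only [← hS₀, h]
    simp [stepsBetween]
  have e : ∀ b, conj (v b) * ((if S₀ ⊆ stepsBetween (τ b) t then phaseCorr δ t (τ b) else 0 : ℝ)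
      : ℂ) = if b = b₀ then conj (v b₀) * phaseCorr δ t (τ b₀) else 0 := fun b => by
    by_cases hb : b = b₀
    · subst hb; rw [if_pos rfl, if_pos (hS₀ ▸ subset_rfl)]
    · rw [if_neg hb]
      by_cases hvb : v b = 0
      · simp [hvb]
      · rw [if_neg, Complex.ofReal_zero, mul_zero]
        intro hsub
        exact hb (hτ (stepsBetween_injective t
          (Finset.eq_of_subset_of_card_le hsub (hmax b hvb)).symm))
  set F : Finset (Fin T) → ℝ := fun S => (Real.exp δ - 1) ^ S.card *
    ‖∑ b, conj (v b) * ((if S ⊆ stepsBetween (τ b) t then phaseCorr δ t (τ b) else 0 : ℝ) : ℂ)‖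
      ^ 2 with hF
  have h0 : F ∅ = ‖∑ b, conj (v b) * (phaseCorr δ t (τ b) : ℂ)‖ ^ 2 := by simp [hF]
  have h1 : 0 < F S₀ := by
    simp only [hF, e, Finset.sum_ite_eq', Finset.mem_univ, if_true]
    have : 0 < ‖conj (v b₀) * (phaseCorr δ t (τ b₀) : ℂ)‖ := by
      rw [norm_pos_iff]
      refine mul_ne_zero (by simpa using hb₀) ?_
      rw [Complex.ofReal_ne_zero]
      exact (Real.exp_pos _).ne'
    positivity
  rw [← h0]
  have h2 : F ∅ + F S₀ ≤ ∑ S, F S := by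
    rw [← Finset.sum_pair (Ne.symm hne)]
    exact Finset.sum_le_sum_of_subset_of_nonneg (Finset.subset_univ _)
      fun S _ _ => by simp only [hF]; positivity
  linarith

end PhaseKernel

section Filter

variable {L K A B T n : ℕ} {LO Ω : Type*} {net : Network L K A B T}
  {imp : Impairments} {V : Sources L K A n T LO Ω}

/-! ### The MRC filter and its moments -/

/-- The correlations of the phases at the pilot times with the phase at time `t`. -/
noncomputable def dataCorr (net : Network L K A B T) (δ : ℝ) (t : Fin T) (b : Fin B) : ℝ :=
  phaseCorr δ t (net.τ b)

/-- The weights that the MRC filter of the UE `(j, k)` gives to the pilot signals at an antenna of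
subarray `α`. -/
noncomputable def mrcWeight (net : Network L K A B T) (imp : Impairments) (j : Fin L) (k : Fin K)
    (t : Fin T) (α : Fin A) : Fin B → ℂ :=
  weight (net.lamAt j α) net.pilot (pilotCorr net imp.delta) imp.kappaSq imp.xi
    (dataCorr net imp.delta t) (j, k)

lemma quad_pilotCorr_nonneg (net : Network L K A B T) {δ : ℝ} (hδ : 0 ≤ δ) (v : Fin B → ℂ) :
    0 ≤ quad (pilotCorr net δ) v := by
  rcases isEmpty_or_nonempty (Fin B) with h | ⟨⟨b⟩⟩
  · simp [quad]
  · exact (sq_nonneg _).trans (sq_norm_le_quad_phaseCorr net.τ (net.τ b) hδ v)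

lemma pilotCorr_comm (net : Network L K A B T) (δ : ℝ) (b b' : Fin B) :
    pilotCorr net δ b b' = pilotCorr net δ b' b := phaseCorr_comm _ _ _

lemma isUnit_det_gramAt (hκ : 0 ≤ imp.kappaSq) (hξ : 0 < imp.xi) (hδ : 0 ≤ imp.delta)
    (hlam : ∀ j l k a, 0 ≤ net.lam j l k a) (j : Fin L) (α : Fin A) :
    IsUnit (net.gramAt imp j α).det := by
  refine isUnit_det_gram (pilotCorr_comm net _) (quad_pilotCorr_nonneg net hδ)
    (fun u => hlam _ _ _ _) fun b => add_pos_of_nonneg_of_pos (mul_nonneg hκ ?_) hξ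
  exact Finset.sum_nonneg fun u _ => mul_nonneg (hlam _ _ _ _) (by positivity)

lemma sum_weight_gram (hκ : 0 ≤ imp.kappaSq) (hξ : 0 < imp.xi)
    (hδ : 0 ≤ imp.delta) (hlam : ∀ j l k a, 0 ≤ net.lam j l k a) (j : Fin L) (k : Fin K)
    (t : Fin T) (α : Fin A) :
    ∑ b, ∑ b', conj (mrcWeight net imp j k t α b) * mrcWeight net imp j k t α b' *
      net.gramAt imp j α b' b = chanMean (net.lamAt j α) net.pilot (dataCorr net imp.delta t)
        (mrcWeight net imp j k t α) (j, k) := by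
  rw [sum_vecMul_eq, chanMean, mrcWeight, Network.gramAt,
    weight_vecMul_gram (isUnit_det_gramAt hκ hξ hδ hlam j α)]

/-- The second moment of the filtered channel of the UE `u` at one antenna of subarray `α`. -/
noncomputable def subarrayPower (net : Network L K A B T) (imp : Impairments) (j : Fin L)
    (k : Fin K) (t : Fin T) (u : Fin L × Fin K) (α : Fin A) : ℝ :=
  chanPower (net.lamAt j α) net.pilot (pilotCorr net imp.delta) imp.kappaSq
    (chanMean (net.lamAt j α) net.pilot (dataCorr net imp.delta t)
        (mrcWeight net imp j k t α) (j, k)).re (mrcWeight net imp j k t α) u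

lemma re_sum_gramFour (hκ : 0 ≤ imp.kappaSq) (hξ : 0 < imp.xi)
    (hδ : 0 ≤ imp.delta) (hlam : ∀ j l k a, 0 ≤ net.lam j l k a) (j : Fin L) (k : Fin K)
    (t : Fin T) (u : Fin L × Fin K) (α : Fin A) :
    (∑ b, ∑ b', conj (mrcWeight net imp j k t α b) * mrcWeight net imp j k t α b' *
      gramFour (net.lamAt j α) net.pilot (pilotCorr net imp.delta) imp.kappaSq imp.xi u b b').re =
      subarrayPower net imp j k t u α := by
  rw [re_gramFour, subarrayPower, ← sum_weight_gram hκ hξ hδ hlam]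
  rfl

lemma sum_antenna {M : Type*} [NonAssocSemiring M] (f : Fin A → M) :
    ∑ a : Antenna A n, f a.1 = n * ∑ α, f α := by
  rw [Fintype.sum_prod_type]
  simp [Finset.mul_sum]

lemma sum_antenna_two (f : Fin A → Fin A → ℝ) (g : Fin A → ℝ) :
    ∑ a : Antenna A n, ∑ a' : Antenna A n, (if a = a' then g a.1 else f a.1 a'.1) =
      n ^ 2 * (∑ α, ∑ α', f α α') + n * ∑ α, (g α - f α α) := by
  have e : ∀ a a' : Antenna A n, (if a = a' then g a.1 else f a.1 a'.1) =
      f a.1 a'.1 + if a = a' then g a.1 - f a.1 a.1 else 0 := fun a a' => by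
    by_cases h : a = a'
    · subst h; simp
    · simp [h]
  simp only [e, Finset.sum_add_distrib, Finset.sum_ite_eq, Finset.mem_univ, if_true]
  rw [sum_antenna (fun α => g α - f α α)]
  congr 1
  have : ∀ a : Antenna A n, ∑ a' : Antenna A n, f a.1 a'.1 = n * ∑ α', f a.1 α' := fun a =>
    sum_antenna (f a.1)
  simp only [this]
  rw [sum_antenna (fun α => (n : ℝ) * ∑ α', f α α'), ← Finset.mul_sum]
  ring

lemma quad_sum_apply {β S : Type*} [Fintype β] [Fintype S] (Q : β → β → ℝ) (z : S → β → ℂ) :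
    quad Q (fun b => ∑ α, z α b) =
      ∑ α, ∑ α', ∑ b, ∑ b', Q b b' * (conj (z α b) * z α' b').re := by
  have e : ∀ b b', Q b b' * (conj (∑ α, z α b) * ∑ α', z α' b').re =
      ∑ α, ∑ α', Q b b' * (conj (z α b) * z α' b').re := fun b b' => by
    rw [map_sum, Finset.sum_mul_sum, Complex.re_sum, Finset.mul_sum]
    simp only [Complex.re_sum, Finset.mul_sum]
  simp only [quad, e]
  simp only [Finset.sum_comm (s := (Finset.univ : Finset β)) (t := (Finset.univ : Finset S))]

variable [MeasurableSpace Ω] {μ : Measure Ω} [IsProbabilityMeasure μ]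

lemma IsModel.crossCov_eq (hm : IsModel net imp V μ)
    (hξ : 0 ≤ imp.xi) (hδ : 0 ≤ imp.delta) (hlam : ∀ j l k a, 0 ≤ net.lam j l k a)
    (osc : Antenna A n → LO) (j l : Fin L) (k : Fin K) (t : Fin T) (a : Antenna A n)
    (q : Fin B × Antenna A n) :
    crossCov net imp osc V μ j l k t a q =
      if q.2 = a then crossVec (net.lamAt j a.1 (l, k)) (net.pilot (l, k))
        (dataCorr net imp.delta t) q.1 else 0 := by
  have h := hm.integral_pilotSignal_effChannel hξ hδ hlam osc j q (l, k) t a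
  simp only [mul_comm (conj _)] at h
  exact h

/-- The pilot signals of different antennas are uncorrelated, even with a common oscillator, since
their channels are independent. -/
lemma IsModel.pilotCov_eq (hm : IsModel net imp V μ) (hκ : 0 ≤ imp.kappaSq)
    (hξ : 0 ≤ imp.xi) (hδ : 0 ≤ imp.delta) (hlam : ∀ j l k a, 0 ≤ net.lam j l k a)
    (osc : Antenna A n → LO) (j : Fin L) :
    pilotCov net imp osc V μ j =
      Matrix.blockDiagonal fun a : Antenna A n => net.gramAt imp j a.1 := by
  ext q q'
  have h := hm.integral_pilotSignal_two hκ hξ hδ hlam osc j q' q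
  simp only [mul_comm (conj _)] at h
  rw [Matrix.blockDiagonal_apply]
  refine h.trans ?_
  by_cases ha : q.2 = q'.2
  · rw [if_pos ha, if_pos ha.symm, ha]
  · rw [if_neg ha, if_neg (Ne.symm ha)]

/-- The MRC filter estimates the channel to each antenna from the pilot signals at that antenna. -/
lemma IsModel.mrc_eq (hm : IsModel net imp V μ) (hκ : 0 ≤ imp.kappaSq)
    (hξ : 0 < imp.xi) (hδ : 0 ≤ imp.delta) (hlam : ∀ j l k a, 0 ≤ net.lam j l k a)
    (osc : Antenna A n → LO) (j : Fin L) (k : Fin K) (t : Fin T) (ω : Ω) (a : Antenna A n) :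
    mrc net imp osc V μ j k t ω a =
      ∑ b, mrcWeight net imp j k t a.1 b * pilotSignal net imp osc V j (b, a) ω := by
  have hinv : (pilotCov net imp osc V μ j)⁻¹ =
      Matrix.blockDiagonal fun a : Antenna A n => (net.gramAt imp j a.1)⁻¹ := by
    rw [hm.pilotCov_eq hκ hξ.le hδ hlam]
    refine Matrix.inv_eq_right_inv ?_
    rw [← Matrix.blockDiagonal_mul]
    simp only [Matrix.mul_nonsing_inv _ (isUnit_det_gramAt hκ hξ hδ hlam j _)]
    exact Matrix.blockDiagonal_one
  have hrow : ∀ q : Fin B × Antenna A n,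
      (crossCov net imp osc V μ j j k t * (pilotCov net imp osc V μ j)⁻¹) a q =
        if q.2 = a then mrcWeight net imp j k t a.1 q.1 else 0 := fun q => by
    rw [hinv, Matrix.mul_apply, Fintype.sum_prod_type]
    simp only [hm.crossCov_eq hξ.le hδ hlam, Matrix.blockDiagonal_apply, ite_mul, zero_mul,
      Finset.sum_ite_eq', Finset.mem_univ, if_true, mul_ite, mul_zero]
    split_ifs with h
    · subst h; rfl
    · simp
  rw [mrc, lmmse, Matrix.mulVec, dotProduct, Fintype.sum_prod_type]
  simp only [hrow, ite_mul, zero_mul, Finset.sum_ite_eq', Finset.mem_univ, if_true]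

/-- Filtering a signal `Z` correlates it, antenna by antenna, with the pilot signals. -/
lemma IsModel.star_mrc_dotProduct (hm : IsModel net imp V μ) (hκ : 0 ≤ imp.kappaSq)
    (hξ : 0 < imp.xi) (hδ : 0 ≤ imp.delta) (hlam : ∀ j l k a, 0 ≤ net.lam j l k a)
    (osc : Antenna A n → LO) (j : Fin L) (k : Fin K) (t : Fin T) (Z : Antenna A n → Ω → ℂ)
    (ω : Ω) : star (mrc net imp osc V μ j k t ω) ⬝ᵥ (fun a => Z a ω) =
      ∑ a, ∑ b, conj (mrcWeight net imp j k t a.1 b) *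
        (conj (pilotSignal net imp osc V j (b, a) ω) * Z a ω) := by
  rw [dotProduct]
  refine Finset.sum_congr rfl fun a _ => ?_
  rw [Pi.star_apply, hm.mrc_eq hκ hξ hδ hlam, star_sum, Finset.sum_mul]
  refine Finset.sum_congr rfl fun b _ => ?_
  rw [star_mul', mul_assoc]
  rfl

lemma IsModel.tame_pilotSignal' (hm : IsModel net imp V μ) (osc : Antenna A n → LO) (j : Fin L)
    (q : Fin B × Antenna A n) :
    Tame μ (V.sigmaOn j Set.univ) (pilotSignal net imp osc V j q) :=
  hm.tame_pilotSignal osc j q (Set.subset_univ _) (Set.subset_univ _) (Set.mem_univ _)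
    (Set.mem_univ _)

lemma IsModel.tame_star_mrc_dotProduct (hm : IsModel net imp V μ) (hκ : 0 ≤ imp.kappaSq)
    (hξ : 0 < imp.xi) (hδ : 0 ≤ imp.delta) (hlam : ∀ j l k a, 0 ≤ net.lam j l k a)
    (osc : Antenna A n → LO) (j : Fin L) (k : Fin K) (t : Fin T) {Z : Antenna A n → Ω → ℂ}
    (hZ : ∀ a, Tame μ (V.sigmaOn j Set.univ) (Z a)) :
    Tame μ (V.sigmaOn j Set.univ)
      (fun ω => star (mrc net imp osc V μ j k t ω) ⬝ᵥ (fun a => Z a ω)) := by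
  rw [funext (hm.star_mrc_dotProduct hκ hξ hδ hlam osc j k t Z)]
  exact Tame.sum fun a _ => Tame.sum fun b _ =>
    (Tame.const _).mul ((hm.tame_pilotSignal' osc j (b, a)).conj.mul (hZ a))

lemma IsModel.integral_sq_star_mrc_dotProduct (hm : IsModel net imp V μ) (hκ : 0 ≤ imp.kappaSq)
    (hξ : 0 < imp.xi) (hδ : 0 ≤ imp.delta) (hlam : ∀ j l k a, 0 ≤ net.lam j l k a)
    (osc : Antenna A n → LO) (j : Fin L) (k : Fin K) (t : Fin T) {Z : Antenna A n → Ω → ℂ}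
    (hZ : ∀ a, Tame μ (V.sigmaOn j Set.univ) (Z a)) :
    ∫ ω, ‖star (mrc net imp osc V μ j k t ω) ⬝ᵥ (fun a => Z a ω)‖ ^ 2 ∂μ =
      ∑ a, ∑ a', (∑ b, ∑ b',
        conj (mrcWeight net imp j k t a.1 b) * mrcWeight net imp j k t a'.1 b' *
        ∫ ω, conj (pilotSignal net imp osc V j (b, a) ω) * pilotSignal net imp osc V j (b', a') ω *
          (Z a ω * conj (Z a' ω)) ∂μ).re := by
  have e : ∀ ω, ((‖star (mrc net imp osc V μ j k t ω) ⬝ᵥ (fun a => Z a ω)‖ ^ 2 : ℝ) : ℂ) =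
      ∑ a, ∑ a', ∑ b, ∑ b',
        conj (mrcWeight net imp j k t a.1 b) * mrcWeight net imp j k t a'.1 b' *
        (conj (pilotSignal net imp osc V j (b, a) ω) * pilotSignal net imp osc V j (b', a') ω *
          (Z a ω * conj (Z a' ω))) := fun ω => by
    push_cast
    rw [← Complex.mul_conj', hm.star_mrc_dotProduct hκ hξ hδ hlam, map_sum, Finset.sum_mul_sum]
    refine Finset.sum_congr rfl fun a _ => Finset.sum_congr rfl fun a' _ => ?_
    rw [map_sum, Finset.sum_mul_sum]
    refine Finset.sum_congr rfl fun b _ => Finset.sum_congr rfl fun b' _ => ?_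
    simp only [map_mul, Complex.conj_conj]
    ring
  have ti : ∀ a a' b b', Tame μ (V.sigmaOn j Set.univ) (fun ω =>
      conj (mrcWeight net imp j k t a.1 b) * mrcWeight net imp j k t a'.1 b' *
        (conj (pilotSignal net imp osc V j (b, a) ω) * pilotSignal net imp osc V j (b', a') ω *
          (Z a ω * conj (Z a' ω)))) := fun a a' b b' =>
    (Tame.const _).mul (((hm.tame_pilotSignal' osc j (b, a)).conj.mul
      (hm.tame_pilotSignal' osc j (b', a'))).mul ((hZ a).mul (hZ a').conj))
  have h : ((∫ ω, ‖star (mrc net imp osc V μ j k t ω) ⬝ᵥ (fun a => Z a ω)‖ ^ 2 ∂μ : ℝ) : ℂ) =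
      ∑ a, ∑ a', ∑ b, ∑ b',
        conj (mrcWeight net imp j k t a.1 b) * mrcWeight net imp j k t a'.1 b' *
        ∫ ω, conj (pilotSignal net imp osc V j (b, a) ω) * pilotSignal net imp osc V j (b', a') ω *
          (Z a ω * conj (Z a' ω)) ∂μ := by
    rw [← integral_complex_ofReal]
    simp only [e]
    rw [integral_finsetSum _ fun a _ => (Tame.sum fun a' _ => Tame.sum fun b _ =>
      Tame.sum fun b' _ => ti a a' b b').integrable]
    refine Finset.sum_congr rfl fun a _ => ?_
    rw [integral_finsetSum _ fun a' _ => (Tame.sum fun b _ =>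
      Tame.sum fun b' _ => ti a a' b b').integrable]
    refine Finset.sum_congr rfl fun a' _ => ?_
    rw [integral_finsetSum _ fun b _ => (Tame.sum fun b' _ => ti a a' b b').integrable]
    refine Finset.sum_congr rfl fun b _ => ?_
    rw [integral_finsetSum _ fun b' _ => (ti a a' b b').integrable]
    exact Finset.sum_congr rfl fun b' _ => integral_const_mul _ _
  have h' := congrArg Complex.re h
  rw [Complex.ofReal_re] at h'
  rw [h', Complex.re_sum]
  exact Finset.sum_congr rfl fun a _ => Complex.re_sum _ _

variable (hm : IsModel net imp V μ) (hκ : 0 ≤ imp.kappaSq) (hξ : 0 < imp.xi)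
  (hδ : 0 ≤ imp.delta) (hlam : ∀ j l k a, 0 ≤ net.lam j l k a) (osc : Antenna A n → LO)
  (j : Fin L) (k : Fin K) (t : Fin T)

include hm hκ hξ hδ hlam

theorem IsModel.integral_filteredChannel (l : Fin L) (m : Fin K) :
    ∫ ω, filteredChannel net imp osc V μ j k l m t ω ∂μ =
      n * ∑ α, chanMean (net.lamAt j α) net.pilot (dataCorr net imp.delta t)
        (mrcWeight net imp j k t α) (l, m) := by
  have e : ∀ ω, filteredChannel net imp osc V μ j k l m t ω = _ := fun ω =>
    hm.star_mrc_dotProduct hκ hξ hδ hlam osc j k t (fun a => effChannel osc V j l m t a) ω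
  have ti : ∀ a b, Tame μ (V.sigmaOn j Set.univ) (fun ω =>
      conj (mrcWeight net imp j k t a.1 b) *
        (conj (pilotSignal net imp osc V j (b, a) ω) * effChannel osc V j l m t a ω)) := fun a b =>
    (Tame.const _).mul ((hm.tame_pilotSignal' osc j (b, a)).conj.mul
      (hm.tame_effChannel osc j (l, m) t a (Set.subset_univ _) (Set.subset_univ _)))
  simp only [e]
  rw [integral_finsetSum _ fun a _ => (Tame.sum fun b _ => ti a b).integrable, ← sum_antenna]
  refine Finset.sum_congr rfl fun a _ => ?_
  rw [integral_finsetSum _ fun b _ => (ti a b).integrable, chanMean]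
  refine Finset.sum_congr rfl fun b _ => ?_
  rw [integral_const_mul, hm.integral_pilotSignal_effChannel hξ.le hδ hlam osc j (b, a) (l, m) t a,
    if_pos rfl]
  rfl

/-- By orthogonality of the estimation error, the filter power is the mean of the filtered
channel. -/
theorem IsModel.filterPower_eq :
    (filterPower net imp osc V μ j k t : ℂ) =
      n * ∑ α, chanMean (net.lamAt j α) net.pilot (dataCorr net imp.delta t)
        (mrcWeight net imp j k t α) (j, k) := by
  have e : ∀ ω, ((∑ a, ‖mrc net imp osc V μ j k t ω a‖ ^ 2 : ℝ) : ℂ) =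
      ∑ a, ∑ b, ∑ b', conj (mrcWeight net imp j k t a.1 b) * mrcWeight net imp j k t a.1 b' *
        (conj (pilotSignal net imp osc V j (b, a) ω) * pilotSignal net imp osc V j (b', a) ω) :=
    fun ω => by
    push_cast
    refine Finset.sum_congr rfl fun a _ => ?_
    rw [← Complex.conj_mul', hm.mrc_eq hκ hξ hδ hlam, map_sum, Finset.sum_mul_sum]
    refine Finset.sum_congr rfl fun b _ => Finset.sum_congr rfl fun b' _ => ?_
    simp only [map_mul]
    ring
  have ti : ∀ a b b', Tame μ (V.sigmaOn j Set.univ) (fun ω =>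
      conj (mrcWeight net imp j k t a.1 b) * mrcWeight net imp j k t a.1 b' *
        (conj (pilotSignal net imp osc V j (b, a) ω) * pilotSignal net imp osc V j (b', a) ω)) :=
    fun a b b' => (Tame.const _).mul ((hm.tame_pilotSignal' osc j (b, a)).conj.mul
      (hm.tame_pilotSignal' osc j (b', a)))
  rw [filterPower, ← integral_complex_ofReal]
  simp only [e]
  rw [integral_finsetSum _ fun a _ => (Tame.sum fun b _ =>
      Tame.sum fun b' _ => ti a b b').integrable, ← sum_antenna]
  refine Finset.sum_congr rfl fun a _ => ?_
  rw [integral_finsetSum _ fun b _ => (Tame.sum fun b' _ => ti a b b').integrable,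
    ← sum_weight_gram hκ hξ hδ hlam]
  refine Finset.sum_congr rfl fun b _ => ?_
  rw [integral_finsetSum _ fun b' _ => (ti a b b').integrable]
  refine Finset.sum_congr rfl fun b' _ => ?_
  rw [integral_const_mul, hm.integral_pilotSignal_two hκ hξ.le hδ hlam, if_pos rfl]

/-- Every pair of different antennas contributes a term given by the kernel `C`; for pairs of equal
antennas this term is replaced by the power of the filtered channel at one antenna. -/
theorem IsModel.integral_sq_filteredChannel (C : Fin B → Fin B → ℝ)
    (hC : ∀ a a', a ≠ a' → ∀ b b', ∫ ω, conj (phasor osc V j (net.τ b) a ω) *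
      phasor osc V j (net.τ b') a' ω *
      (phasor osc V j t a ω * conj (phasor osc V j t a' ω)) ∂μ = C b b') (l : Fin L) (m : Fin K) :
    ∫ ω, ‖filteredChannel net imp osc V μ j k l m t ω‖ ^ 2 ∂μ =
      n ^ 2 * quad C (fun b => ∑ α, net.lamAt j α (l, m) * (mrcWeight net imp j k t α b *
        net.pilot (l, m) b))
      + n * ∑ α, (subarrayPower net imp j k t (l, m) α -
        quad C (fun b => net.lamAt j α (l, m) * (mrcWeight net imp j k t α b *
          net.pilot (l, m) b))) := by
  have h := hm.integral_sq_star_mrc_dotProduct hκ hξ hδ hlam osc j k t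
    (Z := fun a => effChannel osc V j l m t a)
    fun a => hm.tame_effChannel osc j (l, m) t a (Set.subset_univ _) (Set.subset_univ _)
  refine h.trans ?_
  rw [quad_sum_apply]
  rw [show (∑ α, (subarrayPower net imp j k t (l, m) α -
        quad C (fun b => net.lamAt j α (l, m) * (mrcWeight net imp j k t α b *
          net.pilot (l, m) b)))) = ∑ α, (subarrayPower net imp j k t (l, m) α -
        (fun α α' => ∑ b, ∑ b', C b b' * (conj (net.lamAt j α (l, m) *
          (mrcWeight net imp j k t α b * net.pilot (l, m) b)) * (net.lamAt j α' (l, m) *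
          (mrcWeight net imp j k t α' b' * net.pilot (l, m) b'))).re) α α) from rfl,
    ← sum_antenna_two]
  refine Finset.sum_congr rfl fun a _ => Finset.sum_congr rfl fun a' _ => ?_
  split_ifs with ha
  · subst ha
    rw [← re_sum_gramFour hκ hξ hδ hlam]
    congr 1
    refine Finset.sum_congr rfl fun b _ => Finset.sum_congr rfl fun b' _ => ?_
    rw [← hm.integral_pilotSignal_four_same hκ hξ.le hδ hlam osc]
    congr 1
    refine integral_congr_ae (Eventually.of_forall fun ω => ?_)
    have e2 : effChannel osc V j l m t a ω = phasor osc V j t a ω * V.h j l m a ω := rfl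
    have e3 := Complex.mul_conj' (phasor osc V j t a ω)
    rw [norm_phasor, Complex.ofReal_one, one_pow] at e3
    simp only [e2, map_mul]
    linear_combination (conj (pilotSignal net imp osc V j (b, a) ω) *
      pilotSignal net imp osc V j (b', a) ω * (V.h j l m a ω * conj (V.h j l m a ω))) * e3
  · rw [Complex.re_sum]
    refine Finset.sum_congr rfl fun b _ => ?_
    rw [Complex.re_sum]
    refine Finset.sum_congr rfl fun b' _ => ?_
    rw [hm.integral_pilotSignal_four_ne hκ hξ.le hlam osc j b b' ha t (hC a a' ha b b') (l, m),
      ← Complex.re_ofReal_mul]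
    congr 1
    simp only [map_mul]
    ring

/-- The distortion noise at the data time is uncorrelated over the antennas, and its conditional
variance is a combination of the powers of the channels; so the moments of the filtered channels at
single antennas determine its power. -/
theorem IsModel.integral_sq_filteredDistortion (hp : ∀ l k, 0 ≤ net.p l k)
    (ht : ∀ b, net.τ b ≠ t) :
    ∫ ω, ‖filteredDistortion net imp osc V μ j k t ω‖ ^ 2 ∂μ =
      n * ∑ α, imp.kappaSq * ∑ u : Fin L × Fin K, net.p u.1 u.2 *
        subarrayPower net imp j k t u α := by
  have tυ : ∀ a, Tame μ (V.sigmaOn j Set.univ) (dataDistortion net imp V j t a) := fun a =>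
    (hm.tame_distScale _ j a (Set.subset_univ _)).mul (hm.tame_dist j a t (Set.mem_univ _))
  refine (hm.integral_sq_star_mrc_dotProduct hκ hξ hδ hlam osc j k t tυ).trans ?_
  rw [← sum_antenna]
  refine Finset.sum_congr rfl fun a _ => ?_
  have tψ : ∀ b a', Tame μ (V.sigmaOn j {SourceLabel.dist a t}ᶜ)
      (pilotSignal net imp osc V j (b, a')) := fun b a' =>
    hm.tame_pilotSignal osc j _ (Set.subset_union_left.trans (subset_compl_dist a t))
      (Set.subset_union_right.trans (subset_compl_dist a t))
      (dist_mem_compl fun h => ht b (by simpa using (congrArg Prod.snd h).symm)) (by simp)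
  have ts : ∀ a', Tame μ (V.sigmaOn j {SourceLabel.dist a t}ᶜ)
      (distScale imp V net.p j a') := fun a' =>
    hm.tame_distScale _ j a' (Set.subset_union_right.trans (subset_compl_dist a t))
  have hυ : ∀ a ω, dataDistortion net imp V j t a ω =
      distScale imp V net.p j a ω * V.dist j a t ω := fun a ω => rfl
  rw [Finset.sum_eq_single a]
  · have key : ∀ b b', ∫ ω, conj (pilotSignal net imp osc V j (b, a) ω) *
        pilotSignal net imp osc V j (b', a) ω *
        (dataDistortion net imp V j t a ω * conj (dataDistortion net imp V j t a ω)) ∂μ =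
        imp.kappaSq * ∑ u : Fin L × Fin K, net.p u.1 u.2 *
          gramFour (net.lamAt j a.1) net.pilot (pilotCorr net imp.delta) imp.kappaSq imp.xi u
            b b' := fun b b' => by
      have h1 := (hm.integral_dist_mul j a t (((tψ b a).conj.mul (tψ b' a)).mul
        ((ts a).mul (ts a)))).2.2
      simp only [distScale_mul_self hκ hp] at h1
      have h2 := hm.integral_distVar_mul net.p j a ((hm.tame_pilotSignal' osc j (b, a)).conj.mul
        (hm.tame_pilotSignal' osc j (b', a)))
      have h3 : ∀ u : Fin L × Fin K, ∫ ω, conj (V.chan j u a ω) * V.chan j u a ω *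
          (conj (pilotSignal net imp osc V j (b, a) ω) * pilotSignal net imp osc V j (b', a) ω) ∂μ =
          gramFour (net.lamAt j a.1) net.pilot (pilotCorr net imp.delta) imp.kappaSq imp.xi u
            b b' := fun u => by
        rw [← hm.integral_pilotSignal_four_same hκ hξ.le hδ hlam osc]
        exact integral_congr_ae (Eventually.of_forall fun ω => by ring)
      simp only [h3] at h2
      rw [← h2]
      refine Eq.trans ?_ (h1.trans ?_)
      · refine integral_congr_ae (Eventually.of_forall fun ω => ?_)
        have e1 := distScale_mul_self hκ hp (imp := imp) (V := V) j a ω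
        have e2 := conj_distScale (imp := imp) (V := V) net.p j a ω
        simp only [hυ, map_mul, e2]
        rw [← e1]
        ring
      · exact integral_congr_ae (Eventually.of_forall fun ω => by ring)
    have swap : ∑ b, ∑ b', conj (mrcWeight net imp j k t a.1 b) * mrcWeight net imp j k t a.1 b' *
        (imp.kappaSq * ∑ u : Fin L × Fin K, net.p u.1 u.2 *
          gramFour (net.lamAt j a.1) net.pilot (pilotCorr net imp.delta) imp.kappaSq imp.xi u
            b b') = imp.kappaSq * ∑ u : Fin L × Fin K, net.p u.1 u.2 * ∑ b, ∑ b',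
          conj (mrcWeight net imp j k t a.1 b) * mrcWeight net imp j k t a.1 b' *
          gramFour (net.lamAt j a.1) net.pilot (pilotCorr net imp.delta) imp.kappaSq imp.xi u
            b b' := by
      simp only [Finset.mul_sum]
      rw [Finset.sum_congr rfl fun b _ => Finset.sum_comm, Finset.sum_comm]
      exact Finset.sum_congr rfl fun u _ => Finset.sum_congr rfl fun b _ =>
        Finset.sum_congr rfl fun b' _ => by ring
    simp only [key]
    rw [swap, Complex.re_ofReal_mul, Complex.re_sum]
    congr 1
    refine Finset.sum_congr rfl fun u _ => ?_
    rw [Complex.re_ofReal_mul, re_sum_gramFour hκ hξ hδ hlam]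
  · intro a' _ ha'
    have : ∀ b b', ∫ ω, conj (pilotSignal net imp osc V j (b, a) ω) *
        pilotSignal net imp osc V j (b', a') ω *
        (dataDistortion net imp V j t a ω * conj (dataDistortion net imp V j t a' ω)) ∂μ = 0 :=
      fun b b' => by
      rw [← (hm.integral_dist_mul j a t (((tψ b a).conj.mul (tψ b' a')).mul
        ((ts a).mul ((ts a').conj.mul (hm.tame_dist j a' t (dist_mem_compl
          (fun h => ha' (congrArg Prod.fst h).symm))).conj)))).1]
      refine integral_congr_ae (Eventually.of_forall fun ω => ?_)
      simp only [hυ, map_mul]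
      ring
    simp only [this, mul_zero, Finset.sum_const_zero, Complex.zero_re]
  · simp

end Filter

/-! ### Interference as a function of the second-order statistics -/

section Gram

variable {ι β : Type*} [Fintype ι] [DecidableEq β]
  {lam : ι → ℝ} {x : ι → β → ℂ} {E : β → β → ℝ} {κ ξ : ℝ} {e : β → ℝ} {k : ι}

lemma conj_gram (hE : ∀ b b', E b b' = E b' b) (b b' : β) :
    conj (gram lam x E κ ξ b b') = gram lam x E κ ξ b' b := by
  rw [gram, gram, map_add, map_mul, map_sum, Complex.conj_ofReal, hE b b']
  congr 1
  · congr 1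
    refine Finset.sum_congr rfl fun u _ => ?_
    simp only [map_mul, Complex.conj_conj, Complex.conj_ofReal]
    ring
  · by_cases h : b = b'
    · subst h; simp
    · simp [h, Ne.symm h]

lemma gram_smul (ρ : ℝ) : gram lam x (fun b b' => ρ * E b b') (ρ * κ) (ρ * ξ) =
    (ρ : ℂ) • gram lam x E κ ξ := by
  ext b b'
  simp only [gram, Matrix.smul_apply, smul_eq_mul, mul_add, mul_ite, mul_zero]
  congr 1
  · push_cast; ring
  · split_ifs
    · push_cast; ring
    · rfl

variable [Fintype β]

/-- The mean of the filtered channel of the desired UE is the power of the filter. -/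
lemma chanMean_weight_eq (h : IsUnit (gram lam x E κ ξ).det) :
    chanMean lam x e (weight lam x E κ ξ e k) k =
      ∑ b, ∑ b', conj (weight lam x E κ ξ e k b) * weight lam x E κ ξ e k b' *
        gram lam x E κ ξ b' b := by
  rw [sum_vecMul_eq, weight_vecMul_gram h, chanMean]

lemma chanMean_weight_im (hE : ∀ b b', E b b' = E b' b) (h : IsUnit (gram lam x E κ ξ).det) :
    (chanMean lam x e (weight lam x E κ ξ e k) k).im = 0 := by
  rw [chanMean_weight_eq h, ← Complex.conj_eq_iff_im, map_sum]
  simp only [map_sum, map_mul, conj_gram hE, Complex.conj_conj]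
  rw [Finset.sum_comm]
  exact Finset.sum_congr rfl fun b _ => Finset.sum_congr rfl fun b' _ => by ring

lemma weight_eq_zero (h : lam k = 0) : weight lam x E κ ξ e k = 0 := by
  have : crossVec (lam k) (x k) e = 0 := by
    funext b; simp [crossVec, h]
  rw [weight, this, Matrix.zero_vecMul]

lemma weight_ne_zero (h : IsUnit (gram lam x E κ ξ).det) (hk : lam k ≠ 0) {b : β}
    (hx : x k b ≠ 0) (he : e b ≠ 0) : weight lam x E κ ξ e k ≠ 0 := by
  intro h0
  have := congrFun (weight_vecMul_gram h e k) b
  rw [h0, Matrix.zero_vecMul] at this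
  refine mul_ne_zero (mul_ne_zero ?_ ?_) ?_ this.symm
  · exact_mod_cast hk
  · simpa using hx
  · exact_mod_cast he

lemma weight_smul {ρ : ℝ} (hρ : ρ ≠ 0) (σ : ℝ) (b : β) :
    weight lam x (fun b b' => ρ * E b b') (ρ * κ) (ρ * ξ) (fun b => σ * e b) k b =
      ((σ / ρ : ℝ) : ℂ) * weight lam x E κ ξ e k b := by
  have h1 : crossVec (lam k) (x k) (fun b => σ * e b) = (σ : ℂ) • crossVec (lam k) (x k) e := by
    funext b
    simp only [crossVec, Pi.smul_apply, smul_eq_mul]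
    push_cast; ring
  have h2 : ((ρ : ℂ) • gram lam x E κ ξ)⁻¹ = (ρ : ℂ)⁻¹ • (gram lam x E κ ξ)⁻¹ := by
    have hρ' : (ρ : ℂ) ≠ 0 := by exact_mod_cast hρ
    by_cases hd : IsUnit (gram lam x E κ ξ).det
    · refine Matrix.inv_eq_right_inv ?_
      rw [Matrix.smul_mul, Matrix.mul_smul, Matrix.mul_nonsing_inv _ hd, smul_smul,
        mul_inv_cancel₀ hρ', one_smul]
    · rw [Matrix.nonsing_inv_apply_not_isUnit _ hd, Matrix.nonsing_inv_apply_not_isUnit, smul_zero]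
      intro h
      rw [Matrix.det_smul, IsUnit.mul_iff] at h
      exact hd h.2
  rw [weight, weight, gram_smul, h1, h2, Matrix.smul_vecMul, Matrix.vecMul_smul]
  simp only [Pi.smul_apply, smul_eq_mul]
  push_cast
  ring

end Gram

section Scene

/-- The second-order statistics on which the SINR depends: the phase correlations `E` at the pilot
times and `e` between pilot times and data time, the correlation `C` of the phase-drifts at two
different antennas, and the levels `κ` and `ξ` of distortion noise and receiver noise. -/
structure Scene (β : Type*) where
  E : β → β → ℝ
  C : β → β → ℝ
  e : β → ℝ
  κ : ℝ
  ξ : ℝ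

/-- Rescaling by `ρ` of the pilot covariances and by `σ` of the correlations with the data time. -/
def Scene.scale {β : Type*} (s : Scene β) (ρ σ : ℝ) : Scene β where
  E := fun b b' => ρ * s.E b b'
  C := fun b b' => σ ^ 2 * s.C b b'
  e := fun b => σ * s.e b
  κ := ρ * s.κ
  ξ := ρ * s.ξ

variable {ι β 𝒜 : Type*} [Fintype β]

namespace Scene

lemma quad_scale {s : Scene β} {ρ σ : ℝ} (hρ : ρ ≠ 0) (v : β → ℂ) :
    quad (s.scale ρ σ).C (fun b => ((σ / ρ : ℝ) : ℂ) * v b) =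
      (σ ^ 2 / ρ) ^ 2 * quad s.C v := by
  rw [quad_smul]
  simp only [scale]
  rw [smul_quad]
  field_simp

variable [Fintype ι] [DecidableEq β]

variable (lam : 𝒜 → ι → ℝ) (x : ι → β → ℂ) (k : ι) (s : Scene β)

/-- The filter weights in subarray `α`. -/
noncomputable def weights (α : 𝒜) : β → ℂ := weight (lam α) x s.E s.κ s.ξ s.e k

/-- The signal of UE `u` seen through the filter of a subarray. -/
noncomputable def seen (u : ι) (α : 𝒜) (b : β) : ℂ := lam α u * (s.weights lam x k α b * x u b)

section

variable {lam x k s} {ρ σ : ℝ}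

lemma weights_scale (hρ : ρ ≠ 0) (α : 𝒜) (b : β) :
    (s.scale ρ σ).weights lam x k α b = ((σ / ρ : ℝ) : ℂ) * s.weights lam x k α b :=
  weight_smul hρ σ b

lemma chanMean_scale (hρ : ρ ≠ 0) (α : 𝒜) (u : ι) :
    chanMean (lam α) x (s.scale ρ σ).e ((s.scale ρ σ).weights lam x k α) u =
      ((σ ^ 2 / ρ : ℝ) : ℂ) * chanMean (lam α) x s.e (s.weights lam x k α) u := by
  simp only [chanMean, weights_scale hρ, Finset.mul_sum]
  refine Finset.sum_congr rfl fun b _ => ?_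
  rw [map_mul, Complex.conj_ofReal, crossVec, crossVec]
  simp only [scale]
  push_cast
  ring

lemma seen_scale (hρ : ρ ≠ 0) (u : ι) (α : 𝒜) (b : β) :
    (s.scale ρ σ).seen lam x k u α b = ((σ / ρ : ℝ) : ℂ) * s.seen lam x k u α b := by
  rw [seen, seen, weights_scale hρ]
  ring

end

variable [Fintype 𝒜]

/-- The mean of the filtered channel of UE `u`, per antenna index within the subarrays. -/
noncomputable def mean (u : ι) : ℂ := ∑ α, chanMean (lam α) x s.e (s.weights lam x k α) u

/-- The power of the filter. -/
noncomputable def gain : ℝ := (s.mean lam x k k).re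

/-- The part of the power of the filtered channel of UE `u` that adds up coherently over the
antennas. -/
noncomputable def coherent (u : ι) : ℝ := quad s.C (fun b => ∑ α, s.seen lam x k u α b)

/-- The diagonal terms of the coherent power, one for each subarray: pairs of equal antennas do not
follow the pattern of different antennas and are accounted for by `power` instead. -/
noncomputable def coherentDiag (u : ι) : ℝ := ∑ α, quad s.C (s.seen lam x k u α)

/-- The power of the filtered channel of UE `u` at single antennas. -/
noncomputable def power (u : ι) : ℝ :=
  ∑ α, chanPower (lam α) x s.E s.κ (chanMean (lam α) x s.e (s.weights lam x k α) k).re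
    (s.weights lam x k α) u

/-- The denominator of the SINR relative to the squared gain, so that the SINR is the quotient of
`p k` and the interference. The weights `ν₁`, `ν₂`, `ν₃` of the contributions of single antennas all
equal `1 / n` for the true statistics; rescaling changes `ν₁` and `ν₃` in different ways. -/
noncomputable def interference (p : ι → ℝ) (ν₁ ν₂ ν₃ : ℝ) : ℝ :=
  ((∑ u, p u * (s.coherent lam x k u + ν₁ * s.power lam x k u - ν₂ * s.coherentDiag lam x k u))
    + ν₃ * (s.κ * (∑ u, p u * s.power lam x k u) + s.ξ * s.gain lam x k)) / s.gain lam x k ^ 2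
    - p k

variable {lam x k s}

section Scale

variable {ρ σ : ℝ}

lemma mean_scale (hρ : ρ ≠ 0) (u : ι) :
    (s.scale ρ σ).mean lam x k u = ((σ ^ 2 / ρ : ℝ) : ℂ) * s.mean lam x k u := by
  simp only [mean, chanMean_scale hρ, Finset.mul_sum]

lemma gain_scale (hρ : ρ ≠ 0) :
    (s.scale ρ σ).gain lam x k = σ ^ 2 / ρ * s.gain lam x k := by
  rw [gain, mean_scale hρ, Complex.re_ofReal_mul, gain]

lemma coherent_scale (hρ : ρ ≠ 0) (u : ι) :
    (s.scale ρ σ).coherent lam x k u = (σ ^ 2 / ρ) ^ 2 * s.coherent lam x k u := by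
  simp only [coherent, seen_scale hρ, ← Finset.mul_sum]
  exact quad_scale hρ _

lemma coherentDiag_scale (hρ : ρ ≠ 0) (u : ι) :
    (s.scale ρ σ).coherentDiag lam x k u = (σ ^ 2 / ρ) ^ 2 * s.coherentDiag lam x k u := by
  simp only [coherentDiag, Finset.mul_sum]
  refine Finset.sum_congr rfl fun α _ => ?_
  rw [← quad_scale hρ]
  congr 1
  funext b
  exact seen_scale hρ u α b

lemma power_scale (hρ : ρ ≠ 0) (u : ι) :
    (s.scale ρ σ).power lam x k u = σ ^ 2 / ρ * s.power lam x k u := by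
  simp only [power, Finset.mul_sum]
  refine Finset.sum_congr rfl fun α _ => ?_
  have h1 : ∀ b, (s.scale ρ σ).weights lam x k α b * x u b =
      ((σ / ρ : ℝ) : ℂ) * (s.weights lam x k α b * x u b) := fun b => by
    rw [weights_scale hρ, mul_assoc]
  have h2 : ∀ z : ℂ, ‖((σ / ρ : ℝ) : ℂ) * z‖ ^ 2 = (σ / ρ) ^ 2 * ‖z‖ ^ 2 := fun z => by
    rw [norm_mul, mul_pow, Complex.norm_real, Real.norm_eq_abs, sq_abs]
  rw [chanMean_scale hρ, Complex.re_ofReal_mul, chanPower, chanPower]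
  simp only [h1, h2, quad_smul, ← Finset.mul_sum]
  simp only [scale]
  rw [smul_quad]
  field_simp

/-- The interference depends on the scale of the second-order statistics only through the weights
of the contributions of single antennas. -/
lemma interference_scale (hρ : ρ ≠ 0) (hσ : σ ≠ 0) (p : ι → ℝ) (ν₁ ν₂ ν₃ : ℝ) :
    (s.scale ρ σ).interference lam x k p ν₁ ν₂ ν₃ =
      s.interference lam x k p (ρ / σ ^ 2 * ν₁) ν₂ (ρ ^ 2 / σ ^ 2 * ν₃) := by
  have hc : σ ^ 2 / ρ ≠ 0 := div_ne_zero (pow_ne_zero 2 hσ) hρ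
  have e1 : ∀ u, p u * ((s.scale ρ σ).coherent lam x k u + ν₁ * (s.scale ρ σ).power lam x k u -
      ν₂ * (s.scale ρ σ).coherentDiag lam x k u) = (σ ^ 2 / ρ) ^ 2 *
      (p u * (s.coherent lam x k u + (ρ / σ ^ 2 * ν₁) * s.power lam x k u -
      ν₂ * s.coherentDiag lam x k u)) := fun u => by
    rw [coherent_scale hρ, coherentDiag_scale hρ, power_scale hρ]
    field_simp
  have e2 : ∀ u, p u * (s.scale ρ σ).power lam x k u =
      σ ^ 2 / ρ * (p u * s.power lam x k u) := fun u => by rw [power_scale hρ]; ring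
  have e3 : ν₃ * ((s.scale ρ σ).κ * (∑ u, p u * (s.scale ρ σ).power lam x k u) +
      (s.scale ρ σ).ξ * (s.scale ρ σ).gain lam x k) = (σ ^ 2 / ρ) ^ 2 *
      (ρ ^ 2 / σ ^ 2 * ν₃ * (s.κ * (∑ u, p u * s.power lam x k u) + s.ξ * s.gain lam x k)) := by
    simp only [e2, ← Finset.mul_sum, gain_scale hρ]
    simp only [scale]
    field_simp
  rw [interference, interference, e3]
  simp only [e1, ← Finset.mul_sum]
  rw [gain_scale hρ, ← mul_add, mul_pow, mul_div_mul_left _ _ (pow_ne_zero 2 hc)]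

end Scale

end Scene

end Scene

namespace Scene

/-! ### Lower bounds for the interference -/

section LowerBounds

variable {ι β 𝒜 : Type*} [Fintype ι] [Fintype β] [DecidableEq β]

/-- Conditions on the second-order statistics under which the filter of UE `k` is well-defined and
non-zero, and the coherent power of a channel is at least its squared mean. -/
structure Admissible (lam : 𝒜 → ι → ℝ) (x : ι → β → ℂ) (k : ι) (s : Scene β) : Prop where
  symm : ∀ b b', s.E b b' = s.E b' b
  psd : ∀ v, 0 ≤ quad s.E v
  sq_le_quad : ∀ v : β → ℂ, ‖∑ b, conj (v b) * s.e b‖ ^ 2 ≤ quad s.C v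
  κ_nonneg : 0 ≤ s.κ
  ξ_nonneg : 0 ≤ s.ξ
  noise_pos : ∀ α, lam α k ≠ 0 → ∀ b, 0 < s.κ * (∑ u, lam α u * ‖x u b‖ ^ 2) + s.ξ
  lam_nonneg : ∀ α u, 0 ≤ lam α u
  heard : ∃ α, 0 < lam α k
  pilot : ∃ b, x k b ≠ 0 ∧ s.e b ≠ 0

namespace Admissible

variable {lam : 𝒜 → ι → ℝ} {x : ι → β → ℂ} {k : ι} {s : Scene β}

lemma isUnit_det (h : s.Admissible lam x k) {α : 𝒜} (hα : lam α k ≠ 0) :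
    IsUnit (gram (lam α) x s.E s.κ s.ξ).det :=
  isUnit_det_gram h.symm h.psd (h.lam_nonneg α) (h.noise_pos α hα)

lemma chanMean_pos (h : s.Admissible lam x k) {α : 𝒜} (hα : lam α k ≠ 0) :
    0 < (chanMean (lam α) x s.e (s.weights lam x k α) k).re := by
  obtain ⟨b, hx, he⟩ := h.pilot
  rw [weights, chanMean_weight_eq (h.isUnit_det hα)]
  exact re_gram_pos h.symm h.psd (h.lam_nonneg α) (h.noise_pos α hα)
    (weight_ne_zero (h.isUnit_det hα) hα hx he)

lemma weights_eq_zero {α : 𝒜} (hα : lam α k = 0) : s.weights lam x k α = 0 :=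
  weight_eq_zero hα

lemma chanMean_nonneg (h : s.Admissible lam x k) (α : 𝒜) :
    0 ≤ (chanMean (lam α) x s.e (s.weights lam x k α) k).re := by
  by_cases hα : lam α k = 0
  · rw [weights_eq_zero hα]; simp [chanMean]
  · exact (h.chanMean_pos hα).le

lemma chanMean_im (h : s.Admissible lam x k) (α : 𝒜) :
    (chanMean (lam α) x s.e (s.weights lam x k α) k).im = 0 := by
  by_cases hα : lam α k = 0
  · rw [weights_eq_zero hα]; simp [chanMean]
  · exact chanMean_weight_im h.symm (h.isUnit_det hα)

lemma le_chanPower (h : s.Admissible lam x k) (α : 𝒜) (u : ι) :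
    lam α u * (chanMean (lam α) x s.e (s.weights lam x k α) k).re ≤
      chanPower (lam α) x s.E s.κ (chanMean (lam α) x s.e (s.weights lam x k α) k).re
        (s.weights lam x k α) u := by
  have h1 := h.psd (fun b => s.weights lam x k α b * x u b)
  have h2 : 0 ≤ s.κ * ∑ b, ‖s.weights lam x k α b * x u b‖ ^ 2 :=
    mul_nonneg h.κ_nonneg (Finset.sum_nonneg fun b _ => by positivity)
  rw [chanPower]
  have := mul_nonneg (sq_nonneg (lam α u)) (add_nonneg h1 h2)
  linarith

variable [Fintype 𝒜]

lemma gain_pos (h : s.Admissible lam x k) : 0 < s.gain lam x k := by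
  obtain ⟨α, hα⟩ := h.heard
  rw [gain, mean, Complex.re_sum]
  exact Finset.sum_pos' (fun α _ => h.chanMean_nonneg α)
    ⟨α, Finset.mem_univ _, h.chanMean_pos hα.ne'⟩

lemma sq_norm_mean_self (h : s.Admissible lam x k) :
    ‖s.mean lam x k k‖ ^ 2 = s.gain lam x k ^ 2 := by
  have him : (s.mean lam x k k).im = 0 := by
    rw [mean, Complex.im_sum]
    exact Finset.sum_eq_zero fun α _ => h.chanMean_im α
  rw [Complex.sq_norm, Complex.normSq_apply, him, gain]
  ring

lemma mean_eq (u : ι) :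
    s.mean lam x k u = ∑ b, conj (∑ α, s.seen lam x k u α b) * s.e b := by
  simp only [mean, chanMean_eq, map_sum, Finset.sum_mul, seen]
  exact Finset.sum_comm

lemma sq_norm_mean_le (h : s.Admissible lam x k) (u : ι) :
    ‖s.mean lam x k u‖ ^ 2 ≤ s.coherent lam x k u := by
  rw [mean_eq]
  exact h.sq_le_quad _

lemma power_nonneg (h : s.Admissible lam x k) (u : ι) : 0 ≤ s.power lam x k u :=
  Finset.sum_nonneg fun α _ =>
    (mul_nonneg (h.lam_nonneg α u) (h.chanMean_nonneg α)).trans (h.le_chanPower α u)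

lemma power_self_pos (h : s.Admissible lam x k) : 0 < s.power lam x k k := by
  obtain ⟨α, hα⟩ := h.heard
  exact Finset.sum_pos' (fun α _ => (mul_nonneg (h.lam_nonneg α k) (h.chanMean_nonneg α)).trans
    (h.le_chanPower α k)) ⟨α, Finset.mem_univ _,
      (mul_pos hα (h.chanMean_pos hα.ne')).trans_le (h.le_chanPower α k)⟩

/-- The three ways in which interference or noise persists: coherent interference from another UE,
fluctuation of the coherent signal itself, and noise of the same order as the signal. -/
lemma interference_pos (h : s.Admissible lam x k) {p : ι → ℝ} (hp : ∀ u, 0 < p u) {ν₁ ν₃ : ℝ}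
    (hν₁ : 0 ≤ ν₁) (hν₃ : 0 ≤ ν₃)
    (hpos : (∃ u, u ≠ k ∧ s.mean lam x k u ≠ 0) ∨
      ‖s.mean lam x k k‖ ^ 2 < s.coherent lam x k k ∨ (0 < ν₃ ∧ (0 < s.κ ∨ 0 < s.ξ))) :
    0 < s.interference lam x k p ν₁ 0 ν₃ := by
  classical
  have hG := h.gain_pos
  have hterm : ∀ u, 0 ≤ p u * (s.coherent lam x k u + ν₁ * s.power lam x k u -
      0 * s.coherentDiag lam x k u) := fun u => by
    have h1 := h.sq_norm_mean_le u
    have h2 := mul_nonneg hν₁ (h.power_nonneg u)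
    have h3 := sq_nonneg ‖s.mean lam x k u‖
    exact mul_nonneg (hp u).le (by linarith)
  have hk : p k * s.coherent lam x k k ≤ p k * (s.coherent lam x k k + ν₁ * s.power lam x k k -
      0 * s.coherentDiag lam x k k) := by
    have h2 := mul_nonneg hν₁ (h.power_nonneg k)
    exact mul_le_mul_of_nonneg_left (by linarith) (hp k).le
  have hk' : p k * s.gain lam x k ^ 2 ≤ p k * s.coherent lam x k k := by
    rw [← h.sq_norm_mean_self]
    exact mul_le_mul_of_nonneg_left (h.sq_norm_mean_le k) (hp k).le
  have hsum := Finset.single_le_sum (fun u _ => hterm u) (Finset.mem_univ k)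
  have hPsum : p k * s.power lam x k k ≤ ∑ u, p u * s.power lam x k u :=
    Finset.single_le_sum (f := fun u => p u * s.power lam x k u)
      (fun u _ => mul_nonneg (hp u).le (h.power_nonneg u)) (Finset.mem_univ k)
  have hPk := mul_pos (hp k) h.power_self_pos
  have hκP := mul_nonneg h.κ_nonneg (hPk.le.trans hPsum)
  have hξG := mul_nonneg h.ξ_nonneg hG.le
  have hnoise : 0 ≤ ν₃ * (s.κ * (∑ u, p u * s.power lam x k u) + s.ξ * s.gain lam x k) :=
    mul_nonneg hν₃ (add_nonneg hκP hξG)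
  rw [interference, sub_pos, lt_div_iff₀ (by positivity)]
  rcases hpos with ⟨u, hu, hmean⟩ | hlt | ⟨hν, hκξ⟩
  · have h2 : 0 < p u * (s.coherent lam x k u + ν₁ * s.power lam x k u -
        0 * s.coherentDiag lam x k u) := by
      have h1 := h.sq_norm_mean_le u
      have h2 := mul_nonneg hν₁ (h.power_nonneg u)
      have h3 : 0 < ‖s.mean lam x k u‖ ^ 2 := by have := norm_pos_iff.2 hmean; positivity
      exact mul_pos (hp u) (by linarith)
    have h3 := Finset.sum_le_sum_of_subset_of_nonneg (Finset.subset_univ ({k, u} : Finset ι))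
      (fun u _ _ => hterm u)
    rw [Finset.sum_pair hu.symm] at h3
    linarith
  · rw [h.sq_norm_mean_self] at hlt
    have := mul_lt_mul_of_pos_left hlt (hp k)
    linarith
  · have : 0 < ν₃ * (s.κ * (∑ u, p u * s.power lam x k u) + s.ξ * s.gain lam x k) := by
      refine mul_pos hν ?_
      rcases hκξ with hκ | hξ
      · exact add_pos_of_pos_of_nonneg (mul_pos hκ (hPk.trans_le hPsum)) hξG
      · exact add_pos_of_nonneg_of_pos hκP (mul_pos hξ hG)
    linarith

end Admissible

end LowerBounds

/-! ### Limits of the interference -/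

section Limit

variable {ι β 𝒜 : Type*}

/-- Entrywise convergence of second-order statistics. -/
structure TendsTo (s : ℕ → Scene β) (s' : Scene β) : Prop where
  E : ∀ b b', Tendsto (fun n => (s n).E b b') atTop (𝓝 (s'.E b b'))
  C : ∀ b b', Tendsto (fun n => (s n).C b b') atTop (𝓝 (s'.C b b'))
  e : ∀ b, Tendsto (fun n => (s n).e b) atTop (𝓝 (s'.e b))
  κ : Tendsto (fun n => (s n).κ) atTop (𝓝 s'.κ)
  ξ : Tendsto (fun n => (s n).ξ) atTop (𝓝 s'.ξ)

lemma tendsto_quad [Fintype β] {Q : ℕ → β → β → ℝ} {Q' : β → β → ℝ} {v : ℕ → β → ℂ} {v' : β → ℂ}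
    (hQ : ∀ b b', Tendsto (fun n => Q n b b') atTop (𝓝 (Q' b b')))
    (hv : ∀ b, Tendsto (fun n => v n b) atTop (𝓝 (v' b))) :
    Tendsto (fun n => quad (Q n) (v n)) atTop (𝓝 (quad Q' v')) :=
  tendsto_finsetSum _ fun b _ => tendsto_finsetSum _ fun b' _ => (hQ b b').mul
    ((Complex.continuous_re.tendsto _).comp
      (((Complex.continuous_conj.tendsto _).comp (hv b)).mul (hv b')))

lemma tendsto_ofReal {f : ℕ → ℝ} {a : ℝ} (h : Tendsto f atTop (𝓝 a)) :
    Tendsto (fun n => (f n : ℂ)) atTop (𝓝 (a : ℂ)) :=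
  (Complex.continuous_ofReal.tendsto _).comp h

variable {lam : 𝒜 → ι → ℝ} {x : ι → β → ℂ} {k : ι} {s : ℕ → Scene β} {s' : Scene β}

lemma TendsTo.crossVec (h : TendsTo s s') (α : 𝒜) (u : ι) (b : β) :
    Tendsto (fun n => crossVec (lam α u) (x u) (s n).e b) atTop
      (𝓝 (crossVec (lam α u) (x u) s'.e b)) :=
  (tendsto_ofReal (h.e b)).const_mul _

variable [Fintype ι] [DecidableEq β]

lemma TendsTo.gram (h : TendsTo s s') (α : 𝒜) :
    Tendsto (fun n => gram (lam α) x (s n).E (s n).κ (s n).ξ) atTop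
      (𝓝 (gram (lam α) x s'.E s'.κ s'.ξ)) := by
  refine tendsto_pi_nhds.2 fun b => tendsto_pi_nhds.2 fun b' => ?_
  refine ((tendsto_ofReal (h.E b b')).const_mul _).add ?_
  split_ifs
  · exact tendsto_ofReal ((h.κ.mul_const _).add h.ξ)
  · exact tendsto_const_nhds

variable [Fintype β]

lemma TendsTo.weights (h : TendsTo s s') (ha : s'.Admissible lam x k) (α : 𝒜) (b : β) :
    Tendsto (fun n => (s n).weights lam x k α b) atTop (𝓝 (s'.weights lam x k α b)) := by
  by_cases hα : lam α k = 0
  · simp only [Admissible.weights_eq_zero hα]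
    exact tendsto_const_nhds
  · have hdet := ha.isUnit_det hα
    have hinv : Tendsto (fun n => (MassiveMIMO.gram (lam α) x (s n).E (s n).κ (s n).ξ)⁻¹) atTop
        (𝓝 (MassiveMIMO.gram (lam α) x s'.E s'.κ s'.ξ)⁻¹) := by
      refine ContinuousAt.tendsto (continuousAt_matrix_inv _ ?_) |>.comp (h.gram α)
      rw [Ring.inverse_eq_inv']
      exact continuousAt_inv₀ hdet.ne_zero
    exact tendsto_finsetSum _ fun b' _ => (h.crossVec α k b').mul
      (tendsto_pi_nhds.1 (tendsto_pi_nhds.1 hinv b') b)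

lemma TendsTo.chanMean (h : TendsTo s s') (ha : s'.Admissible lam x k) (α : 𝒜) (u : ι) :
    Tendsto (fun n => chanMean (lam α) x (s n).e ((s n).weights lam x k α) u) atTop
      (𝓝 (chanMean (lam α) x s'.e (s'.weights lam x k α) u)) :=
  tendsto_finsetSum _ fun b _ => ((Complex.continuous_conj.tendsto _).comp
    (h.weights ha α b)).mul (h.crossVec α u b)

lemma TendsTo.seen (h : TendsTo s s') (ha : s'.Admissible lam x k) (u : ι) (α : 𝒜) (b : β) :
    Tendsto (fun n => (s n).seen lam x k u α b) atTop (𝓝 (s'.seen lam x k u α b)) :=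
  ((h.weights ha α b).mul_const _).const_mul _

variable [Fintype 𝒜]

lemma TendsTo.mean (h : TendsTo s s') (ha : s'.Admissible lam x k) (u : ι) :
    Tendsto (fun n => (s n).mean lam x k u) atTop (𝓝 (s'.mean lam x k u)) :=
  tendsto_finsetSum _ fun α _ => h.chanMean ha α u

lemma TendsTo.gain (h : TendsTo s s') (ha : s'.Admissible lam x k) :
    Tendsto (fun n => (s n).gain lam x k) atTop (𝓝 (s'.gain lam x k)) :=
  (Complex.continuous_re.tendsto _).comp (h.mean ha k)

lemma TendsTo.coherent (h : TendsTo s s') (ha : s'.Admissible lam x k) (u : ι) :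
    Tendsto (fun n => (s n).coherent lam x k u) atTop (𝓝 (s'.coherent lam x k u)) :=
  tendsto_quad h.C fun b => tendsto_finsetSum _ fun α _ => h.seen ha u α b

lemma TendsTo.coherentDiag (h : TendsTo s s') (ha : s'.Admissible lam x k) (u : ι) :
    Tendsto (fun n => (s n).coherentDiag lam x k u) atTop (𝓝 (s'.coherentDiag lam x k u)) :=
  tendsto_finsetSum _ fun α _ => tendsto_quad h.C fun b => h.seen ha u α b

lemma TendsTo.power (h : TendsTo s s') (ha : s'.Admissible lam x k) (u : ι) :
    Tendsto (fun n => (s n).power lam x k u) atTop (𝓝 (s'.power lam x k u)) := by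
  refine tendsto_finsetSum _ fun α _ => ?_
  have hg := (Complex.continuous_re.tendsto _).comp (h.chanMean ha α k)
  have hw : ∀ b, Tendsto (fun n => (s n).weights lam x k α b * x u b) atTop
      (𝓝 (s'.weights lam x k α b * x u b)) := fun b => (h.weights ha α b).mul_const _
  exact (hg.const_mul _).add (((tendsto_quad h.E hw).add (h.κ.mul
    (tendsto_finsetSum _ fun b _ => (hw b).norm.pow 2))).const_mul _)

lemma TendsTo.interference (h : TendsTo s s') (ha : s'.Admissible lam x k) (p : ι → ℝ)
    {ν₁ ν₂ ν₃ : ℕ → ℝ} {ν₁' ν₂' ν₃' : ℝ} (h₁ : Tendsto ν₁ atTop (𝓝 ν₁'))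
    (h₂ : Tendsto ν₂ atTop (𝓝 ν₂')) (h₃ : Tendsto ν₃ atTop (𝓝 ν₃')) :
    Tendsto (fun n => (s n).interference lam x k p (ν₁ n) (ν₂ n) (ν₃ n)) atTop
      (𝓝 (s'.interference lam x k p ν₁' ν₂' ν₃')) := by
  refine Tendsto.sub (Tendsto.div (Tendsto.add ?_ ?_) ((h.gain ha).pow 2)
    (pow_ne_zero 2 ha.gain_pos.ne')) tendsto_const_nhds
  · exact tendsto_finsetSum _ fun u _ => (((h.coherent ha u).add (h₁.mul (h.power ha u))).sub
      (h₂.mul (h.coherentDiag ha u))).const_mul _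
  · exact h₃.mul ((h.κ.mul (tendsto_finsetSum _ fun u _ => (h.power ha u).const_mul _)).add
      (h.ξ.mul (h.gain ha)))

end Limit

end Scene

/-! ### The SINR in terms of second-order statistics -/

section SINR

variable {L K A B T n : ℕ} {LO Ω : Type*} {net : Network L K A B T} {imp : Impairments}
  {V : Sources L K A n T LO Ω}

/-- The second-order statistics of a network, when the phase-drifts at different antennas have
correlation `C`. -/
noncomputable def Network.scene (net : Network L K A B T) (imp : Impairments)
    (C : Fin B → Fin B → ℝ) (t : Fin T) : Scene (Fin B) where
  E := pilotCorr net imp.delta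
  C := C
  e := dataCorr net imp.delta t
  κ := imp.kappaSq
  ξ := imp.xi

/-- The transmit power of the UE `u = (l, k)`. -/
abbrev Network.power (net : Network L K A B T) (u : Fin L × Fin K) : ℝ := net.p u.1 u.2

lemma admissible_scene (hB : 0 < B) (hκ : 0 ≤ imp.kappaSq) (hξ : 0 < imp.xi)
    (hδ : 0 ≤ imp.delta) (hlam : ∀ j l k a, 0 ≤ net.lam j l k a)
    (hlam_own : ∀ j k, ∃ a, 0 < net.lam j j k a) (hx : ∀ l k b, net.x l k b ≠ 0)
    {C : Fin B → Fin B → ℝ} {t : Fin T}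
    (hC : ∀ v : Fin B → ℂ, ‖∑ b, conj (v b) * dataCorr net imp.delta t b‖ ^ 2 ≤ quad C v)
    (j : Fin L) (k : Fin K) :
    (net.scene imp C t).Admissible (net.lamAt j) net.pilot (j, k) where
  symm := pilotCorr_comm net _
  psd := quad_pilotCorr_nonneg net hδ
  sq_le_quad := hC
  κ_nonneg := hκ
  ξ_nonneg := hξ.le
  noise_pos := fun α _ b => add_pos_of_nonneg_of_pos (mul_nonneg hκ (Finset.sum_nonneg fun u _ =>
    mul_nonneg (hlam _ _ _ _) (by positivity))) hξ
  lam_nonneg := fun α u => hlam _ _ _ _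
  heard := hlam_own j k
  pilot := ⟨⟨0, hB⟩, hx _ _ _, (Real.exp_pos _).ne'⟩

variable [MeasurableSpace Ω] {μ : Measure Ω} [IsProbabilityMeasure μ]
  {osc : Antenna A n → LO} {C : Fin B → Fin B → ℝ} {t : Fin T} {j : Fin L} {k : Fin K}

lemma IsModel.integral_filteredChannel_eq_mean (hm : IsModel net imp V μ) (hκ : 0 ≤ imp.kappaSq)
    (hξ : 0 < imp.xi) (hδ : 0 ≤ imp.delta) (hlam : ∀ j l k a, 0 ≤ net.lam j l k a)
    (l : Fin L) (m : Fin K) :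
    ∫ ω, filteredChannel net imp osc V μ j k l m t ω ∂μ =
      n * (net.scene imp C t).mean (net.lamAt j) net.pilot (j, k) (l, m) :=
  hm.integral_filteredChannel hκ hξ hδ hlam osc j k t l m

lemma IsModel.filterPower_eq_gain (hm : IsModel net imp V μ) (hκ : 0 ≤ imp.kappaSq)
    (hξ : 0 < imp.xi) (hδ : 0 ≤ imp.delta) (hlam : ∀ j l k a, 0 ≤ net.lam j l k a) :
    filterPower net imp osc V μ j k t =
      n * (net.scene imp C t).gain (net.lamAt j) net.pilot (j, k) := by
  have h := congrArg Complex.re (hm.filterPower_eq hκ hξ hδ hlam osc j k t)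
  rw [Complex.ofReal_re, ← Complex.ofReal_natCast, Complex.re_ofReal_mul] at h
  exact h

lemma IsModel.contamination_eq (hm : IsModel net imp V μ) (hn : 0 < n) (hκ : 0 ≤ imp.kappaSq)
    (hξ : 0 < imp.xi) (hδ : 0 ≤ imp.delta) (hlam : ∀ j l k a, 0 ≤ net.lam j l k a)
    (l : Fin L) (m : Fin K) :
    contamination net imp osc V μ j k l m t =
      ‖(net.scene imp C t).mean (net.lamAt j) net.pilot (j, k) (l, m)‖ /
        (net.scene imp C t).gain (net.lamAt j) net.pilot (j, k) := by
  rw [contamination, hm.integral_filteredChannel_eq_mean (C := C) hκ hξ hδ hlam,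
    hm.filterPower_eq_gain (C := C) hκ hξ hδ hlam, norm_mul, Complex.norm_natCast,
    mul_div_mul_left]
  exact_mod_cast hn.ne'

/-- The SINR is the signal power divided by the relative interference, which is positive. -/
lemma IsModel.sinr_eq (hm : IsModel net imp V μ) (hn : 0 < n) (hκ : 0 ≤ imp.kappaSq)
    (hξ : 0 < imp.xi) (hδ : 0 ≤ imp.delta) (hlam : ∀ j l k a, 0 ≤ net.lam j l k a)
    (hp : ∀ l k, 0 < net.p l k) (ht : ∀ b, net.τ b ≠ t)
    (ha : (net.scene imp C t).Admissible (net.lamAt j) net.pilot (j, k))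
    (hC : ∀ a a', a ≠ a' → ∀ b b', ∫ ω, conj (phasor osc V j (net.τ b) a ω) *
      phasor osc V j (net.τ b') a' ω *
      (phasor osc V j t a ω * conj (phasor osc V j t a' ω)) ∂μ = C b b') :
    0 < (net.scene imp C t).interference (net.lamAt j) net.pilot (j, k) net.power
        (1 / n) (1 / n) (1 / n) ∧
      sinr net imp osc V μ j k t = net.p j k /
        (net.scene imp C t).interference (net.lamAt j) net.pilot (j, k) net.power
          (1 / n) (1 / n) (1 / n) := by
  set s := net.scene imp C t with hs
  set G := s.gain (net.lamAt j) net.pilot (j, k) with hG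
  have hGpos : 0 < G := ha.gain_pos
  have hn' : (0 : ℝ) < n := by exact_mod_cast hn
  have h1 : ‖∫ ω, filteredChannel net imp osc V μ j k j k t ω ∂μ‖ ^ 2 = n ^ 2 * G ^ 2 := by
    rw [hm.integral_filteredChannel_eq_mean (C := C) hκ hξ hδ hlam, norm_mul, mul_pow,
      Complex.norm_natCast, ha.sq_norm_mean_self]
  have h2 : filterPower net imp osc V μ j k t = n * G := hm.filterPower_eq_gain hκ hξ hδ hlam
  have h3 : ∀ l m, ∫ ω, ‖filteredChannel net imp osc V μ j k l m t ω‖ ^ 2 ∂μ =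
      n ^ 2 * s.coherent (net.lamAt j) net.pilot (j, k) (l, m) +
        n * (s.power (net.lamAt j) net.pilot (j, k) (l, m) -
          s.coherentDiag (net.lamAt j) net.pilot (j, k) (l, m)) := fun l m => by
    rw [hm.integral_sq_filteredChannel hκ hξ hδ hlam osc j k t C hC l m, Finset.sum_sub_distrib]
    rfl
  have h4 : ∫ ω, ‖filteredDistortion net imp osc V μ j k t ω‖ ^ 2 ∂μ =
      n * (imp.kappaSq * ∑ u : Fin L × Fin K,
        net.power u * s.power (net.lamAt j) net.pilot (j, k) u) := by
    rw [hm.integral_sq_filteredDistortion hκ hξ hδ hlam osc j k t (fun l k => (hp l k).le) ht,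
      ← Finset.mul_sum, Finset.sum_comm]
    simp only [← Finset.mul_sum]
    rfl
  set I := s.interference (net.lamAt j) net.pilot (j, k) net.power (1 / n) (1 / n) (1 / n) with hI
  have hden : (∑ l, ∑ m, net.p l m * ∫ ω, ‖filteredChannel net imp osc V μ j k l m t ω‖ ^ 2 ∂μ)
      - net.p j k * ‖∫ ω, filteredChannel net imp osc V μ j k j k t ω ∂μ‖ ^ 2
      + (∫ ω, ‖filteredDistortion net imp osc V μ j k t ω‖ ^ 2 ∂μ)
      + imp.xi * filterPower net imp osc V μ j k t = n ^ 2 * G ^ 2 * I := by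
    have e1 : ∀ l m, net.p l m * ∫ ω, ‖filteredChannel net imp osc V μ j k l m t ω‖ ^ 2 ∂μ =
        n ^ 2 * (net.power (l, m) * (s.coherent (net.lamAt j) net.pilot (j, k) (l, m) +
          1 / n * s.power (net.lamAt j) net.pilot (j, k) (l, m) -
          1 / n * s.coherentDiag (net.lamAt j) net.pilot (j, k) (l, m))) := fun l m => by
      rw [h3]
      field_simp
      ring
    have e2 : ∑ l, ∑ m, net.p l m * ∫ ω, ‖filteredChannel net imp osc V μ j k l m t ω‖ ^ 2 ∂μ =
        n ^ 2 * ∑ u, net.power u * (s.coherent (net.lamAt j) net.pilot (j, k) u +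
          1 / n * s.power (net.lamAt j) net.pilot (j, k) u -
          1 / n * s.coherentDiag (net.lamAt j) net.pilot (j, k) u) := by
      simp only [e1, Fintype.sum_prod_type, Finset.mul_sum]
    have hκ' : s.κ = imp.kappaSq := rfl
    have hξ' : s.ξ = imp.xi := rfl
    have hp' : net.power (j, k) = net.p j k := rfl
    rw [e2, h1, h2, h4, hI, Scene.interference, ← hG, hκ', hξ', hp']
    generalize ∑ u, net.power u * (_ : ℝ) = X
    generalize ∑ u, net.power u * (_ : ℝ) = Y
    field_simp
    ring
  have hpos : 0 < n ^ 2 * G ^ 2 * I := by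
    rw [← hden]
    have j1 : ∀ l m, ‖∫ ω, filteredChannel net imp osc V μ j k l m t ω ∂μ‖ ^ 2 ≤
        ∫ ω, ‖filteredChannel net imp osc V μ j k l m t ω‖ ^ 2 ∂μ := fun l m =>
      (hm.tame_star_mrc_dotProduct hκ hξ hδ hlam osc j k t (fun a => hm.tame_effChannel osc j (l, m)
        t a (Set.subset_univ _) (Set.subset_univ _))).sq_norm_integral_le
    have j2 : ∀ l m, 0 ≤ net.p l m * ∫ ω, ‖filteredChannel net imp osc V μ j k l m t ω‖ ^ 2 ∂μ :=
      fun l m => mul_nonneg (hp l m).le ((sq_nonneg _).trans (j1 l m))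
    have j3 := Finset.single_le_sum (f := fun l => ∑ m, net.p l m *
      ∫ ω, ‖filteredChannel net imp osc V μ j k l m t ω‖ ^ 2 ∂μ)
      (fun l _ => Finset.sum_nonneg fun m _ => j2 l m) (Finset.mem_univ j)
    have j4 := Finset.single_le_sum (f := fun m => net.p j m *
      ∫ ω, ‖filteredChannel net imp osc V μ j k j m t ω‖ ^ 2 ∂μ)
      (fun m _ => j2 j m) (Finset.mem_univ k)
    have j5 := mul_le_mul_of_nonneg_left (j1 j k) (hp j k).le
    have j6 : 0 ≤ ∫ ω, ‖filteredDistortion net imp osc V μ j k t ω‖ ^ 2 ∂μ :=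
      integral_nonneg fun ω => sq_nonneg _
    have j7 : 0 < imp.xi * filterPower net imp osc V μ j k t := by
      rw [h2]
      positivity
    linarith
  refine ⟨(pos_iff_pos_of_mul_pos hpos).1 (by positivity), ?_⟩
  rw [sinr, hden, h1]
  have : (n : ℝ) ^ 2 * G ^ 2 ≠ 0 := by positivity
  rw [mul_comm (net.p j k), mul_div_mul_left _ _ this]

end SINR

/-! ### Diagonal pilot covariance -/

/-- If the phases at different pilot times decorrelate and the pilots are positive, then the filter
picks up every channel that is heard together with the desired one. -/
lemma Scene.Admissible.mean_ne_zero_of_diagonal {ι β 𝒜 : Type*} [Fintype ι] [Fintype β]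
    [DecidableEq β] [Fintype 𝒜] {lam : 𝒜 → ι → ℝ} {x : ι → β → ℂ} {k : ι} {s : Scene β}
    (h : s.Admissible lam x k) (hE : ∀ b b', b ≠ b' → s.E b b' = 0) (hE0 : ∀ b, 0 ≤ s.E b b)
    (he : ∀ b, 0 ≤ s.e b) (hx : ∀ u b, ∃ r : ℝ, 0 < r ∧ x u b = r) {u : ι}
    (hu : ∃ α, 0 < lam α k ∧ 0 < lam α u) : s.mean lam x k u ≠ 0 := by
  choose r hr hxr using hx
  obtain ⟨b₀, -, he₀⟩ := h.pilot
  have hg : ∀ α, ∃ g : β → ℝ, (∀ b, gram (lam α) x s.E s.κ s.ξ b b = g b) ∧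
      (lam α k ≠ 0 → ∀ b, 0 < g b) := fun α => by
    refine ⟨fun b => (∑ v, lam α v * (r v b * r v b)) * s.E b b +
      (s.κ * (∑ u, lam α u * ‖x u b‖ ^ 2) + s.ξ), fun b => ?_, fun hα b => ?_⟩
    · simp only [gram, if_true, hxr, Complex.conj_ofReal]
      push_cast
      rfl
    · exact add_pos_of_nonneg_of_pos (mul_nonneg (Finset.sum_nonneg fun v _ =>
        mul_nonneg (h.lam_nonneg α v) (mul_self_nonneg _)) (hE0 b)) (h.noise_pos α hα b)
  have hterm : ∀ α, lam α k ≠ 0 → ∃ f : β → ℝ, (∀ b, 0 ≤ f b) ∧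
      (0 < lam α k → 0 < lam α u → 0 < f b₀) ∧
      chanMean (lam α) x s.e (s.weights lam x k α) u = (∑ b, f b : ℝ) := fun α hα => by
    obtain ⟨g, hg, hgpos⟩ := hg α
    have hw : ∀ b, s.weights lam x k α b * g b = crossVec (lam α k) (x k) s.e b := fun b => by
      have h1 := congrFun (weight_vecMul_gram (h.isUnit_det hα) s.e k) b
      rw [← h1, Matrix.vecMul, dotProduct, Finset.sum_eq_single b, hg]
      · rfl
      · intro b' _ hb'
        simp [gram, hE b' b hb', hb']
      · simp
    have hw' : ∀ b, s.weights lam x k α b = ((lam α k * r k b * s.e b / g b : ℝ) : ℂ) :=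
      fun b => by
      have hgb : (g b : ℂ) ≠ 0 := by exact_mod_cast (hgpos hα b).ne'
      push_cast
      rw [eq_div_iff hgb, hw, crossVec, hxr, Complex.conj_ofReal]
    refine ⟨fun b => lam α k * r k b * s.e b / g b * (lam α u * r u b * s.e b), fun b => ?_,
      fun h1 h2 => ?_, ?_⟩
    · have := h.lam_nonneg α k
      have := h.lam_nonneg α u
      have := hr k b
      have := hr u b
      have := he b
      have := hgpos hα b
      positivity
    · have := hr k b₀
      have := hr u b₀
      have := (he b₀).lt_of_ne' he₀
      have := hgpos hα b₀
      positivity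
    · rw [chanMean]
      push_cast
      refine Finset.sum_congr rfl fun b _ => ?_
      rw [hw', crossVec, hxr, Complex.conj_ofReal, Complex.conj_ofReal]
      push_cast
      ring
  obtain ⟨α₀, hk, hu⟩ := hu
  have hpos : 0 < (s.mean lam x k u).re := by
    rw [mean, Complex.re_sum]
    refine Finset.sum_pos' (fun α _ => ?_) ⟨α₀, Finset.mem_univ _, ?_⟩
    · by_cases hα : lam α k = 0
      · rw [weights_eq_zero hα]; simp [chanMean]
      · obtain ⟨f, hf, -, hfe⟩ := hterm α hα
        rw [hfe, Complex.ofReal_re]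
        exact Finset.sum_nonneg fun b _ => hf b
    · obtain ⟨f, hf, hf0, hfe⟩ := hterm α₀ hk.ne'
      rw [hfe, Complex.ofReal_re]
      exact Finset.sum_pos' (fun b _ => hf b) ⟨b₀, Finset.mem_univ _, hf0 hk hu⟩
  intro h0
  rw [h0] at hpos
  exact lt_irrefl _ hpos

/-! ### The scaling law -/

section Scaling

/-- The limit of `N ^ (-s)` as `N → ∞`, for `s ≥ 0`. -/
noncomputable def decay (s : ℝ) : ℝ := if s = 0 then 1 else 0

lemma decay_nonneg (s : ℝ) : 0 ≤ decay s := by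
  unfold decay; split_ifs <;> norm_num

lemma tendsto_decay {A : ℕ} (hA : 0 < A) {s : ℝ} (hs : 0 ≤ s) :
    Tendsto (fun n : ℕ => ((A * n : ℕ) : ℝ) ^ (-s)) atTop (𝓝 (decay s)) := by
  unfold decay
  split_ifs with h
  · subst h
    simp
  · have h1 : Tendsto (fun n : ℕ => ((A * n : ℕ) : ℝ)) atTop atTop :=
      tendsto_natCast_atTop_atTop.comp (tendsto_id.const_mul_atTop' hA)
    exact (tendsto_rpow_neg_atTop (hs.lt_of_ne' h)).comp h1

lemma phaseCorr_scaled {T : ℕ} {N : ℝ} (hN : 0 < N) (δ₀ z₃ : ℝ) (s s' : Fin T) :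
    phaseCorr (δ₀ * (1 + Real.log (N ^ z₃))) s s' =
      phaseCorr δ₀ s s' * N ^ (-(δ₀ * z₃ / 2 * |(s : ℝ) - (s' : ℝ)|)) := by
  rw [phaseCorr, phaseCorr, Real.log_rpow hN, Real.rpow_def_of_pos hN, ← Real.exp_add]
  congr 1
  ring

variable {L K A B T : ℕ}

/-- The limit of the rescaled second-order statistics, when the pilot covariances are divided by
`N ^ θ` and the correlations with the data time by `N ^ (-δ₀ z₃ d / 2)`. -/
noncomputable def Network.limitScene (net : Network L K A B T) (κ₀ ξ₀ δ₀ z₁ z₂ z₃ θ d : ℝ)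
    (C : Fin B → Fin B → ℝ) (t : Fin T) : Scene (Fin B) where
  E := fun b b' => pilotCorr net δ₀ b b' *
    decay (δ₀ * z₃ / 2 * |(net.τ b : ℝ) - (net.τ b' : ℝ)| + θ)
  C := C
  e := fun b => dataCorr net δ₀ t b * decay (δ₀ * z₃ / 2 * (|(t : ℝ) - (net.τ b : ℝ)| - d))
  κ := κ₀ ^ 2 * decay (θ - z₁)
  ξ := ξ₀ * decay (θ - z₂)

/-- The scale of the pilot covariances. -/
noncomputable def noiseScale (A : ℕ) (θ : ℝ) (n : ℕ) : ℝ := ((A * n : ℕ) : ℝ) ^ θ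

/-- The scale of the correlations between the phases at time `t` and at a pilot time at
distance `d`. -/
noncomputable def driftScale (A : ℕ) (δ₀ z₃ d : ℝ) (n : ℕ) : ℝ :=
  ((A * n : ℕ) : ℝ) ^ (-(δ₀ * z₃ / 2 * d))

/-- The second-order statistics of a network with scaled impairments, rescaled so as to converge. -/
noncomputable def Network.rescaled (net : Network L K A B T) (κ₀ ξ₀ δ₀ z₁ z₂ z₃ θ d : ℝ)
    (C : ℕ → Fin B → Fin B → ℝ) (t : Fin T) (n : ℕ) : Scene (Fin B) :=
  (net.scene (scaledImpairments κ₀ ξ₀ δ₀ z₁ z₂ z₃ (A * n)) (C n) t).scale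
    (noiseScale A θ n)⁻¹ (driftScale A δ₀ z₃ d n)⁻¹

lemma tendsTo_limitScene (hA : 0 < A) (net : Network L K A B T) {κ₀ ξ₀ δ₀ z₁ z₂ z₃ θ d : ℝ}
    (hδ₀ : 0 ≤ δ₀) (hz₃ : 0 ≤ z₃) (hθ : 0 ≤ θ) (h₁ : z₁ ≤ θ) (h₂ : z₂ ≤ θ) {t : Fin T}
    (hd : ∀ b, d ≤ |(t : ℝ) - (net.τ b : ℝ)|) {C : ℕ → Fin B → Fin B → ℝ}
    {C' : Fin B → Fin B → ℝ}
    (hC : ∀ b b', Tendsto (fun n => ((driftScale A δ₀ z₃ d n)⁻¹) ^ 2 * C n b b') atTop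
      (𝓝 (C' b b'))) :
    Scene.TendsTo (net.rescaled κ₀ ξ₀ δ₀ z₁ z₂ z₃ θ d C t)
      (net.limitScene κ₀ ξ₀ δ₀ z₁ z₂ z₃ θ d C' t) := by
  have hγ : 0 ≤ δ₀ * z₃ / 2 := by positivity
  have hN : ∀ᶠ n : ℕ in atTop, (0 : ℝ) < ((A * n : ℕ) : ℝ) :=
    (eventually_gt_atTop 0).mono fun n hn => by exact_mod_cast Nat.mul_pos hA hn
  refine ⟨fun b b' => ?_, hC, fun b => ?_, ?_, ?_⟩
  · refine ((tendsto_decay hA (add_nonneg (mul_nonneg hγ (abs_nonneg _)) hθ)).const_mul _).congr' ?_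
    filter_upwards [hN] with n hn
    change _ = (noiseScale A θ n)⁻¹ * phaseCorr _ _ _
    rw [scaledImpairments, phaseCorr_scaled hn, noiseScale, ← Real.rpow_neg hn.le, neg_add,
      Real.rpow_add hn, pilotCorr]
    ring
  · refine ((tendsto_decay hA (mul_nonneg hγ (sub_nonneg.2 (hd b)))).const_mul _).congr' ?_
    filter_upwards [hN] with n hn
    change _ = (driftScale A δ₀ z₃ d n)⁻¹ * phaseCorr _ _ _
    rw [scaledImpairments, phaseCorr_scaled hn, driftScale, ← Real.rpow_neg hn.le, neg_neg,
      mul_sub, neg_sub, sub_eq_add_neg, Real.rpow_add hn, dataCorr]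
    ring
  · refine ((tendsto_decay hA (sub_nonneg.2 h₁)).const_mul _).congr' ?_
    filter_upwards [hN] with n hn
    change _ = (noiseScale A θ n)⁻¹ * (κ₀ ^ 2 * ((A * n : ℕ) : ℝ) ^ z₁)
    rw [noiseScale, ← Real.rpow_neg hn.le, neg_sub, sub_eq_add_neg, Real.rpow_add hn]
    ring
  · refine ((tendsto_decay hA (sub_nonneg.2 h₂)).const_mul _).congr' ?_
    filter_upwards [hN] with n hn
    change _ = (noiseScale A θ n)⁻¹ * (ξ₀ * ((A * n : ℕ) : ℝ) ^ z₂)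
    rw [noiseScale, ← Real.rpow_neg hn.le, neg_sub, sub_eq_add_neg, Real.rpow_add hn]
    ring

lemma scaledImpairments_delta_nonneg {δ₀ z₃ : ℝ} (hδ₀ : 0 ≤ δ₀) (hz₃ : 0 ≤ z₃)
    (κ₀ ξ₀ z₁ z₂ : ℝ) (N : ℕ) : 0 ≤ (scaledImpairments κ₀ ξ₀ δ₀ z₁ z₂ z₃ N).delta := by
  refine mul_nonneg hδ₀ (add_nonneg zero_le_one ?_)
  rcases Nat.eq_zero_or_pos N with rfl | hN
  · by_cases h : z₃ = 0
    · simp [h]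
    · simp [Real.zero_rpow h]
  · have : (1 : ℝ) ≤ N := by exact_mod_cast hN
    exact Real.log_nonneg (Real.one_le_rpow this hz₃)

/-- The limiting second-order statistics are admissible: positivity of the kernels passes to the
limit, and the scale `N ^ θ` keeps one of the two kinds of noise alive. -/
lemma admissible_limitScene {net : Network L K A B T}
    (hlam : ∀ j l k a, 0 ≤ net.lam j l k a)
    (hlam_own : ∀ j k, ∃ a, 0 < net.lam j j k a) (hx : ∀ l k b, net.x l k b ≠ 0)
    {κ₀ ξ₀ δ₀ z₁ z₂ z₃ θ d : ℝ}
    (hξ₀ : 0 < ξ₀) (hδ₀ : 0 ≤ δ₀) (hz₃ : 0 ≤ z₃) {t : Fin T}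
    (hd : ∃ b, d = |(t : ℝ) - (net.τ b : ℝ)|) {C : ℕ → Fin B → Fin B → ℝ}
    {C' : Fin B → Fin B → ℝ}
    (hlim : Scene.TendsTo (net.rescaled κ₀ ξ₀ δ₀ z₁ z₂ z₃ θ d C t)
      (net.limitScene κ₀ ξ₀ δ₀ z₁ z₂ z₃ θ d C' t))
    (hC : ∀ n, ∀ v : Fin B → ℂ, ‖∑ b, conj (v b) *
      dataCorr net (scaledImpairments κ₀ ξ₀ δ₀ z₁ z₂ z₃ (A * n)).delta t b‖ ^ 2 ≤ quad (C n) v)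
    (hnoise : (0 < κ₀ ^ 2 * decay (θ - z₁)) ∨ 0 < ξ₀ * decay (θ - z₂)) (j : Fin L) (k : Fin K) :
    (net.limitScene κ₀ ξ₀ δ₀ z₁ z₂ z₃ θ d C' t).Admissible (net.lamAt j) net.pilot (j, k) where
  symm := fun b b' => by
    simp only [Network.limitScene]
    rw [pilotCorr_comm, abs_sub_comm]
  psd := fun v => by
    refine ge_of_tendsto (Scene.tendsto_quad hlim.E (v := fun _ => v) fun b =>
      tendsto_const_nhds) (Eventually.of_forall fun n => ?_)
    simp only [Network.rescaled, Scene.scale, smul_quad, Network.scene]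
    exact mul_nonneg (inv_nonneg.2 (Real.rpow_nonneg (Nat.cast_nonneg _) _))
      (quad_pilotCorr_nonneg net (scaledImpairments_delta_nonneg hδ₀ hz₃ _ _ _ _ _) v)
  sq_le_quad := fun v => by
    refine le_of_tendsto_of_tendsto ((tendsto_finsetSum _ fun b _ =>
      (Scene.tendsto_ofReal (hlim.e b)).const_mul (conj (v b))).norm.pow 2)
      (Scene.tendsto_quad hlim.C (v := fun _ => v) fun b => tendsto_const_nhds)
      (Eventually.of_forall fun n => ?_)
    simp only [Network.rescaled, Scene.scale, smul_quad, Network.scene]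
    have e : ∀ b, conj (v b) * (((driftScale A δ₀ z₃ d n)⁻¹ *
        dataCorr net (scaledImpairments κ₀ ξ₀ δ₀ z₁ z₂ z₃ (A * n)).delta t b : ℝ) : ℂ) =
        (((driftScale A δ₀ z₃ d n)⁻¹ : ℝ) : ℂ) * (conj (v b) *
        dataCorr net (scaledImpairments κ₀ ξ₀ δ₀ z₁ z₂ z₃ (A * n)).delta t b) := fun b => by
      push_cast; ring
    simp only [e, ← Finset.mul_sum]
    rw [norm_mul, mul_pow, Complex.norm_real, Real.norm_eq_abs, sq_abs]
    exact mul_le_mul_of_nonneg_left (hC n v) (sq_nonneg _)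
  κ_nonneg := mul_nonneg (sq_nonneg _) (decay_nonneg _)
  ξ_nonneg := mul_nonneg hξ₀.le (decay_nonneg _)
  noise_pos := fun α hα b => by
    have h1 : 0 < ∑ u, net.lamAt j α u * ‖net.pilot u b‖ ^ 2 :=
      Finset.sum_pos' (fun u _ => mul_nonneg (hlam _ _ _ _) (by positivity))
        ⟨(j, k), Finset.mem_univ _, mul_pos ((hlam _ _ _ _).lt_of_ne' hα)
          (by have := norm_pos_iff.2 (hx j k b); positivity)⟩
    rcases hnoise with h | h
    · exact add_pos_of_pos_of_nonneg (mul_pos h h1) (mul_nonneg hξ₀.le (decay_nonneg _))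
    · exact add_pos_of_nonneg_of_pos
        (mul_nonneg (mul_nonneg (sq_nonneg _) (decay_nonneg _)) h1.le) h
  lam_nonneg := fun α u => hlam _ _ _ _
  heard := hlam_own j k
  pilot := by
    obtain ⟨b, hb⟩ := hd
    refine ⟨b, hx _ _ _, ?_⟩
    simp only [Network.limitScene, ← hb, sub_self, mul_zero, decay, if_true, mul_one]
    exact (Real.exp_pos _).ne'

end Scaling

/-! ### The limit of the SINR -/

/-- The limit in `(0, ∞]` of the quotient of a positive constant by a positive sequence. -/
lemma exists_tendsto_div {p : ℝ} (hp : 0 < p) {f I : ℕ → ℝ} {Δ : ℝ} (hI : Tendsto I atTop (𝓝 Δ))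
    (hf : ∀ᶠ n in atTop, 0 < I n ∧ f n = p / I n) :
    ∃ ℓ : EReal, 0 < ℓ ∧ Tendsto (fun n => (f n : EReal)) atTop (𝓝 ℓ) ∧ (0 < Δ → ℓ ≠ ⊤) := by
  have hΔ : 0 ≤ Δ := ge_of_tendsto hI (hf.mono fun n h => h.1.le)
  have hf' : f =ᶠ[atTop] fun n => p / I n := hf.mono fun n h => h.2
  rcases hΔ.eq_or_lt with h0 | hpos
  · refine ⟨⊤, EReal.coe_lt_top 0 |>.trans_eq rfl, ?_, fun h => absurd h0 h.ne⟩
    rw [EReal.tendsto_coe_nhds_top_iff]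
    have h1 : Tendsto I atTop (𝓝[>] 0) :=
      tendsto_nhdsWithin_iff.2 ⟨h0 ▸ hI, hf.mono fun n h => h.1⟩
    exact ((tendsto_inv_nhdsGT_zero.comp h1).const_mul_atTop hp).congr' hf'.symm
  · refine ⟨((p / Δ : ℝ) : EReal), by exact_mod_cast div_pos hp hpos, ?_,
      fun _ => EReal.coe_ne_top _⟩
    exact EReal.tendsto_coe.2 ((tendsto_const_nhds.div hI hpos.ne').congr' hf'.symm)

section Limit

variable {L K A B T : ℕ}

lemma exists_min_dist (hB : 0 < B) (net : Network L K A B T) {δ₀ : ℝ} (hδ₀ : 0 ≤ δ₀)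
    (t : Fin T) : ∃ b₀, (∀ b, |(t : ℝ) - (net.τ b₀ : ℝ)| ≤ |(t : ℝ) - (net.τ b : ℝ)|) ∧
      (⨅ b : Fin B, δ₀ * |(t : ℝ) - (net.τ b : ℝ)| / 2) =
        δ₀ * |(t : ℝ) - (net.τ b₀ : ℝ)| / 2 := by
  have : Nonempty (Fin B) := ⟨⟨0, hB⟩⟩
  obtain ⟨b₀, h⟩ := Finite.exists_min fun b : Fin B => |(t : ℝ) - (net.τ b : ℝ)|
  refine ⟨b₀, h, le_antisymm (ciInf_le (Set.finite_range _).bddBelow b₀) (le_ciInf fun b => ?_)⟩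
  have := mul_le_mul_of_nonneg_left (h b) hδ₀
  linarith

/-- Common and separate oscillators differ only in the correlation `C` of the phase-drifts at two
different antennas. -/
lemma exists_antenna_correlation (hA : 0 < A) (net : Network L K A B T)
    {κ₀ ξ₀ δ₀ z₁ z₂ z₃ d : ℝ} (hδ₀ : 0 ≤ δ₀) (hz₃ : 0 ≤ z₃)
    {LO Ω : ℕ → Type*} [∀ n, MeasurableSpace (Ω n)]
    (μ : ∀ n, Measure (Ω n)) [∀ n, IsProbabilityMeasure (μ n)]
    (osc : ∀ n, Antenna A n → LO n) (V : ∀ n, Sources L K A n T (LO n) (Ω n))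
    (hmodel : ∀ n, IsModel net (scaledImpairments κ₀ ξ₀ δ₀ z₁ z₂ z₃ (A * n)) (V n) (μ n))
    (t : Fin T) (ht : ∀ b, net.τ b ≠ t) (hd : ∀ b, d ≤ |(t : ℝ) - (net.τ b : ℝ)|)
    (hscale :
      ((∀ n, CommonLO (osc n)) ∧ max z₁ z₂ ≤ 1 / 2 ∧ z₃ = 0) ∨
      ((∀ n, SeparateLOs (osc n)) ∧ max z₁ z₂ + z₃ * (δ₀ * d / 2) ≤ 1 / 2))
    (j : Fin L) :
    ∃ (C : ℕ → Fin B → Fin B → ℝ) (C' : Fin B → Fin B → ℝ),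
      (∀ n a a', a ≠ a' → ∀ b b', ∫ ω, conj (phasor (osc n) (V n) j (net.τ b) a ω) *
        phasor (osc n) (V n) j (net.τ b') a' ω *
        (phasor (osc n) (V n) j t a ω * conj (phasor (osc n) (V n) j t a' ω)) ∂(μ n) = C n b b') ∧
      (∀ n, ∀ v : Fin B → ℂ, ‖∑ b, conj (v b) *
        dataCorr net (scaledImpairments κ₀ ξ₀ δ₀ z₁ z₂ z₃ (A * n)).delta t b‖ ^ 2 ≤
          quad (C n) v) ∧
      (∀ b b', Tendsto (fun n => ((driftScale A δ₀ z₃ d n)⁻¹) ^ 2 * C n b b') atTop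
        (𝓝 (C' b b'))) ∧
      max z₁ z₂ + z₃ * (δ₀ * d / 2) ≤ 1 / 2 ∧
      ((∀ n, CommonLO (osc n)) → 0 < δ₀ → z₃ = 0 ∧ ∀ v : Fin B → ℂ, v ≠ 0 →
        ‖∑ b, conj (v b) * dataCorr net δ₀ t b‖ ^ 2 < quad C' v) := by
  have hδ := fun n => scaledImpairments_delta_nonneg hδ₀ hz₃ κ₀ ξ₀ z₁ z₂ (A * n)
  rcases hscale with ⟨hLO, hz, rfl⟩ | ⟨hLO, hz⟩
  · have hδe : ∀ n, (scaledImpairments κ₀ ξ₀ δ₀ z₁ z₂ 0 (A * n)).delta = δ₀ := fun n => by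
      simp [scaledImpairments]
    refine ⟨fun _ => pilotCorr net δ₀, pilotCorr net δ₀, fun n a a' _ b b' => ?_, fun n v => ?_,
      fun b b' => ?_, ?_, fun _ hδ₀ => ⟨rfl, fun v hv => ?_⟩⟩
    · rw [(hmodel n).integral_phasor_common (hδ n) (osc n) j _ _ t (hLO n a a'), hδe]
      rfl
    · rw [hδe]
      exact sq_norm_le_quad_phaseCorr net.τ t hδ₀ v
    · simp [driftScale]
    · simpa using hz
    · exact sq_norm_lt_quad_phaseCorr net.τ t hδ₀ net.τ.injective ht hv
  · have hlim := fun b => (tendsTo_limitScene (A := A) hA net (κ₀ := 0) (ξ₀ := 0)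
      (z₁ := 0) (z₂ := 0) hδ₀ hz₃ (le_refl (0 : ℝ)) le_rfl le_rfl hd (C := 0) (C' := 0)
      (by simp)).e b
    refine ⟨fun n b b' => dataCorr net (scaledImpairments κ₀ ξ₀ δ₀ z₁ z₂ z₃ (A * n)).delta t b *
      dataCorr net (scaledImpairments κ₀ ξ₀ δ₀ z₁ z₂ z₃ (A * n)).delta t b', _,
      fun n a a' hne b b' => ?_, fun n v => (quad_mul_self _ v).ge, fun b b' =>
      ((hlim b).mul (hlim b')).congr fun n => ?_, hz, fun hCLO => ?_⟩
    · rw [(hmodel n).integral_phasor_separate (hδ n) (osc n) j _ _ t (fun e => hne (hLO n e))]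
      push_cast
      rfl
    · change (driftScale A δ₀ z₃ d n)⁻¹ * _ * ((driftScale A δ₀ z₃ d n)⁻¹ * _) = _
      rw [mul_mul_mul_comm, ← pow_two]
      rfl
    · have h1 : ((⟨0, hA⟩, 0) : Antenna A 2) = (⟨0, hA⟩, 1) := hLO 2 (hCLO 2 _ _)
      simp at h1

/-- The limit of the SINR when the growth exponent of the distortion noise is irrelevant unless
there is distortion noise. -/
theorem tendsto_sinr (hA : 0 < A) (hB : 0 < B) (net : Network L K A B T)
    (hp : ∀ l k, 0 < net.p l k)
    (hlam : ∀ j l k a, 0 ≤ net.lam j l k a)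
    (hlam_own : ∀ j k, ∃ a, 0 < net.lam j j k a)
    (hx : ∀ l k b, net.x l k b ≠ 0)
    {κ₀ ξ₀ δ₀ z₁ z₂ z₃ d : ℝ}
    (hκ₀ : κ₀ = 0 → z₁ = 0) (hξ₀ : 0 < ξ₀) (hδ₀ : 0 ≤ δ₀)
    (hz₁ : 0 ≤ z₁) (hz₂ : 0 ≤ z₂) (hz₃ : 0 ≤ z₃)
    {LO Ω : ℕ → Type*} [∀ n, MeasurableSpace (Ω n)]
    (μ : ∀ n, Measure (Ω n)) [∀ n, IsProbabilityMeasure (μ n)]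
    (osc : ∀ n, Antenna A n → LO n) (V : ∀ n, Sources L K A n T (LO n) (Ω n))
    (hmodel : ∀ n, IsModel net (scaledImpairments κ₀ ξ₀ δ₀ z₁ z₂ z₃ (A * n)) (V n) (μ n))
    (t : Fin T) (ht : ∀ b, net.τ b ≠ t) (hd : ∀ b, d ≤ |(t : ℝ) - (net.τ b : ℝ)|)
    (hd' : ∃ b, d = |(t : ℝ) - (net.τ b : ℝ)|)
    (hscale :
      ((∀ n, CommonLO (osc n)) ∧ max z₁ z₂ ≤ 1 / 2 ∧ z₃ = 0) ∨
      ((∀ n, SeparateLOs (osc n)) ∧ max z₁ z₂ + z₃ * (δ₀ * d / 2) ≤ 1 / 2))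
    (j : Fin L) (k : Fin K) :
    ∃ ℓ : EReal, 0 < ℓ ∧
      Tendsto (fun n => ((sinr net (scaledImpairments κ₀ ξ₀ δ₀ z₁ z₂ z₃ (A * n)) (osc n) (V n)
        (μ n) j k t : ℝ) : EReal)) atTop (𝓝 ℓ) ∧
      ((∃ l m, (l, m) ≠ (j, k) ∧
          ¬ Tendsto (fun n => contamination net (scaledImpairments κ₀ ξ₀ δ₀ z₁ z₂ z₃ (A * n))
            (osc n) (V n) (μ n) j k l m t) atTop (𝓝 0)) → ℓ ≠ ⊤) ∧
      ((∀ l m b, ∃ r : ℝ, 0 < r ∧ net.x l m b = (r : ℂ)) →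
        (∃ l m, (l, m) ≠ (j, k) ∧ ∃ a, 0 < net.lam j j k a ∧ 0 < net.lam j l m a) →
        (0 < z₁ ∨ 0 < z₂ ∨ (0 < δ₀ ∧ 0 < z₃)) → ℓ ≠ ⊤) ∧
      ((∀ n, CommonLO (osc n)) → 0 < δ₀ → ℓ ≠ ⊤) ∧
      (max z₁ z₂ + z₃ * (δ₀ * d / 2) = 1 / 2 → ℓ ≠ ⊤) := by
  obtain ⟨C, C', hC, hCpos, hClim, hz, hCLO⟩ := exists_antenna_correlation hA net hδ₀ hz₃
    μ osc V hmodel t ht hd hscale j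
  set θ := max z₁ z₂ with hθ
  have hθ₁ : z₁ ≤ θ := le_max_left _ _
  have hθ₂ : z₂ ≤ θ := le_max_right _ _
  have hθ0 : 0 ≤ θ := hz₁.trans hθ₁
  have hd0 : 0 ≤ d := by
    obtain ⟨b, rfl⟩ := hd'
    exact abs_nonneg _
  have hγ : 0 ≤ δ₀ * z₃ / 2 := by positivity
  have hγd := mul_nonneg hγ hd0
  have hN : ∀ n : ℕ, 0 < n → (0 : ℝ) < ((A * n : ℕ) : ℝ) := fun n hn => by
    exact_mod_cast Nat.mul_pos hA hn
  have hA' : (0 : ℝ) < A := by exact_mod_cast hA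
  have hlim := tendsTo_limitScene hA net (κ₀ := κ₀) (ξ₀ := ξ₀) hδ₀ hz₃ hθ0 hθ₁ hθ₂ hd hClim
  have hnoise : (0 < κ₀ ^ 2 * decay (θ - z₁)) ∨ 0 < ξ₀ * decay (θ - z₂) := by
    rcases le_total z₁ z₂ with h | h
    · right
      rw [hθ, max_eq_right h, sub_self, decay, if_pos rfl, mul_one]
      exact hξ₀
    · by_cases hκ : κ₀ = 0
      · right
        have : θ = z₂ := by rw [hθ, hκ₀ hκ, max_eq_right hz₂]
        rw [this, sub_self, decay, if_pos rfl, mul_one]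
        exact hξ₀
      · left
        rw [hθ, max_eq_left h, sub_self, decay, if_pos rfl, mul_one]
        positivity
  have ha := admissible_limitScene hlam hlam_own hx hξ₀ hδ₀ hz₃ hd' hlim hCpos hnoise j k
  set s' := net.limitScene κ₀ ξ₀ δ₀ z₁ z₂ z₃ θ d C' t with hs'
  have hδ := fun n => scaledImpairments_delta_nonneg hδ₀ hz₃ κ₀ ξ₀ z₁ z₂ (A * n)
  have hκ : ∀ n, 0 ≤ (scaledImpairments κ₀ ξ₀ δ₀ z₁ z₂ z₃ (A * n)).kappaSq := fun n =>
    mul_nonneg (sq_nonneg _) (Real.rpow_nonneg (Nat.cast_nonneg _) _)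
  have hξ : ∀ n, 0 < n → 0 < (scaledImpairments κ₀ ξ₀ δ₀ z₁ z₂ z₃ (A * n)).xi := fun n hn =>
    mul_pos hξ₀ (Real.rpow_pos_of_pos (hN n hn) _)
  have hρ : ∀ n, 0 < n → 0 < noiseScale A θ n := fun n hn => Real.rpow_pos_of_pos (hN n hn) _
  have hσ : ∀ n, 0 < n → 0 < driftScale A δ₀ z₃ d n := fun n hn =>
    Real.rpow_pos_of_pos (hN n hn) _
  -- the weights that rescaling turns into `1 / n`; they are powers of `N`, with exponents that the
  -- scaling law makes nonpositive
  set ν₁ : ℕ → ℝ := fun n => noiseScale A θ n / (driftScale A δ₀ z₃ d n ^ 2 * n) with hν₁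
  set ν₃ : ℕ → ℝ := fun n => noiseScale A θ n ^ 2 / (driftScale A δ₀ z₃ d n ^ 2 * n) with hν₃
  have hpow : ∀ n : ℕ, 0 < n → ∀ i : ℕ, noiseScale A θ n ^ i / (driftScale A δ₀ z₃ d n ^ 2 * n) =
      A * ((A * n : ℕ) : ℝ) ^ (-(1 - i * θ - 2 * (δ₀ * z₃ / 2 * d))) := fun n hn i => by
    have hn' : (0 : ℝ) < n := by exact_mod_cast hn
    have h0 := hN n hn
    have e1 : noiseScale A θ n ^ i = ((A * n : ℕ) : ℝ) ^ (i * θ) := by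
      rw [noiseScale, ← Real.rpow_natCast, ← Real.rpow_mul h0.le, mul_comm θ]
    have e2 : (driftScale A δ₀ z₃ d n ^ 2)⁻¹ = ((A * n : ℕ) : ℝ) ^ (2 * (δ₀ * z₃ / 2 * d)) := by
      rw [driftScale, ← Real.rpow_natCast, ← Real.rpow_mul h0.le, ← Real.rpow_neg h0.le]
      congr 1
      push_cast
      ring
    have e3 : (n : ℝ)⁻¹ = A * ((A * n : ℕ) : ℝ) ^ (-1 : ℝ) := by
      rw [Real.rpow_neg_one]
      push_cast
      field_simp
    rw [div_eq_mul_inv, mul_inv, e1, e2, e3, mul_left_comm _ (A : ℝ), mul_left_comm _ (A : ℝ),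
      ← Real.rpow_add h0, ← Real.rpow_add h0]
    congr 2
    ring
  have hlim₁ : Tendsto ν₁ atTop (𝓝 (A * decay (1 - (1 : ℕ) * θ - 2 * (δ₀ * z₃ / 2 * d)))) := by
    refine ((tendsto_decay hA (by push_cast; linarith)).const_mul _).congr' ?_
    filter_upwards [eventually_gt_atTop 0] with n hn
    rw [hν₁, ← hpow n hn, pow_one]
  have hlim₃ : Tendsto ν₃ atTop (𝓝 (A * decay (1 - (2 : ℕ) * θ - 2 * (δ₀ * z₃ / 2 * d)))) := by
    refine ((tendsto_decay hA (by push_cast; linarith)).const_mul _).congr' ?_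
    filter_upwards [eventually_gt_atTop 0] with n hn
    rw [hν₃, ← hpow n hn]
  have hlim₂ : Tendsto (fun n : ℕ => (1 / n : ℝ)) atTop (𝓝 0) := tendsto_one_div_atTop_nhds_zero_nat
  set Δ := s'.interference (net.lamAt j) net.pilot (j, k) net.power
    (A * decay (1 - (1 : ℕ) * θ - 2 * (δ₀ * z₃ / 2 * d))) 0
    (A * decay (1 - (2 : ℕ) * θ - 2 * (δ₀ * z₃ / 2 * d))) with hΔ
  have hI := hlim.interference ha net.power hlim₁ hlim₂ hlim₃
  have hsinr : ∀ᶠ n in atTop, 0 < (net.rescaled κ₀ ξ₀ δ₀ z₁ z₂ z₃ θ d C t n).interference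
      (net.lamAt j) net.pilot (j, k) net.power (ν₁ n) (1 / n) (ν₃ n) ∧
      sinr net (scaledImpairments κ₀ ξ₀ δ₀ z₁ z₂ z₃ (A * n)) (osc n) (V n) (μ n) j k t =
        net.p j k / (net.rescaled κ₀ ξ₀ δ₀ z₁ z₂ z₃ θ d C t n).interference
          (net.lamAt j) net.pilot (j, k) net.power (ν₁ n) (1 / n) (ν₃ n) := by
    filter_upwards [eventually_gt_atTop 0] with n hn
    have hρn := hρ n hn
    have hσn := hσ n hn
    have h := (hmodel n).sinr_eq (C := C n) hn (hκ n) (hξ n hn) (hδ n) hlam hp ht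
      (admissible_scene hB (hκ n) (hξ n hn) (hδ n) hlam hlam_own hx (hCpos n) j k)
      (hC n)
    rw [Network.rescaled, Scene.interference_scale (inv_ne_zero hρn.ne') (inv_ne_zero hσn.ne')]
    have e1 : (noiseScale A θ n)⁻¹ / (driftScale A δ₀ z₃ d n)⁻¹ ^ 2 * ν₁ n = 1 / n := by
      simp only [hν₁]
      field_simp
    have e3 : (noiseScale A θ n)⁻¹ ^ 2 / (driftScale A δ₀ z₃ d n)⁻¹ ^ 2 * ν₃ n = 1 / n := by
      simp only [hν₃]
      field_simp
    rw [e1, e3]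
    exact h
  obtain ⟨ℓ, hℓ, hℓlim, hℓtop⟩ := exists_tendsto_div (hp j k) hI hsinr
  have hpos := ha.interference_pos (p := net.power) (fun u => hp u.1 u.2)
    (mul_nonneg hA'.le (decay_nonneg (1 - (1 : ℕ) * θ - 2 * (δ₀ * z₃ / 2 * d))))
    (mul_nonneg hA'.le (decay_nonneg (1 - (2 : ℕ) * θ - 2 * (δ₀ * z₃ / 2 * d))))
  refine ⟨ℓ, hℓ, hℓlim, ?_, ?_, fun hLO hδ₀' => hℓtop (hpos (Or.inr (Or.inl ?_))),
    fun heq => hℓtop (hpos (Or.inr (Or.inr ⟨?_, hnoise⟩)))⟩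
  · rintro ⟨l, m, hne, hcont⟩
    refine hℓtop (hpos (Or.inl ⟨(l, m), hne, fun h0 => hcont ?_⟩))
    have h1 := ((hlim.mean ha (l, m)).norm.div (hlim.gain ha) ha.gain_pos.ne')
    rw [h0, norm_zero, zero_div] at h1
    refine h1.congr' ?_
    filter_upwards [eventually_gt_atTop 0] with n hn
    have hρn := hρ n hn
    have hσn := hσ n hn
    have hc : 0 < (driftScale A δ₀ z₃ d n)⁻¹ ^ 2 / (noiseScale A θ n)⁻¹ := by positivity
    simp only [Pi.div_apply]
    rw [(hmodel n).contamination_eq (C := C n) hn (hκ n) (hξ n hn) (hδ n) hlam, Network.rescaled,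
      Scene.mean_scale (inv_ne_zero hρn.ne'), Scene.gain_scale (inv_ne_zero hρn.ne'), norm_mul,
      Complex.norm_real, Real.norm_of_nonneg hc.le, mul_div_mul_left _ _ hc.ne']
  · rintro hreal ⟨l, m, hne, α, hk, hm⟩ hgrow
    refine hℓtop (hpos (Or.inl ⟨(l, m), hne, ha.mean_ne_zero_of_diagonal (fun b b' hbb => ?_)
      (fun b => ?_) (fun b => ?_) (fun u b => hreal u.1 u.2 b) ⟨α, hk, hm⟩⟩))
    · have hτ : 0 < |(net.τ b : ℝ) - (net.τ b' : ℝ)| := by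
        rw [abs_pos, sub_ne_zero]
        intro h
        exact hbb (net.τ.injective (Fin.ext (by exact_mod_cast h)))
      have : 0 < δ₀ * z₃ / 2 * |(net.τ b : ℝ) - (net.τ b' : ℝ)| + θ := by
        have h0 := mul_nonneg hγ hτ.le
        rcases hgrow with h | h | ⟨h, h'⟩
        · linarith
        · linarith
        · have : 0 < δ₀ * z₃ / 2 * |(net.τ b : ℝ) - (net.τ b' : ℝ)| := by positivity
          linarith
      simp only [hs', Network.limitScene, decay, if_neg this.ne', mul_zero]
    · exact mul_nonneg (Real.exp_pos _).le (decay_nonneg _)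
    · exact mul_nonneg (Real.exp_pos _).le (decay_nonneg _)
  · obtain ⟨rfl, hlt⟩ := hCLO hLO hδ₀'
    have he : ∀ b, s'.e b = dataCorr net δ₀ t b := fun b => by
      simp [hs', Network.limitScene, decay]
    have h1 := ha.sq_norm_mean_self
    rw [Scene.Admissible.mean_eq] at h1 ⊢
    simp only [he] at h1 ⊢
    refine hlt _ fun h0 => ?_
    have h2 : ∀ b, ∑ α, s'.seen (net.lamAt j) net.pilot (j, k) (j, k) α b = 0 := fun b =>
      congrFun h0 b
    simp only [h2, map_zero, zero_mul, Finset.sum_const_zero, norm_zero] at h1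
    have := ha.gain_pos
    nlinarith
  · have : 1 - ((2 : ℕ) : ℝ) * θ - 2 * (δ₀ * z₃ / 2 * d) = 0 := by push_cast; linarith
    rw [this, decay, if_pos rfl, mul_one]
    exact hA'

end Limit

end MassiveMIMO

theorem corollary4 {L K A B T : ℕ} (hA : 0 < A) (hB : 0 < B)
    (net : MassiveMIMO.Network L K A B T)
    (hp : ∀ l k, 0 < net.p l k)
    (hlam : ∀ j l k a, 0 ≤ net.lam j l k a)
    (hlam_own : ∀ j k, ∃ a, 0 < net.lam j j k a)
    (hx : ∀ l k b, net.x l k b ≠ 0)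
    (κ₀ ξ₀ δ₀ z₁ z₂ z₃ : ℝ)
    (hκ₀ : 0 ≤ κ₀) (hξ₀ : 0 < ξ₀) (hδ₀ : 0 ≤ δ₀)
    (hz₁ : 0 ≤ z₁) (hz₂ : 0 ≤ z₂) (hz₃ : 0 ≤ z₃)
    -- for each number `n` of antennas per subarray, a realization of the model, with `N = A * n`
    {LO Ω : ℕ → Type*} [∀ n, MeasurableSpace (Ω n)]
    (μ : ∀ n, Measure (Ω n)) [∀ n, IsProbabilityMeasure (μ n)]
    (osc : ∀ n, MassiveMIMO.Antenna A n → LO n)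
    (V : ∀ n, MassiveMIMO.Sources L K A n T (LO n) (Ω n))
    (imp : ℕ → MassiveMIMO.Impairments)
    (himp : ∀ n, imp n = MassiveMIMO.scaledImpairments κ₀ ξ₀ δ₀ z₁ z₂ z₃ (A * n))
    (hmodel : ∀ n, MassiveMIMO.IsModel net (imp n) (V n) (μ n))
    -- a data time
    (t : Fin T) (ht : ∀ b, net.τ b ≠ t)
    -- the scaling law, for a common LO and for separate LOs
    (hscale :
      ((∀ n, MassiveMIMO.CommonLO (osc n)) ∧ max z₁ z₂ ≤ 1 / 2 ∧ z₃ = 0) ∨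
      ((∀ n, MassiveMIMO.SeparateLOs (osc n)) ∧
        max z₁ z₂ + z₃ * (⨅ b : Fin B, δ₀ * |(t : ℝ) - (net.τ b : ℝ)| / 2) ≤ 1 / 2))
    (j : Fin L) (k : Fin K) :
    ∃ ℓ : EReal, 0 < ℓ ∧
      Tendsto (fun n => ((MassiveMIMO.sinr net (imp n) (osc n) (V n) (μ n) j k t : ℝ) : EReal))
        atTop (𝓝 ℓ) ∧
      -- the limit is finite if some pilot contamination persists
      ((∃ l m, (l, m) ≠ (j, k) ∧
          ¬ Tendsto (fun n => MassiveMIMO.contamination net (imp n) (osc n) (V n) (μ n) j k l m t)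
            atTop (𝓝 0)) → ℓ ≠ ⊤) ∧
      -- or if the pilot symbols are positive, another UE is heard by a subarray that also hears
      -- UE `k` of cell `j`, and some imperfection grows
      ((∀ l m b, ∃ r : ℝ, 0 < r ∧ net.x l m b = (r : ℂ)) →
        (∃ l m, (l, m) ≠ (j, k) ∧ ∃ a, 0 < net.lam j j k a ∧ 0 < net.lam j l m a) →
        ((0 < κ₀ ∧ 0 < z₁) ∨ 0 < z₂ ∨ (0 < δ₀ ∧ 0 < z₃)) → ℓ ≠ ⊤) ∧
      -- or with a common LO that drifts
      ((∀ n, MassiveMIMO.CommonLO (osc n)) → 0 < δ₀ → ℓ ≠ ⊤) ∧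
      -- or if the scaling law holds with equality
      (max z₁ z₂ + z₃ * (⨅ b : Fin B, δ₀ * |(t : ℝ) - (net.τ b : ℝ)| / 2) = 1 / 2 →
        (0 < κ₀ ∨ z₁ ≤ z₂) → ℓ ≠ ⊤) := by
  obtain ⟨b₀, hmin, hinf⟩ := MassiveMIMO.exists_min_dist hB net hδ₀ t
  rw [hinf] at hscale ⊢
  -- without distortion noise its growth exponent is irrelevant and may be replaced by zero
  obtain ⟨z₁', hz₁', himp', h0, h1, hle⟩ : ∃ z₁' : ℝ, 0 ≤ z₁' ∧
      (∀ N, MassiveMIMO.scaledImpairments κ₀ ξ₀ δ₀ z₁ z₂ z₃ N =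
        MassiveMIMO.scaledImpairments κ₀ ξ₀ δ₀ z₁' z₂ z₃ N) ∧
      (κ₀ = 0 → z₁' = 0) ∧ (0 < κ₀ → z₁' = z₁) ∧ z₁' ≤ z₁ := by
    rcases hκ₀.eq_or_lt with h | h
    · exact ⟨0, le_rfl, fun N => by simp [MassiveMIMO.scaledImpairments, ← h], fun _ => rfl,
        fun h' => absurd h h'.ne, hz₁⟩
    · exact ⟨z₁, hz₁, fun N => rfl, fun h' => absurd h' h.ne', fun _ => rfl, le_rfl⟩
  have hmax : max z₁' z₂ ≤ max z₁ z₂ := max_le_max hle le_rfl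
  obtain ⟨ℓ, hℓ, hlim, c1, c2, c3, c4⟩ := MassiveMIMO.tendsto_sinr hA hB net hp hlam hlam_own hx
    h0 hξ₀ hδ₀ hz₁' hz₂ hz₃ μ osc V (fun n => by rw [← himp', ← himp]; exact hmodel n) t ht hmin
    ⟨b₀, rfl⟩ (hscale.imp (fun h => ⟨h.1, hmax.trans h.2.1, h.2.2⟩)
      (fun h => ⟨h.1, (add_le_add_left hmax _).trans h.2⟩)) j k
  simp only [← himp', ← himp] at hlim c1
  refine ⟨ℓ, hℓ, hlim, c1, fun hr hu hg => c2 hr hu ?_, c3, fun heq hκ => c4 ?_⟩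
  · rcases hg with ⟨h, h'⟩ | h | h
    · exact Or.inl (by rw [h1 h]; exact h')
    · exact Or.inr (Or.inl h)
    · exact Or.inr (Or.inr h)
  · have : max z₁' z₂ = max z₁ z₂ := by
      rcases hκ with h | h
      · rw [h1 h]
      · rw [max_eq_right h, max_eq_right (hle.trans h)]
    rw [this]
    exact heq
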